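/- Let $n\ge 2$ and, for $z\in\mathbb C\setminus\mathbb R$, let $R_0(z)=(-\Delta-z)^{-1}$ be the free resolvent on $L^2(\mathbb R^n)$. For a measurable weight $w\ge0$ let $\|f\|_{L^2(w)}=(\int|f|^2w)^{1/2}$; for functions of $(t,x)\in\mathbb R\times\mathbb R^n$ and a weight $w=w(x)$, $\|f\|_{L^2_{t,x}(w)}=(\int_{\mathbb R}\int_{\mathbb R^n}|f|^2w\,dx\,dt)^{1/2}$. (With $|V|^{-1}=\infty$ on $\{V=0\}$ and $0\cdot\infty=0$.) A class $\mathcal R$ of measurable potentials $V:\mathbb R^n\to\mathbb C$, equipped with a function $[\,\cdot\,]_{\mathcal R}\ge 0$, is called of resolvent type if there is a constant $A$ depending only on the class such that $$\|R_0(z)f\|_{L^2(|V|)}\le A\,[V]_{\mathcal R}\,\|f\|_{L^2(|V|^{-1})}$$ for all $V\in\mathcal R$, $z\in\mathbb C\setminus\mathbb R$ and $f\in L^2\cap L^2(|V|^{-1})$. Consider the Cauchy problem on $\mathbb R\times\mathbb R^n$ $$i\partial_tu+\Delta u-V(x)u=F(x,t),\qquad u(x,0)=u_0(x),$$ where a solution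 in $L^2_{t,x}(|V|)$ is a function $u\in L^2_{t,x}(|V|)$, with $u(\cdot,t)$ locally integrable for a.e. $t$, satisfying for a.e. $t\in\mathbb R$, as distributions on $\mathbb R^n$, Duhamel's formula $$u(\cdot,t)=e^{it\Delta}u_0-i\int_0^te^{i(t-s)\Delta}\big(Vu+F\big)(\cdot,s)\,ds .$$ Here the integral is understood by pairing with test functions, $\langle e^{i\tau\Delta}G,\psi\rangle=\langle G,e^{i\tau\Delta}\psi\rangle$. **Theorem.** Let $\mathcal R$ be a class of resolvent type. There are constants $\varepsilon>0$ and $C$, depending only on $n$ and the class, such that the following holds for every $V\in\mathcal R$ with $[V]_{\mathcal R}<\varepsilon$. If $u_0\in L^2(\mathbb R^n)$ and $F\in L^2_{t,x}(|V|^{-1})$, then the Cauchy problem has a solution $u$ in $L^2_{t,x}(|V|)$, and it is unique up to equality a.e. on $\mathbb R\times\mathbb R^n$. Furthermore $u$ belongs to $C_t L^2_x$ (it has a representative that is continuous from $\mathbb R$ to $L^2(\mathbb R^n)$), it satisfies $u(\cdot,0)=u_0$, and it satisfies the differential equation weakly, i.e. for every Schwartz function $\psi$ on $\mathbb R^n$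 and every $t\in\mathbb R$ $$\int u(t)\psi\,dx=\int u_0\psi\,dx+i\int_0^t\!\!\int u(s)\,\Delta\psi\,dx\,ds-i\int_0^t\!\!\int\big(Vu+F\big)(s)\,\psi\,dx\,ds .$$ Moreover $$\|u\|_{L^2_{t,x}(|V|)}\le C[V]_{\mathcal R}^{1/2}\|u_0\|_{L^2}+C[V]_{\mathcal R}\|F\|_{L^2_{t,x}(|V|^{-1})}$$ and $$\sup_{t\in\mathbb R}\|u(t)\|_{L^2_x}\le C\|u_0\|_{L^2}+C[V]_{\mathcal R}^{1/2}\|F\|_{L^2_{t,x}(|V|^{-1})}.$$ -/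

import Mathlib

open MeasureTheory Filter Topology
open scoped ENNReal NNReal FourierTransform SchwartzMap Laplacian

noncomputable section

/-- The norm of the weighted space `L²(w dμ)`, i.e. `(∫ |f|² w dμ)^{1/2}`, as an extended
nonnegative real number. The weight may take the values `0` and `∞`, and `0 · ∞ = 0`, so that
`f` has to vanish almost everywhere on `{w = ∞}` for the norm to be finite. -/
def weightedL2Norm {X : Type*} [MeasurableSpace X] (μ : Measure X) (w : X → ℝ≥0∞)
    (f : X → ℂ) : ℝ≥0∞ :=
  (∫⁻ x, ‖f x‖ₑ ^ 2 * w x ∂μ) ^ (1 / 2 : ℝ)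

/-- `f` is measurable and has finite weighted `L²(w dμ)` norm. -/
def MemWeightedL2 {X : Type*} [MeasurableSpace X] (μ : Measure X) (w : X → ℝ≥0∞)
    (f : X → ℂ) : Prop :=
  AEStronglyMeasurable f μ ∧ weightedL2Norm μ w f < ∞

/-- The space `L²(ℝⁿ)` of complex-valued functions. -/
abbrev L2Space (n : ℕ) : Type :=
  Lp ℂ 2 (volume : Measure (EuclideanSpace ℝ (Fin n)))

/-- The Fourier multiplier operator `f ↦ 𝓕⁻¹ (m · 𝓕 f)` on `L²(ℝⁿ)` with bounded symbol `m`. -/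
def fourierMultiplierL2 {n : ℕ} (m : EuclideanSpace ℝ (Fin n) → ℂ) (hm : MemLp m ∞ volume)
    (f : L2Space n) : L2Space n :=
  𝓕⁻ (((Lp.memLp (𝓕 f)).mul' hm).toLp (fun ξ => m ξ * (𝓕 f : L2Space n) ξ) : L2Space n)

/-- The symbol of `(-Δ - z)⁻¹`; as the Fourier transform is normalised with `e^{-2πi⟨x,ξ⟩}`, the
symbol of `-Δ` is `4π²|ξ|²`. -/
def resolventSymbol {n : ℕ} (z : ℂ) (ξ : EuclideanSpace ℝ (Fin n)) : ℂ :=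
  (((4 * Real.pi ^ 2 * ‖ξ‖ ^ 2 : ℝ) : ℂ) - z)⁻¹

theorem resolventSymbol_memLp {n : ℕ} {z : ℂ} (hz : z.im ≠ 0) :
    MemLp (resolventSymbol (n := n) z) ∞ volume := by
  refine memLp_top_of_bound ?_ (|z.im|⁻¹) (Eventually.of_forall fun ξ => ?_)
  · have h : Measurable (resolventSymbol (n := n) z) := by
      unfold resolventSymbol
      fun_prop
    exact h.aestronglyMeasurable
  · unfold resolventSymbol
    rw [norm_inv]
    refine inv_anti₀ (abs_pos.mpr hz) ?_
    have h := Complex.abs_im_le_norm (((4 * Real.pi ^ 2 * ‖ξ‖ ^ 2 : ℝ) : ℂ) - z)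
    rwa [Complex.sub_im, Complex.ofReal_im, zero_sub, abs_neg] at h

/-- The free resolvent `R₀(z) = (-Δ - z)⁻¹` on `L²(ℝⁿ)`, for `z ∈ ℂ \ ℝ`. -/
def freeResolvent {n : ℕ} (z : ℂ) (hz : z.im ≠ 0) (f : L2Space n) : L2Space n :=
  fourierMultiplierL2 (resolventSymbol z) (resolventSymbol_memLp hz) f

/-- The symbol `e^{-4π²it|ξ|²}` of the free Schrödinger propagator `e^{itΔ}`. -/
def propagatorSymbol {n : ℕ} (t : ℝ) (ξ : EuclideanSpace ℝ (Fin n)) : ℂ :=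
  Complex.exp (-((4 * Real.pi ^ 2 * t * ‖ξ‖ ^ 2 : ℝ) : ℂ) * Complex.I)

theorem propagatorSymbol_memLp {n : ℕ} (t : ℝ) :
    MemLp (propagatorSymbol (n := n) t) ∞ volume := by
  refine memLp_top_of_bound ?_ 1 (Eventually.of_forall fun ξ => ?_)
  · have h : Continuous (propagatorSymbol (n := n) t) := by
      unfold propagatorSymbol
      fun_prop
    exact h.aestronglyMeasurable
  · unfold propagatorSymbol
    rw [← Complex.ofReal_neg, Complex.norm_exp_ofReal_mul_I]

/-- The free Schrödinger propagator `e^{itΔ}` on `L²(ℝⁿ)`. -/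
def freePropagator {n : ℕ} (t : ℝ) (f : L2Space n) : L2Space n :=
  fourierMultiplierL2 (propagatorSymbol t) (propagatorSymbol_memLp t) f

/-- The free Schrödinger propagator on a Schwartz function, given pointwise by the Fourier
integral `e^{itΔ}ψ(x) = ∫ e^{2πi⟨x,ξ⟩} e^{-4π²it|ξ|²} ψ̂(ξ) dξ`. -/
def propagatorOnTest {n : ℕ} (t : ℝ) (ψ : 𝓢(EuclideanSpace ℝ (Fin n), ℂ)) :
    EuclideanSpace ℝ (Fin n) → ℂ :=
  𝓕⁻ (fun ξ => propagatorSymbol t ξ * 𝓕 (ψ : EuclideanSpace ℝ (Fin n) → ℂ) ξ)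

/-- The class `R` of potentials, with the quantity `br V = [V]_R`, is of resolvent type: up to a
constant depending only on the class, `‖R₀(z) f‖_{L²(|V|)} ≤ [V]_R ‖f‖_{L²(|V|⁻¹)}` holds
for all `V ∈ R`, uniformly in `z ∈ ℂ \ ℝ`. -/
def IsResolventType {n : ℕ} (R : Set (EuclideanSpace ℝ (Fin n) → ℂ))
    (br : (EuclideanSpace ℝ (Fin n) → ℂ) → ℝ≥0) : Prop :=
  (∀ V ∈ R, AEStronglyMeasurable V volume) ∧
  ∃ A : ℝ≥0, ∀ V ∈ R, ∀ (z : ℂ) (hz : z.im ≠ 0) (f : L2Space n),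
    MemWeightedL2 volume (fun x => ‖V x‖ₑ⁻¹) f →
    weightedL2Norm volume (fun x => ‖V x‖ₑ) (freeResolvent z hz f) ≤
      (A : ℝ≥0∞) * (br V : ℝ≥0∞) * weightedL2Norm volume (fun x => ‖V x‖ₑ⁻¹) f

/-- `u` is a solution, in the space-time space `L²(|V|)`, of the integral (Duhamel) form
`u(t) = e^{itΔ} u₀ - i ∫₀ᵗ e^{i(t-s)Δ} (V u + F)(s) ds` of the Cauchy problem
`i ∂ₜu + Δu - V u = F`, `u(0) = u₀` on `ℝ × ℝⁿ`. The identity is one of distributions on `ℝⁿ`,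
for almost every time `t`; under the integral sign, `e^{i(t-s)Δ}` acts on the distribution
`(V u + F)(s)` by transposition, `⟨e^{iτΔ} G, ψ⟩ = ⟨G, e^{iτΔ} ψ⟩`. -/
structure IsDuhamelSolution {n : ℕ} (V : EuclideanSpace ℝ (Fin n) → ℂ)
    (F : ℝ × EuclideanSpace ℝ (Fin n) → ℂ) (u₀ : L2Space n)
    (u : ℝ × EuclideanSpace ℝ (Fin n) → ℂ) : Prop where
  memWeightedL2 : MemWeightedL2 volume (fun p => ‖V p.2‖ₑ) u
  locallyIntegrable : ∀ᵐ t : ℝ, LocallyIntegrable (fun x => u (t, x)) volume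
  duhamel : ∀ᵐ t : ℝ, ∀ ψ : 𝓢(EuclideanSpace ℝ (Fin n), ℂ), HasCompactSupport ψ →
    IntegrableOn
      (fun p : ℝ × EuclideanSpace ℝ (Fin n) =>
        (V p.2 * u p + F p) * propagatorOnTest (t - p.1) ψ p.2)
      (Set.uIcc 0 t ×ˢ Set.univ) volume ∧
    ∫ x, u (t, x) * ψ x =
      (∫ x, freePropagator t u₀ x * ψ x) -
        Complex.I * ∫ s in (0 : ℝ)..t, ∫ x,
          (V x * u (s, x) + F (s, x)) * propagatorOnTest (t - s) ψ x

/-- The curve `U` in `L²(ℝⁿ)`, with space-time representative `u`, satisfies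
`i ∂ₜu + Δu - V u = F` weakly: for every Schwartz function `ψ` on `ℝⁿ` and every time `t`,
`⟨U(t), ψ⟩ = ⟨U(0), ψ⟩ + i ∫₀ᵗ ⟨U(s), Δψ⟩ ds - i ∫₀ᵗ ⟨(V u + F)(s), ψ⟩ ds`. -/
def SolvesWeakly {n : ℕ} (V : EuclideanSpace ℝ (Fin n) → ℂ)
    (F : ℝ × EuclideanSpace ℝ (Fin n) → ℂ) (u : ℝ × EuclideanSpace ℝ (Fin n) → ℂ)
    (U : ℝ → L2Space n) : Prop :=
  ∀ (t : ℝ) (ψ : 𝓢(EuclideanSpace ℝ (Fin n), ℂ)),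
    IntegrableOn
      (fun p : ℝ × EuclideanSpace ℝ (Fin n) => (V p.2 * u p + F p) * ψ p.2)
      (Set.uIcc 0 t ×ˢ Set.univ) volume ∧
    ∫ x, U t x * ψ x =
      (∫ x, U 0 x * ψ x) + Complex.I * (∫ s in (0 : ℝ)..t, ∫ x, U s x * (Δ ψ) x) -
        Complex.I * ∫ s in (0 : ℝ)..t, ∫ x, (V x * u (s, x) + F (s, x)) * ψ x

end

/-! ### Consistency of the inverse Fourier transform on L¹ ∩ L² -/

section FourierLp

variable {E F : Type*} [NormedAddCommGroup E] [InnerProductSpace ℝ E] [FiniteDimensional ℝ E]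
  [MeasurableSpace E] [BorelSpace E]
  [NormedAddCommGroup F] [InnerProductSpace ℂ F] [CompleteSpace F]

/-! Write b = |V|^{1/2} and a = A [V]. The resolvent estimate says that b R₀(z) b is bounded by a on
L², uniformly in z in both half-planes. This is turned into two space-time bounds: Kato smoothing, f
↦ b e^{itΔ} f, with norm √(2a), and the sandwiched Duhamel operator g ↦ b ∫₀ᵗ e^{i(t-s)Δ} b g(s) ds,
with norm 2a.

For the second bound, damp the causal evolution ∫_{s<t} by e^{-εr}, r = t - s. It is a convolution
in time whose Fourier multiplier at τ is b times the Laplace transform of the group times b, that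
is, b R₀(z) b up to a unimodular factor. Plancherel for Hilbert-valued functions bounds it by a, and
ε → 0 removes the damping (`UnitaryFlow.causal_bound`); reversing time uses the other half-plane
(`UnitaryFlow.anticausal_bound`). The integral ∫₀ᵗ is a causal evolution of the source at positive
times minus an anticausal one of the source at nonpositive times, whence 2a. Kato smoothing is the
TT* argument (`UnitaryFlow.smoothing_bound`): TT* is the sum of the causal and the anticausal
evolution.

Since b is unbounded, this is done with b cut off to {|V| ≤ N}, with bounds independent of N, and
Fatou's lemma lets N → ∞. The Duhamel integral itself is defined through the adjoint of the
smoothing operator.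

Finally F = b f with f in L², and V = b · (V/|V|) · b. Duhamel's formula for u becomes a fixed-point
equation for v = b u in L²(ℝ × ℝⁿ), a contraction as soon as 2a ≤ 1/2. Every solution u produces a
fixed point b u, and u is recovered from b u by the formula, so uniqueness follows as well.
Continuity in time comes from the dual smoothing bound; the distributional statements come from
moving the propagator onto the test function. -/

theorem integral_fourierInv_smul_eq_of_integrable {f : E → ℂ} {g : E → F} (hf : Integrable f)
    (hg : Integrable g) : ∫ x, (𝓕⁻ f x) • g x = ∫ x, f x • 𝓕⁻ g x := by
  have h := VectorFourier.integral_fourierIntegral_smul_eq_flip (L := -innerₗ E) (μ := volume)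
    (ν := volume) Real.continuous_fourierChar continuous_inner.neg hf hg
  have e : (-innerₗ E).flip = -innerₗ E := by
    ext x y; simp [real_inner_comm]
  rw [e] at h
  exact h

set_option linter.unusedSectionVars false in
theorem continuous_fourierInv_of_integrable {g : E → F} (hg : Integrable g) :
    Continuous (𝓕⁻ g) :=
  VectorFourier.fourierIntegral_continuous Real.continuous_fourierChar continuous_inner.neg hg

/-- On `L¹ ∩ L²` the inverse Fourier transform of `L²` is the inverse Fourier integral. -/
theorem fourierInv_toLp_ae_eq {h : E → F} (h₁ : Integrable h) (h₂ : MemLp h 2) :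
    (𝓕⁻ (h₂.toLp h) : Lp F 2 (volume : Measure E)) =ᵐ[volume] 𝓕⁻ h := by
  refine ae_eq_of_integral_contDiff_smul_eq
    ((Lp.memLp _).locallyIntegrable (by norm_num))
    (continuous_fourierInv_of_integrable h₁).locallyIntegrable fun g hg hgs => ?_
  let ψ : 𝓢(E, ℂ) := (hgs.comp_left (g := Complex.ofReal) rfl).toSchwartzMap
    (Complex.ofRealCLM.contDiff.comp hg)
  have hψ : ∀ x, ψ x = (g x : ℂ) := fun x => rfl
  -- The L² transform agrees with that of tempered distributions, so both sides can be compared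
  -- through their action on ψ.
  have key := congrArg (fun T : 𝓢'(E, F) => T ψ)
    (Lp.fourierInv_toTemperedDistribution_eq (h₂.toLp h))
  simp only [TemperedDistribution.fourierInv_apply, Lp.toTemperedDistribution_apply] at key
  have e1 : ∫ x, (𝓕⁻ ψ) x • (h₂.toLp h) x = ∫ x, (𝓕⁻ (ψ : E → ℂ)) x • h x := by
    refine integral_congr_ae ?_
    filter_upwards [h₂.coeFn_toLp] with x hx
    rw [hx, SchwartzMap.fourierInv_coe]
  rw [e1, integral_fourierInv_smul_eq_of_integrable ψ.integrable h₁] at key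
  simpa [hψ] using key.symm

end FourierLp

/-! ### Functions in L²(T × X) as curves in L²(X), and conversely -/

section Slices

theorem eLpNorm_two_sq {α F : Type*} [MeasurableSpace α] [NormedAddCommGroup F] (μ : Measure α)
    (f : α → F) : eLpNorm f 2 μ ^ 2 = ∫⁻ x, ‖f x‖ₑ ^ 2 ∂μ := by
  have h := eLpNorm_nnreal_pow_eq_lintegral (p := 2) (f := f) (μ := μ) (by norm_num)
  simpa using h

theorem eLpNorm_two_eq {α F : Type*} [MeasurableSpace α] [NormedAddCommGroup F] (μ : Measure α)
    (f : α → F) : eLpNorm f 2 μ = (∫⁻ x, ‖f x‖ₑ ^ 2 ∂μ) ^ (1 / 2 : ℝ) := by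
  rw [← eLpNorm_two_sq, ← ENNReal.rpow_natCast, ← ENNReal.rpow_mul]
  norm_num

/-- By Lindelöf an open set is a countable union of balls, and the preimage of a ball is a sublevel
set of a distance function. -/
theorem measurable_of_measurable_edist {α Y : Type*} [MeasurableSpace α] [PseudoEMetricSpace Y]
    [SecondCountableTopology Y] [MeasurableSpace Y] [BorelSpace Y] {γ : α → Y}
    (h : ∀ y, Measurable fun a => edist (γ a) y) : Measurable γ := by
  refine measurable_of_isOpen fun O hO => ?_
  have hr : ∀ y : O, ∃ r > 0, Metric.eball (y : Y) r ⊆ O := fun y =>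
    EMetric.isOpen_iff.1 hO y y.2
  choose r hr0 hrO using hr
  obtain ⟨S, hS, hSU⟩ := TopologicalSpace.isOpen_iUnion_countable
    (fun y : O => Metric.eball (y : Y) (r y)) fun y => Metric.isOpen_eball
  have hO' : O = ⋃ y ∈ S, Metric.eball (y : Y) (r y) := by
    rw [hSU]
    refine Set.Subset.antisymm (fun y hy => ?_) (Set.iUnion_subset hrO)
    exact Set.mem_iUnion.2 ⟨⟨y, hy⟩, Metric.mem_eball_self (hr0 ⟨y, hy⟩)⟩
  rw [hO', Set.preimage_iUnion₂]
  exact MeasurableSet.biUnion hS fun y _ => measurableSet_lt (h y) measurable_const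

variable {T X : Type*} [MeasurableSpace T] [MeasurableSpace X] {ν : Measure T} {μ : Measure X}
  [SigmaFinite μ]

/-- If the time slices of `u` are given by the curve `γ` in `L²`, then `u` and `γ` have the same
`L²` norm. -/
theorem lintegral_prod_eq_of_slices {u : T × X → ℂ} {γ : T → Lp ℂ 2 μ}
    (hu : AEStronglyMeasurable u (ν.prod μ)) (h : ∀ᵐ t ∂ν, γ t =ᵐ[μ] fun x => u (t, x)) :
    ∫⁻ p, ‖u p‖ₑ ^ 2 ∂(ν.prod μ) = ∫⁻ t, ‖γ t‖ₑ ^ 2 ∂ν := by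
  rw [lintegral_prod _ (by fun_prop)]
  refine lintegral_congr_ae ?_
  filter_upwards [h] with t ht
  rw [Lp.enorm_def, eLpNorm_two_sq]
  refine lintegral_congr_ae ?_
  filter_upwards [ht] with x hx
  rw [hx]

theorem eLpNorm_prod_eq_of_slices {u : T × X → ℂ} {γ : T → Lp ℂ 2 μ}
    (hu : AEStronglyMeasurable u (ν.prod μ)) (h : ∀ᵐ t ∂ν, γ t =ᵐ[μ] fun x => u (t, x)) :
    eLpNorm u 2 (ν.prod μ) = eLpNorm γ 2 ν := by
  rw [eLpNorm_two_eq, eLpNorm_two_eq, lintegral_prod_eq_of_slices hu h]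

variable [SFinite ν] [MeasurableSpace.CountablyGenerated X]

/-- As X is countably generated, L²(X) is separable, so measurability of the curve reduces to that
of its distances to fixed elements, which is Tonelli. -/
theorem exists_curve_of_memLp {g : T × X → ℂ} (hg : MemLp g 2 (ν.prod μ)) :
    ∃ γ : T → Lp ℂ 2 μ, MemLp γ 2 ν ∧ ∀ᵐ t ∂ν, γ t =ᵐ[μ] fun x => g (t, x) := by
  classical
  let _ : MeasurableSpace (Lp ℂ 2 μ) := borel _
  have _ : BorelSpace (Lp ℂ 2 μ) := ⟨rfl⟩
  have : Fact ((2 : ℝ≥0∞) ≠ ∞) := ⟨by norm_num⟩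
  set g' := hg.1.mk g with hg'
  have hgm : StronglyMeasurable g' := hg.1.stronglyMeasurable_mk
  have hgae : ∀ᵐ t ∂ν, (fun x => g (t, x)) =ᵐ[μ] fun x => g' (t, x) :=
    Measure.ae_ae_of_ae_prod hg.1.ae_eq_mk
  have hsl : ∀ t, StronglyMeasurable fun x => g' (t, x) := fun t =>
    hgm.comp_measurable measurable_prodMk_left
  have hfin : ∫⁻ t, ∫⁻ x, ‖g' (t, x)‖ₑ ^ 2 ∂μ ∂ν < ∞ := by
    rw [lintegral_lintegral (f := fun t x => ‖g' (t, x)‖ₑ ^ 2) (by fun_prop)]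
    have := (hg.ae_eq hg.1.ae_eq_mk).2
    calc _ = eLpNorm g' 2 (ν.prod μ) ^ 2 := (eLpNorm_two_sq _ _).symm
      _ < ∞ := ENNReal.pow_lt_top this
  have hmeas : ∀ f : Lp ℂ 2 μ, Measurable fun t => eLpNorm (fun x => g' (t, x) - f x) 2 μ := by
    intro f
    simp_rw [eLpNorm_two_eq]
    refine Measurable.pow_const ?_ _
    have h1 : StronglyMeasurable fun p : T × X => g' p - f p.2 :=
      hgm.sub ((Lp.stronglyMeasurable f).comp_measurable measurable_snd)
    exact Measurable.lintegral_prod_right' (f := fun p : T × X => ‖g' p - f p.2‖ₑ ^ 2)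
      (h1.enorm.pow_const 2)
  -- Outside A, which is conull, the slice is not square integrable and the curve is given the value
  -- 0.
  set A : Set T := {t | ∫⁻ x, ‖g' (t, x)‖ₑ ^ 2 ∂μ < ∞} with hA
  have hAm : MeasurableSet A := measurableSet_lt
    (Measurable.lintegral_prod_right' (f := fun p : T × X => ‖g' p‖ₑ ^ 2) (hgm.enorm.pow_const 2))
    measurable_const
  have hAL : ∀ t ∈ A, MemLp (fun x => g' (t, x)) 2 μ := fun t ht =>
    ⟨(hsl t).aestronglyMeasurable, by
      rw [eLpNorm_two_eq]; exact ENNReal.rpow_lt_top_of_nonneg (by norm_num) (ne_of_lt ht)⟩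
  let γ : T → Lp ℂ 2 μ := fun t => if h : t ∈ A then (hAL t h).toLp _ else 0
  have hγm : Measurable γ := by
    refine measurable_of_measurable_edist fun f => ?_
    have : (fun t => edist (γ t) f) =
        A.piecewise (fun t => eLpNorm (fun x => g' (t, x) - f x) 2 μ) fun _ => edist 0 f := by
      funext t
      by_cases ht : t ∈ A
      · simp only [γ, ht, dif_pos, Set.piecewise_eq_of_mem]
        rw [Lp.edist_def]
        refine eLpNorm_congr_ae ?_
        filter_upwards [(hAL t ht).coeFn_toLp] with x hx
        simp [hx]
      · simp [γ, ht]
    rw [this]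
    exact (hmeas f).piecewise hAm measurable_const
  have hγae : ∀ᵐ t ∂ν, γ t =ᵐ[μ] fun x => g (t, x) := by
    filter_upwards [hgae, ae_lt_top' (by fun_prop) hfin.ne] with t ht hlt
    have : γ t = (hAL t hlt).toLp _ := dif_pos hlt
    rw [this]
    exact (hAL t hlt).coeFn_toLp.trans ht.symm
  refine ⟨γ, ⟨hγm.aestronglyMeasurable, ?_⟩, hγae⟩
  rw [← eLpNorm_prod_eq_of_slices hg.1 hγae]
  exact hg.2

/-- Choosing a representative of each γ t separately need not be jointly measurable. Simple curves
have evident representatives, and the property survives sums and limits. -/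
theorem exists_slices_of_memLp {γ : T → Lp ℂ 2 μ} (hγ : MemLp γ 2 ν) :
    ∃ u : T × X → ℂ, MemLp u 2 (ν.prod μ) ∧ ∀ᵐ t ∂ν, γ t =ᵐ[μ] fun x => u (t, x) := by
  have : Fact ((2 : ℝ≥0∞) ≠ ∞) := ⟨by norm_num⟩
  refine MemLp.induction (p := 2) (by norm_num)
    (motive := fun γ : T → Lp ℂ 2 μ => ∃ u : T × X → ℂ, MemLp u 2 (ν.prod μ) ∧
      ∀ᵐ t ∂ν, γ t =ᵐ[μ] fun x => u (t, x)) ?_ ?_ ?_ ?_ hγ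
  · intro c s hs hνs
    have hm : AEStronglyMeasurable (fun p : T × X => s.indicator (fun _ => (1 : ℂ)) p.1 * c p.2)
        (ν.prod μ) :=
      ((stronglyMeasurable_const.indicator hs).comp_measurable
        measurable_fst).aestronglyMeasurable.mul (Lp.aestronglyMeasurable c).comp_snd
    have hsl : ∀ᵐ t ∂ν, (s.indicator (fun _ => c) t : Lp ℂ 2 μ) =ᵐ[μ]
        fun x => s.indicator (fun _ => (1 : ℂ)) t * c x := by
      refine Eventually.of_forall fun t => ?_
      by_cases ht : t ∈ s
      · simp [ht]
      · simp only [ht, not_false_eq_true, Set.indicator_of_notMem, zero_mul]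
        exact Lp.coeFn_zero _ _ _
    refine ⟨_, ⟨hm, ?_⟩, hsl⟩
    rw [eLpNorm_prod_eq_of_slices hm hsl]
    exact (memLp_indicator_const 2 hs c (Or.inr hνs.ne)).2
  · rintro f g - hf hg ⟨u, hu, huf⟩ ⟨v, hv, hvg⟩
    refine ⟨u + v, hu.add hv, ?_⟩
    filter_upwards [huf, hvg] with t h1 h2
    filter_upwards [h1, h2, Lp.coeFn_add (f t) (g t)] with x h1 h2 h3
    exact h3.trans (by simp only [Pi.add_apply, h1, h2])
  -- Slicing is isometric, so representatives of a convergent sequence of curves are Cauchy. The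
  -- curve of their limit w must be F, by uniqueness of limits.
  · refine IsSeqClosed.isClosed fun f F hf hF => ?_
    choose u hu huf using hf
    have hdist : ∀ (v : T × X → ℂ) (hv : MemLp v 2 (ν.prod μ)) (G : Lp (Lp ℂ 2 μ) 2 ν) (k : ℕ),
        (∀ᵐ t ∂ν, G t =ᵐ[μ] fun x => v (t, x)) →
        edist ((hu k).toLp _) (hv.toLp v) = edist (f k) G := by
      intro v hv G k hG
      rw [Lp.edist_toLp_toLp, Lp.edist_def]
      refine eLpNorm_prod_eq_of_slices ((hu k).sub hv).1 ?_
      filter_upwards [huf k, hG] with t h1 h2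
      filter_upwards [h1, h2, Lp.coeFn_sub (f k t) (G t)] with x h1 h2 h3
      exact h3.trans (by simp only [Pi.sub_apply, h1, h2])
    have hc : CauchySeq fun k => (hu k).toLp (u k) := by
      refine EMetric.cauchySeq_iff.2 fun ε hε => ?_
      obtain ⟨N, hN⟩ := EMetric.cauchySeq_iff.1 hF.cauchySeq ε hε
      refine ⟨N, fun m hm k hk => ?_⟩
      rw [hdist _ (hu k) (f k) m (huf k)]
      exact hN m hm k hk
    obtain ⟨w, hw⟩ := cauchySeq_tendsto_of_complete hc
    obtain ⟨δ, hδ, hδw⟩ := exists_curve_of_memLp (Lp.memLp w)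
    have hD : Tendsto f atTop (𝓝 (hδ.toLp δ)) := by
      refine tendsto_iff_edist_tendsto_0.2 ?_
      have := tendsto_iff_edist_tendsto_0.1 hw
      refine this.congr fun k => ?_
      rw [← hdist w (Lp.memLp w) (hδ.toLp δ) k, Lp.toLp_coeFn]
      filter_upwards [hδ.coeFn_toLp, hδw] with t h1 h2
      rw [h1]; exact h2
    refine ⟨w, Lp.memLp w, ?_⟩
    rw [tendsto_nhds_unique hF hD]
    filter_upwards [hδ.coeFn_toLp, hδw] with t h1 h2
    rw [h1]; exact h2
  · rintro f g hfg - ⟨u, hu, huf⟩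
    refine ⟨u, hu, ?_⟩
    filter_upwards [hfg, huf] with t h1 h2
    rw [← h1]; exact h2

end Slices

/-! ### Strongly continuous unitary groups -/

/-- A strongly continuous one-parameter group of isometries of a complex Hilbert space. -/
structure UnitaryFlow (H : Type*) [NormedAddCommGroup H] [InnerProductSpace ℂ H] where
  /-- The isometry at time `t`. -/
  toFun : ℝ → H →ₗᵢ[ℂ] H
  map_zero' : ∀ f, toFun 0 f = f
  map_add' : ∀ s t f, toFun (s + t) f = toFun s (toFun t f)
  continuous' : ∀ f, Continuous fun t => toFun t f

namespace UnitaryFlow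

variable {H : Type*} [NormedAddCommGroup H] [InnerProductSpace ℂ H]

instance : CoeFun (UnitaryFlow H) fun _ => ℝ → H →ₗᵢ[ℂ] H := ⟨toFun⟩

variable (U : UnitaryFlow H)

theorem map_zero (f : H) : U 0 f = f := U.map_zero' f

theorem map_add (s t : ℝ) (f : H) : U (s + t) f = U s (U t f) := U.map_add' s t f

theorem map_map_neg (t : ℝ) (f : H) : U t (U (-t) f) = f := by
  rw [← U.map_add, add_neg_cancel, U.map_zero]

theorem inner_map_left (t : ℝ) (f g : H) : inner ℂ (U t f) g = inner ℂ f (U (-t) g) := by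
  rw [← (U t).inner_map_map f (U (-t) g), map_map_neg]

theorem norm_map (t : ℝ) (f : H) : ‖U t f‖ = ‖f‖ := (U t).norm_map f

/-- Isometries are equicontinuous, which upgrades strong continuity to joint continuity; this is
what makes s ↦ U(t-s)g(s) measurable for measurable g. -/
theorem continuous_uncurry : Continuous fun p : ℝ × H => U p.1 p.2 := by
  refine continuous_iff_continuousAt.2 fun ⟨t₀, f₀⟩ => ?_
  rw [ContinuousAt, tendsto_iff_norm_sub_tendsto_zero]
  have h1 : Tendsto (fun p : ℝ × H => ‖p.2 - f₀‖ + ‖U p.1 f₀ - U t₀ f₀‖) (𝓝 (t₀, f₀)) (𝓝 0) := by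
    have hc : Continuous fun p : ℝ × H => ‖p.2 - f₀‖ + ‖U p.1 f₀ - U t₀ f₀‖ := by
      have := (U.continuous' f₀).comp (continuous_fst (X := ℝ) (Y := H))
      exact (continuous_snd.sub continuous_const).norm.add (this.sub continuous_const).norm
    simpa using hc.tendsto (t₀, f₀)
  refine squeeze_zero (fun _ => norm_nonneg _) (fun p => ?_) h1
  calc ‖U p.1 p.2 - U t₀ f₀‖ = ‖U p.1 (p.2 - f₀) + (U p.1 f₀ - U t₀ f₀)‖ := by
        rw [_root_.map_sub]; abel_nf
    _ ≤ ‖U p.1 (p.2 - f₀)‖ + ‖U p.1 f₀ - U t₀ f₀‖ := norm_add_le _ _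
    _ = _ := by rw [U.norm_map]

theorem continuous_comp {α : Type*} [TopologicalSpace α] {τ : α → ℝ} {γ : α → H}
    (hτ : Continuous τ) (hγ : Continuous γ) : Continuous fun x => U (τ x) (γ x) :=
  U.continuous_uncurry.comp (hτ.prodMk hγ)

theorem aestronglyMeasurable_comp {α : Type*} [MeasurableSpace α] {μ : Measure α} {τ : α → ℝ}
    {γ : α → H} (hτ : AEStronglyMeasurable τ μ) (hγ : AEStronglyMeasurable γ μ) :
    AEStronglyMeasurable (fun x => U (τ x) (γ x)) μ :=
  U.continuous_uncurry.comp_aestronglyMeasurable (hτ.prodMk hγ)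

/-- The flow run backwards in time. -/
def reverse : UnitaryFlow H where
  toFun t := U (-t)
  map_zero' f := by rw [neg_zero, U.map_zero]
  map_add' s t f := by rw [neg_add, U.map_add]
  continuous' f := (U.continuous' f).comp continuous_neg

theorem reverse_apply (t : ℝ) : U.reverse t = U (-t) := rfl

/-! ### Damped causal evolution and Plancherel in time -/

/-- The sandwiched resolvent `B (ε + 2πiτ - U')⁻¹ B`, written as a Laplace transform, is bounded
by `a`. -/
def LaplaceBound (B : H →L[ℂ] H) (a : ℝ) : Prop :=
  ∀ ε : ℝ, 0 < ε → ∀ (τ : ℝ) (h : H),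
    ‖B (∫ r in Set.Ioi (0 : ℝ),
      Complex.exp (-((ε : ℂ) + 2 * Real.pi * τ * Complex.I) * r) • U r (B h))‖ ≤ a * ‖h‖

variable {U} {B : H →L[ℂ] H} {a : ℝ}

theorem norm_exp_laplace (ε τ r : ℝ) :
    ‖Complex.exp (-((ε : ℂ) + 2 * Real.pi * τ * Complex.I) * r)‖ = Real.exp (-ε * r) := by
  rw [Complex.norm_exp]
  congr 1
  simp

theorem integrableOn_exp_neg {ε : ℝ} (hε : 0 < ε) :
    IntegrableOn (fun r : ℝ => Real.exp (-ε * r)) (Set.Ioi 0) :=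
  integrableOn_exp_mul_Ioi (by linarith) 0

theorem integrable_laplace_prod (U : UnitaryFlow H) (B : H →L[ℂ] H) {ε : ℝ} (hε : 0 < ε)
    {G : ℝ → H} (hG : Integrable G) :
    Integrable (fun p : ℝ × ℝ =>
      Complex.exp (-((ε : ℂ) + 2 * Real.pi * p.2 * Complex.I) * p.1) • U p.1 (B (G p.2)))
      ((volume.restrict (Set.Ioi 0)).prod volume) := by
  have h : Integrable (fun p : ℝ × ℝ => Real.exp (-ε * p.1) * (‖B‖ * ‖G p.2‖))
      ((volume.restrict (Set.Ioi 0)).prod volume) :=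
    Integrable.mul_prod (integrableOn_exp_neg hε) (hG.norm.const_mul _)
  refine h.mono' ?_ (Eventually.of_forall fun p => ?_)
  · refine AEStronglyMeasurable.smul (Continuous.aestronglyMeasurable (by fun_prop)) ?_
    exact U.aestronglyMeasurable_comp continuous_fst.aestronglyMeasurable
      (B.continuous.comp_aestronglyMeasurable hG.1.comp_snd)
  · rw [norm_smul, norm_exp_laplace, U.norm_map]
    gcongr
    exact B.le_opNorm _

variable [CompleteSpace H]

/-- The damped causal evolution of the inverse Fourier transform of an integrable function is an
inverse Fourier transform in time. -/
theorem damped_eq_fourierInv (U : UnitaryFlow H) (B : H →L[ℂ] H) {ε : ℝ} (hε : 0 < ε)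
    {G : ℝ → H} (hG : Integrable G) (t : ℝ) :
    B (∫ r in Set.Ioi (0 : ℝ), Real.exp (-ε * r) • U r (B (𝓕⁻ G (t - r)))) =
      𝓕⁻ (fun τ : ℝ => B (∫ r in Set.Ioi (0 : ℝ),
        Complex.exp (-((ε : ℂ) + 2 * Real.pi * τ * Complex.I) * r) • U r (B (G τ)))) t := by
  have hP := integrable_laplace_prod U B hε hG
  -- Inserting the Fourier integral of G, the phases recombine as e^{-εr} e^{2πi(t-r)τ} = e^{2πitτ}
  -- e^{-(ε+2πiτ)r}.
  have h1 : ∀ r : ℝ, Real.exp (-ε * r) • U r (B (𝓕⁻ G (t - r))) =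
      ∫ τ : ℝ, Complex.exp (2 * Real.pi * t * τ * Complex.I) •
        (Complex.exp (-((ε : ℂ) + 2 * Real.pi * τ * Complex.I) * r) • U r (B (G τ))) := by
    intro r
    have hint : Integrable fun τ : ℝ => Real.fourierChar (τ * (t - r)) • G τ := by
      refine hG.norm.mono' ?_ (Eventually.of_forall fun τ => by simp [Circle.norm_smul])
      have hc : Continuous fun τ : ℝ => Real.fourierChar (τ * (t - r)) :=
        Real.continuous_fourierChar.comp (by fun_prop)
      exact hc.aestronglyMeasurable.smul hG.1
    have h2 : 𝓕⁻ G (t - r) = ∫ τ : ℝ, Real.fourierChar (τ * (t - r)) • G τ := by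
      rw [Real.fourierInv_eq]
      simp [mul_comm]
    rw [h2]
    have h3 := ((U r).toContinuousLinearMap.comp B).integral_comp_comm hint
    simp only [ContinuousLinearMap.comp_apply, LinearIsometry.coe_toContinuousLinearMap] at h3
    rw [← h3, ← integral_smul]
    refine integral_congr_ae (Eventually.of_forall fun τ => ?_)
    simp only [Circle.smul_def, ContinuousLinearMap.map_smul, LinearIsometry.map_smul, smul_smul]
    rw [← Complex.coe_smul, smul_smul, ← Complex.exp_add, Real.fourierChar_apply,
      Complex.ofReal_exp, ← Complex.exp_add]
    congr 2
    push_cast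
    ring
  simp_rw [h1]
  -- After the swap, made legitimate by the damping, the integral in r is the Laplace transform of
  -- the group at ε + 2πiτ.
  rw [integral_integral_swap]
  · have h4 : ∀ τ : ℝ, ∫ r in Set.Ioi (0 : ℝ), Complex.exp (2 * Real.pi * t * τ * Complex.I) •
        (Complex.exp (-((ε : ℂ) + 2 * Real.pi * τ * Complex.I) * r) • U r (B (G τ))) =
        Complex.exp (2 * Real.pi * t * τ * Complex.I) • ∫ r in Set.Ioi (0 : ℝ),
        (Complex.exp (-((ε : ℂ) + 2 * Real.pi * τ * Complex.I) * r) • U r (B (G τ))) :=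
      fun τ => integral_smul _ _
    have hi := hP.integral_prod_right
    simp_rw [h4]
    rw [← B.integral_comp_comm, Real.fourierInv_eq]
    · refine integral_congr_ae (Eventually.of_forall fun τ => ?_)
      simp only [ContinuousLinearMap.map_smul, Circle.smul_def, Real.fourierChar_apply]
      congr 2
      simp
      ring
    · refine hi.norm.mono' (AEStronglyMeasurable.smul
        (Continuous.aestronglyMeasurable (by fun_prop)) hi.1) (Eventually.of_forall fun τ => ?_)
      rw [norm_smul, Complex.norm_exp]
      simp
  · refine hP.norm.mono' (AEStronglyMeasurable.smul
        (Continuous.aestronglyMeasurable (by fun_prop)) hP.1) (Eventually.of_forall fun p => ?_)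
    simp only [Function.uncurry]
    rw [norm_smul, Complex.norm_exp]
    simp

/-- Plancherel is applied to g and to the output, with the multiplier bound between them. For
Schwartz g the transform is integrable, as the pointwise inversion formula requires. -/
theorem damped_bound_of_fourierInv (hB : U.LaplaceBound B a) {ε : ℝ} (hε : 0 < ε)
    (g : 𝓢(ℝ, H)) :
    AEStronglyMeasurable (fun t : ℝ =>
      B (∫ r in Set.Ioi (0 : ℝ), Real.exp (-ε * r) • U r (B (g (t - r))))) volume ∧
    eLpNorm (fun t : ℝ => B (∫ r in Set.Ioi (0 : ℝ), Real.exp (-ε * r) • U r (B (g (t - r))))) 2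
      volume ≤ ENNReal.ofReal a * eLpNorm g 2 volume := by
  set G : 𝓢(ℝ, H) := 𝓕 g with hGdef
  have hg : g = 𝓕⁻ G := (FourierTransform.fourierInv_fourier_eq g).symm
  have hgc : ∀ s, g s = 𝓕⁻ (G : ℝ → H) s := fun s => by rw [hg, SchwartzMap.fourierInv_coe]
  simp_rw [hgc, damped_eq_fourierInv U B hε G.integrable]
  set h : ℝ → H := fun τ => B (∫ r in Set.Ioi (0 : ℝ),
        Complex.exp (-((ε : ℂ) + 2 * Real.pi * τ * Complex.I) * r) • U r (B (G τ))) with hh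
  have hh1 : Integrable h :=
    B.integrable_comp (integrable_laplace_prod U B hε G.integrable).integral_prod_right
  have hle : ∀ τ, ‖h τ‖ ≤ a * ‖G τ‖ := fun τ => hB ε hε τ (G τ)
  have hG2 : MemLp G 2 volume := G.memLp 2 volume
  have hh2 : MemLp h 2 volume := hG2.of_le_mul hh1.1 (Eventually.of_forall hle)
  refine ⟨(continuous_fourierInv_of_integrable hh1).aestronglyMeasurable, ?_⟩
  calc eLpNorm (𝓕⁻ h) 2 volume = ‖(𝓕⁻ (hh2.toLp h) : Lp H 2 (volume : Measure ℝ))‖ₑ := by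
        rw [Lp.enorm_def, eLpNorm_congr_ae (fourierInv_toLp_ae_eq hh1 hh2)]
    _ = ‖hh2.toLp h‖ₑ := by
        rw [← ofReal_norm, ← ofReal_norm]
        congr 1
        exact (Lp.fourierTransformₗᵢ ℝ H).symm.norm_map _
    _ = eLpNorm h 2 volume := Lp.enorm_toLp _
    _ ≤ ENNReal.ofReal a * eLpNorm G 2 volume :=
        eLpNorm_le_mul_eLpNorm_of_ae_le_mul (Eventually.of_forall hle) 2
    _ = ENNReal.ofReal a * eLpNorm g 2 volume := by
        congr 1
        rw [← Lp.enorm_toLp hG2, ← Lp.enorm_toLp (g.memLp 2 volume), ← ofReal_norm, ← ofReal_norm]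
        congr 1
        exact SchwartzMap.norm_fourier_toL2_eq g

end UnitaryFlow

/-! ### Extension to L² and removal of the damping -/

namespace UnitaryFlow

variable {H : Type*} [NormedAddCommGroup H] [InnerProductSpace ℂ H] {U : UnitaryFlow H}
  {B : H →L[ℂ] H} {a : ℝ}

theorem memLp_exp_neg {ε : ℝ} (hε : 0 < ε) :
    MemLp (fun r : ℝ => Real.exp (-ε * r)) 2 (volume.restrict (Set.Ioi 0)) := by
  refine (memLp_two_iff_integrable_sq_norm (Continuous.aestronglyMeasurable (by fun_prop))).2 ?_
  refine (integrableOn_exp_neg (ε := 2 * ε) (by linarith)).congr (Eventually.of_forall fun r => ?_)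
  simp only [Real.norm_eq_abs, Real.abs_exp]
  rw [sq, ← Real.exp_add]
  congr 1
  ring

omit [InnerProductSpace ℂ H] in
theorem memLp_comp_sub_left {g : ℝ → H} (hg : MemLp g 2 volume) (t : ℝ) :
    MemLp (fun r => g (t - r)) 2 volume :=
  hg.comp_measurePreserving (Measure.measurePreserving_sub_left volume t)

theorem aestronglyMeasurable_evolution {ν : Measure ℝ} (hν : ν ≤ volume) {g : ℝ → H}
    (hg : AEStronglyMeasurable g volume) (t : ℝ) :
    AEStronglyMeasurable (fun r => U r (B (g (t - r)))) ν :=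
  (U.aestronglyMeasurable_comp continuous_id.aestronglyMeasurable
    (B.continuous.comp_aestronglyMeasurable
      (hg.comp_measurePreserving (Measure.measurePreserving_sub_left volume t)))).mono_measure hν

theorem memLp_evolution {g : ℝ → H} (hg : MemLp g 2 volume) (t : ℝ) :
    MemLp (fun r => U r (B (g (t - r)))) 2 volume :=
  (memLp_comp_sub_left hg t).of_le_mul (aestronglyMeasurable_evolution le_rfl hg.1 t)
    (Eventually.of_forall fun r => by rw [U.norm_map]; exact B.le_opNorm _)

theorem integrable_damped {ε : ℝ} (hε : 0 < ε) {g : ℝ → H} (hg : MemLp g 2 volume) (t : ℝ) :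
    IntegrableOn (fun r => Real.exp (-ε * r) • U r (B (g (t - r)))) (Set.Ioi 0) := by
  have h : MemLp ((fun r : ℝ => Real.exp (-ε * r)) • fun r => U r (B (g (t - r)))) 1
      (volume.restrict (Set.Ioi 0)) :=
    ((memLp_evolution hg t).mono_measure Measure.restrict_le_self).smul (memLp_exp_neg hε)
  exact memLp_one_iff_integrable.1 h

/-- Cauchy–Schwarz against the square integrable factor e^{-εr}. For fixed ε the damped integral at
each single time t is therefore continuous in g for the L² norm. -/
theorem enorm_damped_le (ε : ℝ) {g : ℝ → H} (hg : MemLp g 2 volume) (t : ℝ) :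
    ‖∫ r in Set.Ioi (0 : ℝ), Real.exp (-ε * r) • U r (B (g (t - r)))‖ₑ ≤
      eLpNorm (fun r : ℝ => Real.exp (-ε * r)) 2 (volume.restrict (Set.Ioi 0)) *
        (‖B‖ₑ * eLpNorm g 2 volume) := by
  calc _ ≤ ∫⁻ r in Set.Ioi (0 : ℝ), ‖Real.exp (-ε * r) • U r (B (g (t - r)))‖ₑ :=
        enorm_integral_le_lintegral_enorm _
    _ = eLpNorm ((fun r : ℝ => Real.exp (-ε * r)) • fun r => U r (B (g (t - r)))) 1
        (volume.restrict (Set.Ioi 0)) := by rw [eLpNorm_one_eq_lintegral_enorm]; rfl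
    _ ≤ eLpNorm (fun r : ℝ => Real.exp (-ε * r)) 2 (volume.restrict (Set.Ioi 0)) *
        eLpNorm (fun r => U r (B (g (t - r)))) 2 (volume.restrict (Set.Ioi 0)) :=
        eLpNorm_smul_le_mul_eLpNorm
          (aestronglyMeasurable_evolution Measure.restrict_le_self hg.1 t)
          (Continuous.aestronglyMeasurable (by fun_prop))
    _ ≤ _ := by
        gcongr
        refine (eLpNorm_mono_measure _ Measure.restrict_le_self).trans ?_
        rw [← eLpNorm_comp_measurePreserving hg.1 (Measure.measurePreserving_sub_left volume t)]
        have := eLpNorm_le_mul_eLpNorm_of_ae_le_mul (p := 2) (μ := volume) (c := ‖B‖)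
          (f := fun r => U r (B (g (t - r)))) (g := g ∘ fun r => t - r)
          (Eventually.of_forall fun r => by rw [U.norm_map]; exact B.le_opNorm _)
        rwa [ofReal_norm] at this

variable [CompleteSpace H]

/-- Schwartz functions are dense in L²; along an approximating sequence the outputs converge at
every t by `enorm_damped_le`, and Fatou preserves the bound. -/
theorem damped_bound (hB : U.LaplaceBound B a) {ε : ℝ} (hε : 0 < ε) {g : ℝ → H}
    (hg : MemLp g 2 volume) :
    AEStronglyMeasurable (fun t : ℝ =>
      B (∫ r in Set.Ioi (0 : ℝ), Real.exp (-ε * r) • U r (B (g (t - r))))) volume ∧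
    eLpNorm (fun t : ℝ => B (∫ r in Set.Ioi (0 : ℝ), Real.exp (-ε * r) • U r (B (g (t - r))))) 2
      volume ≤ ENNReal.ofReal a * eLpNorm g 2 volume := by
  have hd : DenseRange (SchwartzMap.toLpCLM ℂ (E := ℝ) H 2 volume) :=
    SchwartzMap.denseRange_toLpCLM ENNReal.ofNat_ne_top
  obtain ⟨s, hs, hsg⟩ := mem_closure_iff_seq_limit.1 (hd.closure_range ▸ Set.mem_univ (hg.toLp g))
  choose φ hφ using hs
  have hφ' : ∀ k, s k = (φ k).toLp 2 := fun k => (hφ k).symm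
  have hlim : Tendsto (fun k => eLpNorm ((φ k : ℝ → H) - g) 2 volume) atTop (𝓝 0) := by
    refine (tendsto_iff_edist_tendsto_0.1 hsg).congr fun k => ?_
    rw [hφ' k]
    exact Lp.edist_toLp_toLp _ _ ((φ k).memLp 2 volume) hg
  have hnorm : Tendsto (fun k => eLpNorm (φ k : ℝ → H) 2 volume) atTop
      (𝓝 (eLpNorm g 2 volume)) := by
    have := (continuous_enorm.tendsto _).comp hsg
    rw [Lp.enorm_toLp] at this
    refine this.congr fun k => ?_
    rw [Function.comp_apply, hφ' k]
    exact Lp.enorm_toLp ((φ k).memLp 2 volume)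
  have hpt : ∀ t, Tendsto (fun k => B (∫ r in Set.Ioi (0 : ℝ),
      Real.exp (-ε * r) • U r (B (φ k (t - r))))) atTop
      (𝓝 (B (∫ r in Set.Ioi (0 : ℝ), Real.exp (-ε * r) • U r (B (g (t - r)))))) := by
    intro t
    refine (B.continuous.tendsto _).comp ?_
    rw [tendsto_iff_edist_tendsto_0]
    set K := eLpNorm (fun r : ℝ => Real.exp (-ε * r)) 2 (volume.restrict (Set.Ioi 0))
    have hK : K ≠ ∞ := (memLp_exp_neg hε).2.ne
    have h0 : Tendsto (fun k => K * (‖B‖ₑ * eLpNorm ((φ k : ℝ → H) - g) 2 volume)) atTop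
        (𝓝 0) := by
      have h1 := ENNReal.Tendsto.const_mul (a := ‖B‖ₑ) hlim (Or.inr enorm_ne_top)
      have := ENNReal.Tendsto.const_mul (a := K) h1 (Or.inr hK)
      simpa using this
    refine tendsto_of_tendsto_of_tendsto_of_le_of_le tendsto_const_nhds h0
      (fun _ => zero_le) fun k => ?_
    have hk := (φ k).memLp 2 volume
    refine le_trans (le_of_eq ?_) (enorm_damped_le (U := U) (B := B) ε (hk.sub hg) t)
    rw [edist_eq_enorm_sub, ← integral_sub (integrable_damped hε hk t) (integrable_damped hε hg t)]
    congr 2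
    funext r
    simp [smul_sub]
  have hm := fun k => (damped_bound_of_fourierInv hB hε (φ k)).1
  refine ⟨aestronglyMeasurable_of_tendsto_ae atTop hm (Eventually.of_forall hpt), ?_⟩
  refine (Lp.eLpNorm_lim_le_liminf_eLpNorm hm _ (Eventually.of_forall hpt)).trans ?_
  have h2 : Tendsto (fun k => ENNReal.ofReal a * eLpNorm (φ k : ℝ → H) 2 volume) atTop
      (𝓝 (ENNReal.ofReal a * eLpNorm g 2 volume)) :=
    ENNReal.Tendsto.const_mul hnorm (Or.inr ENNReal.ofReal_ne_top)
  rw [← h2.liminf_eq]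
  exact liminf_le_liminf (Eventually.of_forall fun k =>
    (damped_bound_of_fourierInv hB hε (φ k)).2)

theorem setIntegral_Ioi_comp_sub_left {F : Type*} [NormedAddCommGroup F] [NormedSpace ℝ F]
    (f : ℝ → F) (t : ℝ) : ∫ r in Set.Ioi (0 : ℝ), f (t - r) = ∫ s in Set.Iio t, f s := by
  rw [← integral_indicator measurableSet_Ioi, ← integral_indicator measurableSet_Iio,
    ← integral_sub_left_eq_self _ volume t]
  congr 1
  funext r
  simp [Set.indicator]

/-- The causal evolution `∫_{s<t} U(t-s) B g(s) ds`, followed by `B`, is bounded by `a` on `L²`. -/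
theorem causal_bound (hB : U.LaplaceBound B a) {g : ℝ → H} (hg : MemLp g 2 volume)
    (hi : ∀ t, IntegrableOn g (Set.Iio t)) :
    AEStronglyMeasurable (fun t : ℝ => B (∫ s in Set.Iio t, U (t - s) (B (g s)))) volume ∧
    eLpNorm (fun t : ℝ => B (∫ s in Set.Iio t, U (t - s) (B (g s)))) 2 volume ≤
      ENNReal.ofReal a * eLpNorm g 2 volume := by
  -- The damping ε = 1/(k+1) tends to 0. Dominated convergence needs g integrable on the past of t,
  -- as square integrability alone does not give a convergent undamped integral.
  have hpt : ∀ t, Tendsto (fun k : ℕ => B (∫ r in Set.Ioi (0 : ℝ),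
      Real.exp (-(1 / ((k : ℝ) + 1)) * r) • U r (B (g (t - r))))) atTop
      (𝓝 (B (∫ s in Set.Iio t, U (t - s) (B (g s))))) := by
    intro t
    refine (B.continuous.tendsto _).comp ?_
    rw [← setIntegral_Ioi_comp_sub_left (fun s => U (t - s) (B (g s))) t]
    simp only [sub_sub_cancel]
    have hgt : IntegrableOn (fun r => g (t - r)) (Set.Ioi 0) := by
      have := (Measure.measurePreserving_sub_left volume t).integrableOn_comp_preimage
        (measurableEmbedding_subLeft t) (f := g) (s := Set.Iio t)
      have h2 := this.2 (hi t)
      have e : Set.Ioi (0 : ℝ) = (fun r => t - r) ⁻¹' Set.Iio t := by ext r; simp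
      rw [e]; exact h2
    refine tendsto_integral_of_dominated_convergence (fun r => ‖B‖ * ‖g (t - r)‖)
      (fun k => (integrable_damped (by positivity) hg t).1) (hgt.norm.const_mul _)
      (fun k => ?_) (Eventually.of_forall fun r => ?_)
    · filter_upwards [ae_restrict_mem measurableSet_Ioi] with r hr
      rw [norm_smul, U.norm_map]
      have h1 : ‖Real.exp (-(1 / ((k : ℝ) + 1)) * r)‖ ≤ 1 := by
        rw [Real.norm_eq_abs, Real.abs_exp, Real.exp_le_one_iff]
        have : 0 < 1 / ((k : ℝ) + 1) * r := mul_pos (by positivity) hr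
        linarith
      calc _ ≤ 1 * ‖B (g (t - r))‖ := by gcongr
        _ ≤ _ := by rw [one_mul]; exact B.le_opNorm _
    · have h1 : Tendsto (fun k : ℕ => Real.exp (-(1 / ((k : ℝ) + 1)) * r)) atTop (𝓝 1) := by
        have h2 := (tendsto_one_div_add_atTop_nhds_zero_nat (𝕜 := ℝ)).neg.mul_const r
        simpa [Function.comp_def] using (Real.continuous_exp.tendsto _).comp h2
      simpa using h1.smul_const (U r (B (g (t - r))))
  have hb := fun k : ℕ => damped_bound hB (ε := 1 / ((k : ℝ) + 1)) (by positivity) hg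
  refine ⟨aestronglyMeasurable_of_tendsto_ae atTop (fun k => (hb k).1)
    (Eventually.of_forall hpt), ?_⟩
  refine (Lp.eLpNorm_lim_le_liminf_eLpNorm (fun k => (hb k).1) _
    (Eventually.of_forall hpt)).trans ?_
  refine (liminf_le_liminf (Eventually.of_forall fun k => (hb k).2)).trans ?_
  simp

/-- The anticausal evolution `∫_{s>t} U(t-s) B g(s) ds`, followed by `B`, is bounded by `a` on
`L²`. -/
theorem anticausal_bound (hB : U.reverse.LaplaceBound B a) {g : ℝ → H} (hg : MemLp g 2 volume)
    (hi : ∀ t, IntegrableOn g (Set.Ioi t)) :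
    AEStronglyMeasurable (fun t : ℝ => B (∫ s in Set.Ioi t, U (t - s) (B (g s)))) volume ∧
    eLpNorm (fun t : ℝ => B (∫ s in Set.Ioi t, U (t - s) (B (g s)))) 2 volume ≤
      ENNReal.ofReal a * eLpNorm g 2 volume := by
  have hneg := Measure.measurePreserving_neg (volume : Measure ℝ)
  have hg' : MemLp (fun s => g (-s)) 2 volume := hg.comp_measurePreserving hneg
  have hi' : ∀ t, IntegrableOn (fun s => g (-s)) (Set.Iio t) := fun t => by
    have := (hneg.integrableOn_comp_preimage (MeasurableEquiv.neg ℝ).measurableEmbedding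
      (f := g) (s := Set.Ioi (-t))).2 (hi (-t))
    have e : Set.Iio t = Neg.neg ⁻¹' Set.Ioi (-t) := by ext r; simp
    rw [e]; exact this
  obtain ⟨h1, h2⟩ := causal_bound hB hg' hi'
  -- The substitution s ↦ -s turns the future into the past and the group into its reverse.
  have key : ∀ t, B (∫ s in Set.Iio t, U.reverse (t - s) (B (g (-s)))) =
      (fun t => B (∫ s in Set.Ioi t, U (t - s) (B (g s)))) (-t) := by
    intro t
    simp only
    congr 1
    rw [← integral_indicator measurableSet_Ioi, ← integral_indicator measurableSet_Iio,
      ← integral_neg_eq_self]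
    congr 1
    funext r
    simp only [Set.indicator, Set.mem_Iio, Set.mem_Ioi, neg_neg, reverse_apply,
      sub_neg_eq_add, neg_add]
    have e : -t + -r = -t - r := by ring
    rw [e]
    simp only [neg_lt]
  simp_rw [key] at h1 h2
  have h1' : AEStronglyMeasurable (fun t : ℝ => B (∫ s in Set.Ioi t, U (t - s) (B (g s))))
      volume := by
    have := h1.comp_measurePreserving hneg
    simpa [Function.comp_def] using this
  refine ⟨h1', ?_⟩
  have e1 := eLpNorm_comp_measurePreserving (p := 2) h1' hneg
  have e2 := eLpNorm_comp_measurePreserving (p := 2) hg.1 hneg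
  rw [← e1, ← e2]
  exact h2

/-! ### Kato smoothing by the TT* method -/

theorem map_integral (U : UnitaryFlow H) (t : ℝ) {α : Type*} [MeasurableSpace α] {μ : Measure α}
    {f : α → H} (hf : Integrable f μ) : U t (∫ x, f x ∂μ) = ∫ x, U t (f x) ∂μ :=
  ((U t).toContinuousLinearMap.integral_comp_comm hf).symm

omit [CompleteSpace H] in
theorem integrable_evolution (t : ℝ) {g : ℝ → H} {ν : Measure ℝ} (hg : Integrable g ν) :
    Integrable (fun s => U (t - s) (B (g s))) ν := by
  refine (hg.norm.const_mul ‖B‖).mono' ?_ (Eventually.of_forall fun s => ?_)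
  · exact U.aestronglyMeasurable_comp (by fun_prop) (B.continuous.comp_aestronglyMeasurable hg.1)
  · rw [U.norm_map]
    exact B.le_opNorm _

/-- For Tf = (s ↦ B U(s) f) this identifies the adjoint as T*g = ∫ U(-s) B g(s) ds. Writing `0 - s`
makes T*g the evolution integral at time 0. -/
theorem inner_integral_evolution (hs : ∀ f g, inner ℂ (B f) g = inner ℂ f (B g)) {g : ℝ → H}
    {ν : Measure ℝ} (hg : Integrable g ν) (f : H) :
    inner ℂ f (∫ s, U (0 - s) (B (g s)) ∂ν) = ∫ s, inner ℂ (B (U s f)) (g s) ∂ν := by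
  rw [← integral_inner (integrable_evolution 0 hg)]
  refine integral_congr_ae (Eventually.of_forall fun s => ?_)
  simp only [zero_sub]
  rw [← U.inner_map_left, hs]

/-- Kato smoothing: the two resolvent bounds imply that `t ↦ B U(t) f` is square integrable. -/
theorem smoothing_bound (hB : U.LaplaceBound B a) (hB' : U.reverse.LaplaceBound B a)
    (hs : ∀ f g, inner ℂ (B f) g = inner ℂ f (B g)) (f : H) :
    ∫⁻ t, ‖B (U t f)‖ₑ ^ 2 ≤ 2 * ENNReal.ofReal a * ‖f‖ₑ ^ 2 := by
  have hloc : ∀ T : ℝ, ∫⁻ t in Set.Icc (-T) T, ‖B (U t f)‖ₑ ^ 2 ≤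
      2 * ENNReal.ofReal a * ‖f‖ₑ ^ 2 := by
    intro T
    -- Restricting to [-T, T] makes all norms finite a priori, so that they can be cancelled later.
    -- Below, N = ‖g‖ and Z = T*g.
    set g : ℝ → H := (Set.Icc (-T) T).indicator fun s => B (U s f) with hg
    have hc : Continuous fun s => B (U s f) := B.continuous.comp (U.continuous' f)
    have hm : AEStronglyMeasurable g volume :=
      hc.aestronglyMeasurable.indicator measurableSet_Icc
    have hbd : ∀ s, ‖g s‖ ≤ ‖(Set.Icc (-T) T).indicator (fun _ => ‖B‖ * ‖f‖) s‖ := by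
      intro s
      simp only [hg, Set.indicator]
      split_ifs
      · rw [norm_mul, norm_norm, norm_norm, ← U.norm_map s f]
        exact B.le_opNorm _
      · simp
    have hL : ∀ p : ℝ≥0∞, MemLp g p volume := fun p =>
      (memLp_indicator_const p measurableSet_Icc (‖B‖ * ‖f‖) (Or.inr (by simp))).of_le hm
        (Eventually.of_forall hbd)
    have hint : Integrable g volume := memLp_one_iff_integrable.1 (hL 1)
    set N := eLpNorm g 2 volume with hN
    set Z := ∫ s, U (0 - s) (B (g s)) with hZ
    -- By the group law TT*g at time t is an integral over all s, which splits at s = t into causal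
    -- and anticausal parts, each bounded by a.
    have hUZ : ∀ t, B (U t Z) = B (∫ s in Set.Iio t, U (t - s) (B (g s))) +
        B (∫ s in Set.Ioi t, U (t - s) (B (g s))) := by
      intro t
      rw [← _root_.map_add, hZ, U.map_integral t (integrable_evolution 0 hint)]
      have e : ∀ s, U t (U (0 - s) (B (g s))) = U (t - s) (B (g s)) := fun s => by
        rw [← U.map_add]; congr 2; ring
      simp_rw [e]
      rw [← integral_add_compl measurableSet_Iio (integrable_evolution t hint), Set.compl_Iio,
        integral_Ici_eq_integral_Ioi]
    obtain ⟨m1, b1⟩ := causal_bound hB (hL 2) fun t => hint.integrableOn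
    obtain ⟨m2, b2⟩ := anticausal_bound hB' (hL 2) fun t => hint.integrableOn
    have hmZ : AEStronglyMeasurable (fun s => B (U s Z)) volume :=
      (B.continuous.comp (U.continuous' Z)).aestronglyMeasurable
    have hBZ : eLpNorm (fun s => B (U s Z)) 2 volume ≤ 2 * ENNReal.ofReal a * N := by
      simp_rw [hUZ]
      refine (eLpNorm_add_le m1 m2 (by norm_num)).trans ((add_le_add b1 b2).trans ?_)
      rw [mul_assoc, two_mul]
    -- ‖Z‖² = ⟨TT*g, g⟩ ≤ 2a N².
    have hZ2 : ‖Z‖ₑ ^ 2 ≤ 2 * ENNReal.ofReal a * N * N := by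
      have h1 : (‖Z‖ₑ ^ 2 : ℝ≥0∞) = ‖(inner ℂ Z Z : ℂ)‖ₑ := by
        rw [inner_self_eq_norm_sq_to_K, enorm_pow,
          ← ofReal_norm, ← ofReal_norm (_ : ℂ)]
        simp
      rw [h1, show inner ℂ Z Z = _ from inner_integral_evolution hs hint Z]
      calc _ ≤ ∫⁻ s, ‖(inner ℂ (B (U s Z)) (g s) : ℂ)‖ₑ := enorm_integral_le_lintegral_enorm _
        _ ≤ ∫⁻ s, ‖((fun s => ‖B (U s Z)‖) • fun s => ‖g s‖) s‖ₑ := by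
            refine lintegral_mono fun s => ?_
            rw [← ofReal_norm, ← ofReal_norm]
            refine ENNReal.ofReal_le_ofReal ((norm_inner_le_norm _ _).trans (le_of_eq ?_))
            simp
        _ = eLpNorm ((fun s => ‖B (U s Z)‖) • fun s => ‖g s‖) 1 volume :=
            eLpNorm_one_eq_lintegral_enorm.symm
        _ ≤ eLpNorm (fun s => ‖B (U s Z)‖) 2 volume * eLpNorm (fun s => ‖g s‖) 2 volume :=
            eLpNorm_smul_le_mul_eLpNorm hm.norm hmZ.norm
        _ = eLpNorm (fun s => B (U s Z)) 2 volume * N := by rw [eLpNorm_norm, eLpNorm_norm]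
        _ ≤ _ := by gcongr
    -- As g is Tf cut off in time, ⟨f, T*g⟩ = ‖g‖².
    have hN2 : N ^ 2 ≤ ‖f‖ₑ * ‖Z‖ₑ := by
      have h1 : inner ℂ f Z = ((∫ s, ‖g s‖ ^ 2 : ℝ) : ℂ) := by
        rw [hZ, inner_integral_evolution hs hint, ← integral_complex_ofReal]
        refine integral_congr_ae (Eventually.of_forall fun s => ?_)
        by_cases h : s ∈ Set.Icc (-T) T
        · simp only [hg, Set.indicator_of_mem h, inner_self_eq_norm_sq_to_K]
          push_cast; rfl
        · simp [hg, Set.indicator_of_notMem h]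
      have h2 : N ^ 2 = ‖(inner ℂ f Z : ℂ)‖ₑ := by
        rw [h1, hN, eLpNorm_two_sq, ← ofReal_norm, Complex.norm_real, Real.norm_of_nonneg
          (integral_nonneg fun s => by positivity), ofReal_integral_eq_lintegral_ofReal
          ((memLp_two_iff_integrable_sq_norm hm).1 (hL 2))
          (Eventually.of_forall fun s => by positivity)]
        refine lintegral_congr fun s => ?_
        rw [ENNReal.ofReal_pow (norm_nonneg _), ofReal_norm]
      rw [h2, ← ofReal_norm, ← ofReal_norm, ← ofReal_norm, ← ENNReal.ofReal_mul (norm_nonneg _)]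
      exact ENNReal.ofReal_le_ofReal (norm_inner_le_norm _ _)
    -- Squaring the last bound and inserting the one for Z gives N⁴ ≤ 2a ‖f‖² N²; the finite factor
    -- N² cancels.
    have hfin : N ^ 2 ≤ 2 * ENNReal.ofReal a * ‖f‖ₑ ^ 2 := by
      by_cases h0 : N ^ 2 = 0
      · rw [h0]; exact zero_le
      have hNtop : N ^ 2 ≠ ∞ := ENNReal.pow_ne_top (hL 2).2.ne
      refine (ENNReal.mul_le_mul_iff_left h0 hNtop).1 ?_
      calc N ^ 2 * N ^ 2 ≤ (‖f‖ₑ * ‖Z‖ₑ) * (‖f‖ₑ * ‖Z‖ₑ) := mul_le_mul' hN2 hN2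
        _ = ‖f‖ₑ ^ 2 * ‖Z‖ₑ ^ 2 := by ring
        _ ≤ ‖f‖ₑ ^ 2 * (2 * ENNReal.ofReal a * N * N) := by gcongr
        _ = _ := by ring
    refine le_trans (le_of_eq ?_) hfin
    rw [hN, eLpNorm_two_sq, ← lintegral_indicator measurableSet_Icc]
    refine lintegral_congr fun s => ?_
    by_cases h : s ∈ Set.Icc (-T) T <;> simp [hg, h]
  have hmono : Monotone fun n : ℕ => Set.Icc (-(n : ℝ)) n := fun m n h =>
    Set.Icc_subset_Icc (by simpa using h) (by simpa using h)
  have huniv : ⋃ n : ℕ, Set.Icc (-(n : ℝ)) n = Set.univ := by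
    refine Set.eq_univ_of_forall fun t => Set.mem_iUnion.2 ?_
    obtain ⟨n, hn⟩ := exists_nat_ge |t|
    exact ⟨n, abs_le.1 hn⟩
  rw [← setLIntegral_univ, ← huniv, setLIntegral_iUnion_of_directed _ hmono.directed_le]
  exact iSup_le fun n => hloc n

end UnitaryFlow

/-! ### Multiplication operators on L² -/

section MulLp

variable {α : Type*} [MeasurableSpace α] {μ : Measure α}

theorem memLp_bounded_mul {b : α → ℂ} (hb : AEStronglyMeasurable b μ) {C : ℝ}
    (hC : ∀ x, ‖b x‖ ≤ C) {f : α → ℂ} (hf : MemLp f 2 μ) : MemLp (fun x => b x * f x) 2 μ :=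
  hf.of_le_mul (hb.mul hf.1) (Eventually.of_forall fun x => by
    rw [norm_mul]; exact mul_le_mul_of_nonneg_right (hC x) (norm_nonneg _))

/-- Multiplication by a bounded function, as an operator on `L²`. -/
noncomputable def mulL2 (b : α → ℂ) (hb : AEStronglyMeasurable b μ) (C : ℝ)
    (hC : ∀ x, ‖b x‖ ≤ C) : Lp ℂ 2 μ →L[ℂ] Lp ℂ 2 μ :=
  LinearMap.mkContinuous
    { toFun := fun f => (memLp_bounded_mul hb hC (Lp.memLp f)).toLp _
      map_add' := fun f g => by
        rw [← MemLp.toLp_add]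
        refine MemLp.toLp_congr _ _ ?_
        filter_upwards [Lp.coeFn_add f g] with x hx
        rw [hx, Pi.add_apply, Pi.add_apply, mul_add]
      map_smul' := fun c f => by
        rw [RingHom.id_apply, ← MemLp.toLp_const_smul]
        refine MemLp.toLp_congr _ _ ?_
        filter_upwards [Lp.coeFn_smul c f] with x hx
        rw [hx, Pi.smul_apply, Pi.smul_apply, smul_eq_mul, smul_eq_mul,
            mul_left_comm] } C fun f => by
    refine Lp.norm_le_mul_norm_of_ae_le_mul ?_
    filter_upwards [(memLp_bounded_mul hb hC (Lp.memLp f)).coeFn_toLp] with x hx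
    simp only [LinearMap.coe_mk, AddHom.coe_mk, hx, norm_mul]
    exact mul_le_mul_of_nonneg_right (hC x) (norm_nonneg _)

theorem coeFn_mulL2 {b : α → ℂ} (hb : AEStronglyMeasurable b μ) {C : ℝ}
    (hC : ∀ x, ‖b x‖ ≤ C) (f : Lp ℂ 2 μ) : mulL2 b hb C hC f =ᵐ[μ] fun x => b x * f x :=
  (memLp_bounded_mul hb hC (Lp.memLp f)).coeFn_toLp

theorem inner_mulL2_ofReal {b : α → ℝ} (hb : AEStronglyMeasurable (fun x => (b x : ℂ)) μ) {C : ℝ}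
    (hC : ∀ x, ‖(b x : ℂ)‖ ≤ C) (f g : Lp ℂ 2 μ) :
    inner ℂ (mulL2 _ hb C hC f) g = inner ℂ f (mulL2 _ hb C hC g) := by
  rw [L2.inner_def, L2.inner_def]
  refine integral_congr_ae ?_
  filter_upwards [coeFn_mulL2 hb hC f, coeFn_mulL2 hb hC g] with x h1 h2
  rw [h1, h2]
  simp only [RCLike.inner_apply, map_mul, Complex.conj_ofReal]
  ring

end MulLp

/-! ### The free Schrödinger group -/

section FreeFlow

variable {n : ℕ}

theorem coeFn_fourier_fourierMultiplierL2 (m : EuclideanSpace ℝ (Fin n) → ℂ) (hm :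
    MemLp m ∞ volume) (f : L2Space n) :
    (𝓕 (fourierMultiplierL2 m hm f) : L2Space n) =ᵐ[volume] fun ξ => m ξ * (𝓕 f : L2Space n) ξ := by
  unfold fourierMultiplierL2
  rw [FourierTransform.fourier_fourierInv_eq]
  exact MemLp.coeFn_toLp _

theorem L2Space.ext_fourier {f g : L2Space n}
    (h : (𝓕 f : L2Space n) =ᵐ[volume] (𝓕 g : L2Space n)) : f = g :=
  (Lp.fourierTransformₗᵢ (EuclideanSpace ℝ (Fin n)) ℂ).injective (Lp.ext h)

theorem norm_propagatorSymbol (t : ℝ) (ξ : EuclideanSpace ℝ (Fin n)) : ‖propagatorSymbol t ξ‖ =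
    1 := by
  unfold propagatorSymbol
  rw [← Complex.ofReal_neg, Complex.norm_exp_ofReal_mul_I]

theorem propagatorSymbol_add (s t : ℝ) (ξ : EuclideanSpace ℝ (Fin n)) :
    propagatorSymbol (s + t) ξ = propagatorSymbol s ξ * propagatorSymbol t ξ := by
  unfold propagatorSymbol
  rw [← Complex.exp_add]
  congr 1
  push_cast
  ring

theorem propagatorSymbol_zero (ξ : EuclideanSpace ℝ (Fin n)) : propagatorSymbol 0 ξ = 1 := by
  simp [propagatorSymbol]

theorem continuous_propagatorSymbol : Continuous fun p : ℝ × EuclideanSpace ℝ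
    (Fin n) => propagatorSymbol p.1 p.2 := by
  unfold propagatorSymbol
  fun_prop

theorem coeFn_fourier_freePropagator (t : ℝ) (f : L2Space n) :
    (𝓕 (freePropagator t f) : L2Space n) =ᵐ[volume]
      fun ξ => propagatorSymbol t ξ * (𝓕 f : L2Space n) ξ :=
  coeFn_fourier_fourierMultiplierL2 _ _ f

/-- On the Fourier side this is dominated convergence: the symbols are unimodular and continuous in
t. -/
theorem continuous_freePropagator (f : L2Space n) : Continuous fun t => freePropagator t f := by
  refine continuous_iff_continuousAt.2 fun t₀ => ?_
  rw [ContinuousAt, tendsto_iff_edist_tendsto_0]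
  have h : ∀ t, edist (freePropagator t f) (freePropagator t₀ f) = (∫⁻ ξ,
      ‖(propagatorSymbol t ξ - propagatorSymbol t₀ ξ) * (𝓕 f : L2Space n) ξ‖ₑ ^ 2) ^ (1 / 2 : ℝ) :=
          by
    intro t
    rw [← (Lp.fourierTransformₗᵢ (EuclideanSpace ℝ (Fin n)) ℂ).isometry.edist_eq, Lp.edist_def,
        eLpNorm_two_eq]
    congr 1
    refine lintegral_congr_ae ?_
    filter_upwards [coeFn_fourier_freePropagator t f, coeFn_fourier_freePropagator t₀ f]
      with ξ h1 h2
    rw [sub_mul]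
    exact congrArg (fun z : ℂ => ‖z‖ₑ ^ 2) (congrArg₂ (fun z w : ℂ => z - w) h1 h2)
  simp_rw [h]
  have h2 : Tendsto (fun t : ℝ => ∫⁻ ξ,
      ‖(propagatorSymbol t ξ - propagatorSymbol t₀ ξ) * (𝓕 f : L2Space n) ξ‖ₑ ^ 2) (𝓝 t₀)
      (𝓝 (∫⁻ _ : EuclideanSpace ℝ (Fin n), 0)) := by
    have hf := Lp.aestronglyMeasurable (𝓕 f : L2Space n)
    have hc : ∀ t, Continuous fun ξ : EuclideanSpace ℝ (Fin n) =>
        propagatorSymbol t ξ - propagatorSymbol t₀ ξ :=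
      fun t => (continuous_propagatorSymbol.comp (Continuous.prodMk_right t)).sub
        (continuous_propagatorSymbol.comp (Continuous.prodMk_right t₀))
    refine tendsto_lintegral_filter_of_dominated_convergence'
      (fun ξ => (2 * ‖(𝓕 f : L2Space n) ξ‖ₑ) ^ 2) (Eventually.of_forall fun t => ?_)
      (Eventually.of_forall fun t => Eventually.of_forall fun ξ => ?_) ?_
      (Eventually.of_forall fun ξ => ?_)
    · exact ((hc t).aestronglyMeasurable.mul hf).enorm.pow_const 2
    · rw [enorm_mul]
      gcongr
      refine (enorm_sub_le).trans ?_
      rw [← ofReal_norm, ← ofReal_norm, norm_propagatorSymbol, norm_propagatorSymbol]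
      norm_num
    · simp_rw [mul_pow]
      rw [lintegral_const_mul' _ _ (by norm_num), ← eLpNorm_two_sq]
      exact ENNReal.mul_ne_top (by norm_num) (ENNReal.pow_ne_top (Lp.eLpNorm_ne_top _))
    · have hcc : Continuous fun t : ℝ =>
          (propagatorSymbol t ξ - propagatorSymbol t₀ ξ) * (𝓕 f : L2Space n) ξ :=
        ((continuous_propagatorSymbol.comp (Continuous.prodMk_left ξ)).sub
          continuous_const).mul continuous_const
      have := ((ENNReal.continuous_pow 2).comp hcc.enorm).tendsto t₀
      simpa [Function.comp_def] using this
  rw [lintegral_zero] at h2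
  have := (ENNReal.continuous_rpow_const (y := 1 / 2)).tendsto 0 |>.comp h2
  simpa [Function.comp_def] using this

/-- The free Schrödinger group on `L²(ℝⁿ)`. -/
noncomputable def freeFlow (n : ℕ) : UnitaryFlow (L2Space n) where
  toFun t :=
    { toFun := freePropagator t
      map_add' := fun f g => by
        refine L2Space.ext_fourier ?_
        rw [FourierTransform.fourier_add]
        filter_upwards [coeFn_fourier_freePropagator t (f + g), coeFn_fourier_freePropagator t f,
          coeFn_fourier_freePropagator t g,
          Lp.coeFn_add (𝓕 (freePropagator t f) : L2Space n) (𝓕 (freePropagator t g)),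
          Lp.coeFn_add (𝓕 f : L2Space n) (𝓕 g)] with ξ h1 h2 h3 h4 h5
        rw [h1, h4, FourierTransform.fourier_add, h5]
        simp only [Pi.add_apply, h2, h3, mul_add]
      map_smul' := fun c f => by
        refine L2Space.ext_fourier ?_
        rw [RingHom.id_apply, FourierTransform.fourier_smul]
        filter_upwards [coeFn_fourier_freePropagator t (c • f), coeFn_fourier_freePropagator t f,
          Lp.coeFn_smul c (𝓕 (freePropagator t f) : L2Space n),
          Lp.coeFn_smul c (𝓕 f : L2Space n)] with ξ h1 h2 h3 h4
        rw [h1, h3, FourierTransform.fourier_smul, h4]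
        simp only [Pi.smul_apply, h2, smul_eq_mul, mul_left_comm]
      norm_map' := fun f => by
        change ‖freePropagator t f‖ = ‖f‖
        rw [← Lp.norm_fourier_eq f, ← Lp.norm_fourier_eq (freePropagator t f), Lp.norm_def,
          Lp.norm_def]
        congr 1
        refine eLpNorm_congr_norm_ae ?_
        filter_upwards [coeFn_fourier_freePropagator t f] with ξ h1
        rw [h1, norm_mul, norm_propagatorSymbol, one_mul] }
  map_zero' f := by
    refine L2Space.ext_fourier ?_
    filter_upwards [coeFn_fourier_freePropagator 0 f] with ξ h1
    refine h1.trans ?_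
    rw [propagatorSymbol_zero, one_mul]
  map_add' s t f := by
    refine L2Space.ext_fourier ?_
    filter_upwards [coeFn_fourier_freePropagator (s + t) f, coeFn_fourier_freePropagator t f,
      coeFn_fourier_freePropagator s (freePropagator t f)] with ξ h1 h2 h3
    refine h1.trans (Eq.trans ?_ h3.symm)
    rw [h2, propagatorSymbol_add, mul_assoc]
  continuous' f := continuous_freePropagator f

theorem freeFlow_apply (t : ℝ) (f : L2Space n) : freeFlow n t f = freePropagator t f := rfl

end FreeFlow

/-! ### The Laplace transform of the free group is the free resolvent -/

section Resolvent

variable {n : ℕ}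

theorem UnitaryFlow.integrable_laplace {H : Type*} [NormedAddCommGroup H] [InnerProductSpace ℂ H]
    (U : UnitaryFlow H) {ε : ℝ} (hε : 0 < ε) (τ : ℝ) (f : H) :
    IntegrableOn (fun r : ℝ => Complex.exp (-((ε : ℂ) + 2 * Real.pi * τ * Complex.I) * r) • U r f)
      (Set.Ioi 0) := by
  refine ((integrableOn_exp_neg hε).mul_const ‖f‖).mono' ?_ (Eventually.of_forall fun r => ?_)
  · exact (Continuous.smul (by fun_prop) (U.continuous' f)).aestronglyMeasurable
  · rw [norm_smul, norm_exp_laplace, U.norm_map]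

/-- If a unitary group on `L²(ℝⁿ)` acts on the Fourier side by `e^{irm(ξ)}`, its Laplace transform
at `ζ` acts by `(ζ - im(ξ))⁻¹`. -/
theorem coeFn_fourier_laplace (U : UnitaryFlow (L2Space n)) (f : L2Space n) (m : EuclideanSpace ℝ
    (Fin n) → ℝ)
    (hm : Continuous m)
    (hU : ∀ r, (𝓕 (U r f) : L2Space n) =ᵐ[volume]
      fun ξ => Complex.exp ((m ξ : ℂ) * Complex.I * r) * (𝓕 f : L2Space n) ξ)
    {ε : ℝ} (hε : 0 < ε) (τ : ℝ) (Φ : L2Space n)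
    (hΦ : (𝓕 Φ : L2Space n) =ᵐ[volume] fun ξ =>
      ((ε : ℂ) + 2 * Real.pi * τ * Complex.I - m ξ * Complex.I)⁻¹ * (𝓕 f : L2Space n) ξ) :
    ∫ r in Set.Ioi (0 : ℝ),
      Complex.exp (-((ε : ℂ) + 2 * Real.pi * τ * Complex.I) * r) • U r f = Φ := by
  set ζ : ℂ := (ε : ℂ) + 2 * Real.pi * τ * Complex.I with hζ
  have hζre : ζ.re = ε := by simp [hζ]
  refine (Lp.fourierTransformₗᵢ (EuclideanSpace ℝ (Fin n)) ℂ).injective ?_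
  change (Lp.fourierTransformₗᵢ (EuclideanSpace ℝ (Fin n)) ℂ) _ = (𝓕 Φ : L2Space n)
  have hint := U.integrable_laplace hε τ f
  have h1 := ((Lp.fourierTransformₗᵢ (EuclideanSpace ℝ (Fin n)) ℂ).toContinuousLinearEquiv.toContinuousLinearMap
    ).integral_comp_comm hint
  refine Eq.trans h1.symm ?_
  simp only [ContinuousLinearMap.map_smul]
  change ∫ r in Set.Ioi (0 : ℝ), Complex.exp (-ζ * r) • (𝓕 (U r f) : L2Space n) = _
  have hint2 : IntegrableOn (fun r : ℝ => Complex.exp (-ζ * r) • (𝓕 (U r f) : L2Space n))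
      (Set.Ioi 0) := by
    have := ((Lp.fourierTransformₗᵢ (EuclideanSpace ℝ (Fin n)) ℂ).toContinuousLinearEquiv.toContinuousLinearMap
      ).integrable_comp hint
    simp only [ContinuousLinearMap.map_smul] at this
    exact this
  -- Testing against χ replaces the L²-valued integral by a scalar double integral; after Fubini the
  -- integral in r is elementary for each ξ, as Re ζ = ε > 0.
  refine ext_inner_left ℂ fun χ => ?_
  rw [← integral_inner hint2, L2.inner_def]
  have h2 : ∀ r : ℝ, inner ℂ χ (Complex.exp (-ζ * r) • (𝓕 (U r f) : L2Space n)) =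
      ∫ ξ : EuclideanSpace ℝ (Fin n), Complex.exp (-(ζ - m ξ * Complex.I) * r) *
        (inner ℂ (χ ξ) ((𝓕 f : L2Space n) ξ) : ℂ) := by
    intro r
    rw [inner_smul_right, L2.inner_def, ← integral_const_mul]
    refine integral_congr_ae ?_
    filter_upwards [hU r] with ξ h
    rw [h]
    simp only [RCLike.inner_apply]
    have : Complex.exp (-(ζ - m ξ * Complex.I) * r) =
        Complex.exp (-ζ * r) * Complex.exp ((m ξ : ℂ) * Complex.I * r) := by
      rw [← Complex.exp_add]; ring_nf
    rw [this]
    ring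
  simp_rw [h2]
  have hχf : Integrable (fun ξ : EuclideanSpace ℝ (Fin n) =>
      (inner ℂ (χ ξ) ((𝓕 f : L2Space n) ξ) : ℂ)) volume :=
    L2.integrable_inner (𝕜 := ℂ) χ (𝓕 f : L2Space n)
  rw [integral_integral_swap]
  · refine integral_congr_ae ?_
    filter_upwards [hΦ] with ξ h
    have hre : (-(ζ - m ξ * Complex.I)).re < 0 := by simp [hζre, hε]
    rw [h, integral_mul_const, integral_exp_mul_complex_Ioi hre]
    have e : -Complex.exp (-(ζ - m ξ * Complex.I) * (0 : ℝ)) / -(ζ - m ξ * Complex.I) =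
        (ζ - m ξ * Complex.I)⁻¹ := by
      rw [neg_div_neg_eq]
      simp
    rw [e]
    simp only [RCLike.inner_apply]
    ring
  · have hP : Integrable (fun p : ℝ × EuclideanSpace ℝ (Fin n) => Real.exp (-ε * p.1) *
        ‖(inner ℂ (χ p.2) ((𝓕 f : L2Space n) p.2) : ℂ)‖)
        ((volume.restrict (Set.Ioi 0)).prod volume) :=
      Integrable.mul_prod (UnitaryFlow.integrableOn_exp_neg hε) hχf.norm
    refine hP.mono' ?_ (Eventually.of_forall fun p => ?_)
    · exact (Continuous.aestronglyMeasurable (by fun_prop)).mul hχf.1.comp_snd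
    · simp only [Function.uncurry, norm_mul, Complex.norm_exp]
      simp [hζre]

/-- With z = -2πτ + iε one has ε + 2πiτ + 4π²i|ξ|² = i(4π²|ξ|² - z), so forward evolution sees the
upper half-plane. -/
theorem integral_exp_smul_freeFlow {ε : ℝ} (hε : 0 < ε) (τ : ℝ) (f : L2Space n)
    (hz : (((-(2 * Real.pi * τ) : ℝ) : ℂ) + ε * Complex.I).im ≠ 0) :
    ∫ r in Set.Ioi (0 : ℝ),
      Complex.exp (-((ε : ℂ) + 2 * Real.pi * τ * Complex.I) * r) • freeFlow n r f =
      (-Complex.I) • freeResolvent (((-(2 * Real.pi * τ) : ℝ) : ℂ) + ε * Complex.I) hz f := by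
  refine coeFn_fourier_laplace _ f (fun ξ => -(4 * Real.pi ^ 2 * ‖ξ‖ ^ 2)) (by fun_prop)
    (fun r => ?_) hε τ _ ?_
  · refine (coeFn_fourier_freePropagator r f).trans (Eventually.of_forall fun ξ => ?_)
    simp only [propagatorSymbol]
    congr 2
    push_cast
    ring
  · rw [FourierTransform.fourier_smul]
    filter_upwards [Lp.coeFn_smul (-Complex.I) (𝓕 (freeResolvent _ hz f) : L2Space n),
      coeFn_fourier_fourierMultiplierL2 _ (resolventSymbol_memLp hz) f] with ξ h1 h2
    rw [h1, Pi.smul_apply, freeResolvent, h2, smul_eq_mul, ← mul_assoc, resolventSymbol]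
    congr 1
    rw [← Complex.inv_I, ← mul_inv]
    congr 1
    push_cast
    linear_combination (-ε : ℂ) * Complex.I_sq

/-- With z = 2πτ - iε one has ε + 2πiτ - 4π²i|ξ|² = -i(4π²|ξ|² - z), so backward evolution sees the
lower half-plane. -/
theorem integral_exp_smul_freeFlow_reverse {ε : ℝ} (hε : 0 < ε) (τ : ℝ) (f : L2Space n)
    (hz : (((2 * Real.pi * τ : ℝ) : ℂ) - ε * Complex.I).im ≠ 0) :
    ∫ r in Set.Ioi (0 : ℝ), Complex.exp (-((ε : ℂ) + 2 * Real.pi * τ * Complex.I) * r) •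
      (freeFlow n).reverse r f =
      Complex.I • freeResolvent (((2 * Real.pi * τ : ℝ) : ℂ) - ε * Complex.I) hz f := by
  refine coeFn_fourier_laplace _ f (fun ξ => 4 * Real.pi ^ 2 * ‖ξ‖ ^ 2) (by fun_prop)
    (fun r => ?_) hε τ _ ?_
  · refine (coeFn_fourier_freePropagator (-r) f).trans (Eventually.of_forall fun ξ => ?_)
    simp only [propagatorSymbol]
    congr 2
    push_cast
    ring
  · rw [FourierTransform.fourier_smul]
    filter_upwards [Lp.coeFn_smul Complex.I (𝓕 (freeResolvent _ hz f) : L2Space n),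
      coeFn_fourier_fourierMultiplierL2 _ (resolventSymbol_memLp hz) f] with ξ h1 h2
    rw [h1, Pi.smul_apply, freeResolvent, h2, smul_eq_mul, ← mul_assoc, resolventSymbol]
    congr 1
    rw [← neg_neg Complex.I, ← Complex.inv_I, neg_mul, ← mul_inv, ← inv_neg]
    congr 1
    push_cast
    rw [Complex.inv_I]
    linear_combination (-ε : ℂ) * Complex.I_sq

end Resolvent

/-! ### Truncated weights and the sandwiched resolvent bound -/

section Truncation

variable {n : ℕ}

/-- The weight `|V|^{1/2}`, cut off where `|V| > N`. -/
noncomputable def truncWeight {α : Type*} (V : α → ℂ) (N : ℝ) (x : α) : ℝ :=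
  if ‖V x‖ ≤ N then Real.sqrt ‖V x‖ else 0

theorem truncWeight_nonneg {α : Type*} (V : α → ℂ) (N : ℝ) (x : α) : 0 ≤ truncWeight V N x := by
  unfold truncWeight
  split_ifs
  exacts [Real.sqrt_nonneg _, le_rfl]

theorem norm_truncWeight_le {α : Type*} (V : α → ℂ) (N : ℝ) (x : α) :
    ‖(truncWeight V N x : ℂ)‖ ≤ Real.sqrt N := by
  rw [Complex.norm_real, Real.norm_of_nonneg (truncWeight_nonneg V N x)]
  unfold truncWeight
  split_ifs with h
  exacts [Real.sqrt_le_sqrt h, Real.sqrt_nonneg _]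

theorem enorm_truncWeight_sq_le {α : Type*} (V : α → ℂ) (N : ℝ) (x : α) :
    ‖(truncWeight V N x : ℂ)‖ₑ ^ 2 ≤ ‖V x‖ₑ := by
  rw [← ofReal_norm, ← ofReal_norm, ← ENNReal.ofReal_pow (norm_nonneg _), Complex.norm_real,
    Real.norm_of_nonneg (truncWeight_nonneg V N x)]
  refine ENNReal.ofReal_le_ofReal ?_
  unfold truncWeight
  split_ifs
  · rw [Real.sq_sqrt (norm_nonneg _)]
  · simp

theorem aestronglyMeasurable_truncWeight {α : Type*} [MeasurableSpace α] {μ : Measure α}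
    {V : α → ℂ} (hV : AEStronglyMeasurable V μ) (N : ℝ) :
    AEStronglyMeasurable (fun x => (truncWeight V N x : ℂ)) μ := by
  have h : Measurable fun z : ℂ => if ‖z‖ ≤ N then Real.sqrt ‖z‖ else 0 :=
    Measurable.ite (measurableSet_le measurable_norm measurable_const)
      (by fun_prop) measurable_const
  exact (Complex.measurable_ofReal.comp_aemeasurable
    (h.comp_aemeasurable hV.aemeasurable)).aestronglyMeasurable

/-- Multiplication by the truncated weight. -/
noncomputable def truncMul {α : Type*} [MeasurableSpace α] {μ : Measure α} {V : α → ℂ}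
    (hV : AEStronglyMeasurable V μ) (N : ℝ) : Lp ℂ 2 μ →L[ℂ] Lp ℂ 2 μ :=
  mulL2 _ (aestronglyMeasurable_truncWeight hV N) (Real.sqrt N) (norm_truncWeight_le V N)

theorem coeFn_truncMul {α : Type*} [MeasurableSpace α] {μ : Measure α} {V : α → ℂ}
    (hV : AEStronglyMeasurable V μ) (N : ℝ) (f : Lp ℂ 2 μ) :
    truncMul hV N f =ᵐ[μ] fun x => (truncWeight V N x : ℂ) * f x :=
  coeFn_mulL2 _ _ f

/-- The squared truncated weight is at most |V|, and where V = 0 the product 0 · ∞ is 0. So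
truncated multiplication maps L² into L²(|V|⁻¹) without loss, for every N. -/
theorem weightedL2Norm_inv_truncMul_le {α : Type*} [MeasurableSpace α] {μ : Measure α} {V : α → ℂ}
    (hV : AEStronglyMeasurable V μ) (N : ℝ) (f : Lp ℂ 2 μ) :
    weightedL2Norm μ (fun x => ‖V x‖ₑ⁻¹) (truncMul hV N f) ≤ ‖f‖ₑ := by
  rw [Lp.enorm_def, eLpNorm_two_eq, weightedL2Norm]
  refine ENNReal.rpow_le_rpow (lintegral_mono_ae ?_) (by norm_num)
  filter_upwards [coeFn_truncMul hV N f] with x hx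
  rw [hx, enorm_mul, mul_pow, mul_right_comm]
  have h : ‖(truncWeight V N x : ℂ)‖ₑ ^ 2 * ‖V x‖ₑ⁻¹ ≤ 1 := by
    by_cases h0 : V x = 0
    · simp [truncWeight, h0]
    · calc _ ≤ ‖V x‖ₑ * ‖V x‖ₑ⁻¹ := by gcongr; exact enorm_truncWeight_sq_le V N x
        _ ≤ 1 := ENNReal.mul_inv_le_one _
  calc _ ≤ 1 * ‖f x‖ₑ ^ 2 := by gcongr
    _ = _ := one_mul _

theorem enorm_truncMul_le {α : Type*} [MeasurableSpace α] {μ : Measure α} {V : α → ℂ}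
    (hV : AEStronglyMeasurable V μ) (N : ℝ) (f : Lp ℂ 2 μ) :
    ‖truncMul hV N f‖ₑ ≤ weightedL2Norm μ (fun x => ‖V x‖ₑ) f := by
  rw [Lp.enorm_def, eLpNorm_two_eq, weightedL2Norm]
  refine ENNReal.rpow_le_rpow (lintegral_mono_ae ?_) (by norm_num)
  filter_upwards [coeFn_truncMul hV N f] with x hx
  rw [hx, enorm_mul, mul_pow, mul_comm]
  gcongr
  exact enorm_truncWeight_sq_le V N x

/-- The resolvent estimate of a potential `V`, with constant `a`. -/
def ResolventBound (V : EuclideanSpace ℝ (Fin n) → ℂ) (a : ℝ≥0) : Prop :=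
  ∀ (z : ℂ) (hz : z.im ≠ 0) (f : L2Space n), MemWeightedL2 volume (fun x => ‖V x‖ₑ⁻¹) f →
    weightedL2Norm volume (fun x => ‖V x‖ₑ) (freeResolvent z hz f) ≤
      (a : ℝ≥0∞) * weightedL2Norm volume (fun x => ‖V x‖ₑ⁻¹) f

variable {V : EuclideanSpace ℝ (Fin n) → ℂ} {a : ℝ≥0}

/-- The inner factor enters L²(|V|⁻¹) and the outer factor leaves L²(|V|), both contractively; hence
the constant a does not depend on N. -/
theorem ResolventBound.norm_truncMul_le (h : ResolventBound V a)
    (hV : AEStronglyMeasurable V volume) (N : ℝ) (z : ℂ) (hz : z.im ≠ 0) (f : L2Space n) :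
    ‖truncMul hV N (freeResolvent z hz (truncMul hV N f))‖ ≤ a * ‖f‖ := by
  have h1 := weightedL2Norm_inv_truncMul_le hV N f
  have h2 : ‖truncMul hV N (freeResolvent z hz (truncMul hV N f))‖ₑ ≤ (a : ℝ≥0∞) * ‖f‖ₑ :=
    (enorm_truncMul_le hV N _).trans
      ((h z hz _ ⟨Lp.aestronglyMeasurable _, h1.trans_lt enorm_lt_top⟩).trans (by gcongr))
  have h3 : ‖truncMul hV N (freeResolvent z hz (truncMul hV N f))‖₊ ≤ a * ‖f‖₊ := by
    rw [enorm_eq_nnnorm, enorm_eq_nnnorm] at h2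
    exact_mod_cast h2
  exact_mod_cast h3

theorem ResolventBound.laplaceBound (h : ResolventBound V a)
    (hV : AEStronglyMeasurable V volume) (N : ℝ) :
    (freeFlow n).LaplaceBound (truncMul hV N) a := by
  intro ε hε τ f
  have hz : (((-(2 * Real.pi * τ) : ℝ) : ℂ) + ε * Complex.I).im ≠ 0 := by
    simpa using hε.ne'
  refine (congrArg (fun g => ‖truncMul hV N g‖)
    (integral_exp_smul_freeFlow hε τ (truncMul hV N f) hz)).trans_le ?_
  rw [ContinuousLinearMap.map_smul, norm_smul, norm_neg,
    Complex.norm_I, one_mul]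
  exact h.norm_truncMul_le hV N _ hz f

theorem ResolventBound.laplaceBound_reverse (h : ResolventBound V a)
    (hV : AEStronglyMeasurable V volume) (N : ℝ) :
    (freeFlow n).reverse.LaplaceBound (truncMul hV N) a := by
  intro ε hε τ f
  have hz : (((2 * Real.pi * τ : ℝ) : ℂ) - ε * Complex.I).im ≠ 0 := by
    simpa using hε.ne'
  refine (congrArg (fun g => ‖truncMul hV N g‖)
    (integral_exp_smul_freeFlow_reverse hε τ (truncMul hV N f) hz)).trans_le ?_
  rw [ContinuousLinearMap.map_smul, norm_smul,
    Complex.norm_I, one_mul]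
  exact h.norm_truncMul_le hV N _ hz f

theorem truncMul_symm {α : Type*} [MeasurableSpace α] {μ : Measure α} {V : α → ℂ}
    (hV : AEStronglyMeasurable V μ) (N : ℝ) (f g : Lp ℂ 2 μ) :
    inner ℂ (truncMul hV N f) g = inner ℂ f (truncMul hV N g) :=
  inner_mulL2_ofReal _ _ f g

end Truncation

/-! ### Space-time functions and their time slices -/

section SpaceTime

/-- The space `L²(ℝ × ℝⁿ)` of complex-valued functions of time and space. -/
abbrev SpaceTimeL2 (n : ℕ) : Type :=
  Lp ℂ 2 (volume : Measure (ℝ × EuclideanSpace ℝ (Fin n)))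

variable {n : ℕ}

theorem ae_eq_of_slices {T Y : Type*} [MeasurableSpace T] [MeasurableSpace Y] {ν : Measure T}
    {μ : Measure Y} [SFinite μ] {u v : T × Y → ℂ} (hu : AEStronglyMeasurable u (ν.prod μ))
    (hv : AEStronglyMeasurable v (ν.prod μ))
    (h : ∀ᵐ t ∂ν, (fun x => u (t, x)) =ᵐ[μ] fun x => v (t, x)) : u =ᵐ[ν.prod μ] v := by
  have h0 : ∫⁻ p, ‖u p - v p‖ₑ ∂(ν.prod μ) = 0 := by
    rw [lintegral_prod _ (by fun_prop)]
    rw [← lintegral_zero (μ := ν)]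
    refine lintegral_congr_ae ?_
    filter_upwards [h] with t ht
    rw [← lintegral_zero (μ := μ)]
    refine lintegral_congr_ae ?_
    filter_upwards [ht] with x hx
    simp [hx]
  rw [lintegral_eq_zero_iff' (by fun_prop)] at h0
  filter_upwards [h0] with p hp
  simpa [sub_eq_zero] using hp

theorem slices_ae_eq {T Y : Type*} [MeasurableSpace T] [MeasurableSpace Y] {ν : Measure T}
    {μ : Measure Y} [SFinite μ] {u v : T × Y → ℂ} (h : u =ᵐ[ν.prod μ] v) :
    ∀ᵐ t ∂ν, (fun x => u (t, x)) =ᵐ[μ] fun x => v (t, x) :=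
  Measure.ae_ae_of_ae_prod h

/-- A bounded curve need not be square integrable in time. It becomes so after multiplication by
(1+t²)⁻¹, a factor divided out again once representatives are chosen. -/
theorem exists_slices_of_continuous {γ : ℝ → L2Space n} (hc : Continuous γ) {C : ℝ}
    (hC : ∀ t, ‖γ t‖ ≤ C) :
    ∃ u : ℝ × EuclideanSpace ℝ (Fin n) → ℂ, AEStronglyMeasurable u volume ∧
      ∀ᵐ t : ℝ, γ t =ᵐ[volume] fun x => u (t, x) := by
  have hw : Continuous fun t : ℝ => (1 + t ^ 2)⁻¹ :=
    Continuous.inv₀ (by fun_prop) fun t => by positivity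
  have hwL : MemLp (fun t : ℝ => (1 + t ^ 2)⁻¹) 2 volume := by
    refine (memLp_two_iff_integrable_sq_norm hw.aestronglyMeasurable).2 ?_
    refine integrable_inv_one_add_sq.mono' (by fun_prop) (Eventually.of_forall fun t => ?_)
    have h1 : (1 + t ^ 2)⁻¹ ≤ 1 := inv_le_one_of_one_le₀ (by nlinarith [sq_nonneg t])
    have h0 : 0 ≤ (1 + t ^ 2)⁻¹ := by positivity
    rw [norm_pow, norm_norm, Real.norm_of_nonneg h0]
    nlinarith
  have hγ : MemLp (fun t => (((1 + t ^ 2)⁻¹ : ℝ) : ℂ) • γ t) 2 volume := by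
    refine hwL.of_le_mul (c := C)
      ((Complex.continuous_ofReal.comp hw).smul hc).aestronglyMeasurable
      (Eventually.of_forall fun t => ?_)
    rw [norm_smul, Complex.norm_real, mul_comm]
    exact mul_le_mul_of_nonneg_right (hC t) (norm_nonneg _)
  obtain ⟨u, hu, hs⟩ := exists_slices_of_memLp hγ
  refine ⟨fun p => ((1 + p.1 ^ 2 : ℝ) : ℂ) * u p,
    (Continuous.aestronglyMeasurable (by fun_prop)).mul hu.1, ?_⟩
  filter_upwards [hs] with t ht
  filter_upwards [ht, Lp.coeFn_smul (((1 + t ^ 2)⁻¹ : ℝ) : ℂ) (γ t)] with x h1 h2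
  rw [← h1, h2, Pi.smul_apply, smul_eq_mul, ← mul_assoc, ← Complex.ofReal_mul,
    mul_inv_cancel₀ (by positivity), Complex.ofReal_one, one_mul]

end SpaceTime

/-! ### The full weight as a limit of truncations -/

section Weight

variable {α : Type*} [MeasurableSpace α] {μ : Measure α} {V : α → ℂ}

/-- The weight `|V|^{1/2}`. -/
noncomputable def sqrtWeight {α : Type*} (V : α → ℂ) (x : α) : ℂ := (Real.sqrt ‖V x‖ : ℝ)

theorem enorm_sqrtWeight_sq {α : Type*} (V : α → ℂ) (x : α) : ‖sqrtWeight V x‖ₑ ^ 2 = ‖V x‖ₑ := by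
  rw [← ofReal_norm, ← ofReal_norm, ← ENNReal.ofReal_pow (norm_nonneg _), sqrtWeight,
    Complex.norm_real, Real.norm_of_nonneg (Real.sqrt_nonneg _), Real.sq_sqrt (norm_nonneg _)]

theorem aestronglyMeasurable_sqrtWeight (hV : AEStronglyMeasurable V μ) :
    AEStronglyMeasurable (sqrtWeight V) μ := by
  have h : Continuous fun z : ℂ => ((Real.sqrt ‖z‖ : ℝ) : ℂ) := by fun_prop
  exact h.comp_aestronglyMeasurable hV

theorem truncWeight_eventually_eq {α : Type*} (V : α → ℂ) (x : α) :
    ∀ᶠ N : ℕ in atTop, (truncWeight V N x : ℂ) = sqrtWeight V x := by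
  obtain ⟨M, hM⟩ := exists_nat_ge ‖V x‖
  filter_upwards [eventually_ge_atTop M] with N hN
  rw [truncWeight, if_pos (hM.trans (by exact_mod_cast hN)), sqrtWeight]

theorem truncWeight_mono {α : Type*} (V : α → ℂ) (x : α) {M N : ℝ} (h : M ≤ N) :
    truncWeight V M x ≤ truncWeight V N x := by
  unfold truncWeight
  split_ifs with h1 h2 h2
  · exact le_rfl
  · exact absurd (h1.trans h) h2
  · exact Real.sqrt_nonneg _
  · exact le_rfl

theorem norm_truncMul_mono (hV : AEStronglyMeasurable V μ) {M N : ℝ} (h : M ≤ N)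
    (f : Lp ℂ 2 μ) : ‖truncMul hV M f‖ ≤ ‖truncMul hV N f‖ := by
  refine Lp.norm_le_norm_of_ae_le ?_
  filter_upwards [coeFn_truncMul hV M f, coeFn_truncMul hV N f] with x h1 h2
  rw [h1, h2, norm_mul, norm_mul, Complex.norm_real, Complex.norm_real,
    Real.norm_of_nonneg (truncWeight_nonneg V M x), Real.norm_of_nonneg (truncWeight_nonneg V N x)]
  exact mul_le_mul_of_nonneg_right (truncWeight_mono V x h) (norm_nonneg _)

variable {n : ℕ} {V : EuclideanSpace ℝ (Fin n) → ℂ}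

theorem aestronglyMeasurable_sqrtWeight_snd (hV : AEStronglyMeasurable V volume) :
    AEStronglyMeasurable (fun p : ℝ × EuclideanSpace ℝ (Fin n) => sqrtWeight V p.2) volume :=
  (aestronglyMeasurable_sqrtWeight hV).comp_snd

/-- A uniform bound for the truncated weights passes to the full weight. -/
theorem memLp_sqrtWeight_mul_of_truncMul (hV : AEStronglyMeasurable V volume)
    {γ : ℝ → L2Space n} {u : ℝ × EuclideanSpace ℝ (Fin n) → ℂ} (hu : AEStronglyMeasurable u volume)
    (hs : ∀ᵐ t : ℝ, γ t =ᵐ[volume] fun x => u (t, x)) {K : ℝ≥0∞}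
    (hK : ∀ N : ℕ, eLpNorm (fun t => truncMul hV N (γ t)) 2 volume ≤ K) :
    eLpNorm (fun p => sqrtWeight V p.2 * u p) 2 volume ≤ K := by
  have hm : ∀ N : ℕ, AEStronglyMeasurable (fun p : ℝ × EuclideanSpace ℝ (Fin n) =>
      (truncWeight V N p.2 : ℂ) * u p) volume := fun N =>
    (aestronglyMeasurable_truncWeight hV N).comp_snd.mul hu
  refine (Lp.eLpNorm_lim_le_liminf_eLpNorm hm _ (Eventually.of_forall fun p => ?_)).trans ?_
  · refine tendsto_const_nhds.congr' ?_
    filter_upwards [truncWeight_eventually_eq V p.2] with N hN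
    rw [hN]
  · refine liminf_le_of_le (by isBoundedDefault) fun b hb => ?_
    obtain ⟨N, hN⟩ := hb.exists
    refine hN.trans (le_trans (le_of_eq ?_) (hK N))
    refine eLpNorm_prod_eq_of_slices (hm N) ?_
    filter_upwards [hs] with t ht
    filter_upwards [ht, coeFn_truncMul hV N (γ t)] with x h1 h2
    rw [h2, h1]

end Weight

/-! ### The Kato smoothing operator -/

section Smoothing

variable {n : ℕ} {V : EuclideanSpace ℝ (Fin n) → ℂ} {a : ℝ≥0}

/-- `UnitaryFlow.smoothing_bound` holds for every truncation with the same constant, and Fatou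
passes to the full weight. The slices determine w uniquely, so the choice is linear in f. -/
theorem exists_smoothing (h : ResolventBound V a) (hV : AEStronglyMeasurable V volume)
    (f : L2Space n) : ∃ w : SpaceTimeL2 n,
      (∀ᵐ t : ℝ, (fun x => w (t, x)) =ᵐ[volume]
        fun x => sqrtWeight V x * freePropagator t f x) ∧
      ‖w‖ ≤ Real.sqrt (2 * a) * ‖f‖ := by
  obtain ⟨u, hu, hs⟩ := exists_slices_of_continuous (continuous_freePropagator f)
    (C := ‖f‖) fun t => ((freeFlow n).norm_map t f).le
  have hb : eLpNorm (fun p => sqrtWeight V p.2 * u p) 2 volume ≤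
      ENNReal.ofReal (Real.sqrt (2 * a) * ‖f‖) := by
    refine memLp_sqrtWeight_mul_of_truncMul hV hu hs fun N => ?_
    rw [← ENNReal.pow_le_pow_left_iff two_ne_zero, eLpNorm_two_sq]
    refine ((freeFlow n).smoothing_bound (h.laplaceBound hV N) (h.laplaceBound_reverse hV N)
      (truncMul_symm hV N) f).trans (le_of_eq ?_)
    rw [← ENNReal.ofReal_pow (by positivity), mul_pow, Real.sq_sqrt (by positivity),
      ENNReal.ofReal_mul (by positivity), ENNReal.ofReal_mul (by positivity),
      ENNReal.ofReal_pow (norm_nonneg _), ofReal_norm]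
    simp
  have hL : MemLp (fun p => sqrtWeight V p.2 * u p) 2 volume :=
    ⟨(aestronglyMeasurable_sqrtWeight_snd hV).mul hu, hb.trans_lt ENNReal.ofReal_lt_top⟩
  refine ⟨hL.toLp _, ?_, ?_⟩
  · filter_upwards [slices_ae_eq (ν := volume) (μ := volume) hL.coeFn_toLp, hs] with t h1 h2
    filter_upwards [h1, h2] with x h1 h2
    rw [h1, h2]
  · rw [Lp.norm_toLp]
    exact ENNReal.toReal_le_of_le_ofReal (by positivity) hb

theorem SpaceTimeL2.ext_slices {v w : SpaceTimeL2 n}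
    (h : ∀ᵐ t : ℝ, (fun x => v (t, x)) =ᵐ[volume] fun x => w (t, x)) : v = w :=
  Lp.ext (ae_eq_of_slices (ν := volume) (μ := volume) (Lp.aestronglyMeasurable v)
    (Lp.aestronglyMeasurable w) h)

/-- The Kato smoothing operator `f ↦ |V|^{1/2} e^{itΔ} f` from `L²(ℝⁿ)` to `L²(ℝ × ℝⁿ)`. -/
noncomputable def smoothingOp (h : ResolventBound V a) (hV : AEStronglyMeasurable V volume) :
    L2Space n →L[ℂ] SpaceTimeL2 n :=
  LinearMap.mkContinuous
    { toFun := fun f => (exists_smoothing h hV f).choose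
      map_add' := fun f g => by
        refine SpaceTimeL2.ext_slices ?_
        filter_upwards [(exists_smoothing h hV (f + g)).choose_spec.1,
          (exists_smoothing h hV f).choose_spec.1, (exists_smoothing h hV g).choose_spec.1,
          slices_ae_eq (ν := volume) (μ := volume) (Lp.coeFn_add
            (exists_smoothing h hV f).choose (exists_smoothing h hV g).choose)] with t h1 h2 h3 h4
        have h5 : freePropagator t (f + g) = freePropagator t f + freePropagator t g :=
          (freeFlow n t).map_add f g
        filter_upwards [h1, h2, h3, h4, Lp.coeFn_add (freePropagator t f) (freePropagator t g)]
          with x h1 h2 h3 h4 h6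
        rw [h1, h4, h5, h6, Pi.add_apply, Pi.add_apply, h2, h3, mul_add]
      map_smul' := fun c f => by
        refine SpaceTimeL2.ext_slices ?_
        filter_upwards [(exists_smoothing h hV (c • f)).choose_spec.1,
          (exists_smoothing h hV f).choose_spec.1, slices_ae_eq (ν := volume) (μ := volume)
            (Lp.coeFn_smul c (exists_smoothing h hV f).choose)] with t h1 h2 h4
        have h5 : freePropagator t (c • f) = c • freePropagator t f :=
          (freeFlow n t).map_smul c f
        filter_upwards [h1, h2, h4, Lp.coeFn_smul c (freePropagator t f)] with x h1 h2 h4 h6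
        rw [RingHom.id_apply, h1, h4, h5, h6, Pi.smul_apply, Pi.smul_apply, h2, smul_eq_mul,
          smul_eq_mul, mul_left_comm] }
    (Real.sqrt (2 * a)) fun f => (exists_smoothing h hV f).choose_spec.2

theorem smoothingOp_slices (h : ResolventBound V a) (hV : AEStronglyMeasurable V volume)
    (f : L2Space n) : ∀ᵐ t : ℝ, (fun x => smoothingOp h hV f (t, x)) =ᵐ[volume]
        fun x => sqrtWeight V x * freePropagator t f x :=
  (exists_smoothing h hV f).choose_spec.1

theorem norm_smoothingOp_le (h : ResolventBound V a) (hV : AEStronglyMeasurable V volume) :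
    ‖smoothingOp h hV‖ ≤ Real.sqrt (2 * a) :=
  LinearMap.mkContinuous_norm_le _ (Real.sqrt_nonneg _) _

end Smoothing

/-! ### The Duhamel integral and its weighted bound -/

section Duhamel

/-- The signed indicator of the time interval between `0` and `t`. -/
noncomputable def timeCutoff (t s : ℝ) : ℝ :=
  (Set.Iio t).indicator ((Set.Ioi 0).indicator 1) s -
    (Set.Ioi t).indicator ((Set.Iic 0).indicator 1) s

theorem measurable_timeCutoff (t : ℝ) : Measurable (timeCutoff t) :=
  ((measurable_one.indicator measurableSet_Ioi).indicator measurableSet_Iio).sub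
    ((measurable_one.indicator measurableSet_Iic).indicator measurableSet_Ioi)

theorem norm_timeCutoff_le (t s : ℝ) : ‖(timeCutoff t s : ℂ)‖ ≤ 1 := by
  rw [Complex.norm_real]
  simp only [timeCutoff, Set.indicator, Set.mem_Iio, Set.mem_Ioi, Set.mem_Iic, Pi.one_apply]
  split_ifs <;> first | (exfalso; linarith) | norm_num

theorem timeCutoff_eq_zero {t s : ℝ} (h : |t| < |s|) : timeCutoff t s = 0 := by
  simp only [timeCutoff, Set.indicator, Set.mem_Iio, Set.mem_Ioi, Set.mem_Iic, Pi.one_apply]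
  rcases abs_cases t with ⟨h1, h2⟩ | ⟨h1, h2⟩ <;> rcases abs_cases s with ⟨h3, h4⟩ | ⟨h3, h4⟩ <;>
  split_ifs <;> first | (exfalso; linarith) | norm_num

theorem timeCutoff_zero {s : ℝ} : timeCutoff 0 s = 0 := by
  simp only [timeCutoff, Set.indicator, Set.mem_Iio, Set.mem_Ioi, Set.mem_Iic, Pi.one_apply]
  split_ifs <;> first | (exfalso; linarith) | norm_num

theorem timeCutoff_eventually_eq {t₀ s : ℝ} (h : s ≠ t₀) :
    ∀ᶠ t in 𝓝 t₀, timeCutoff t s = timeCutoff t₀ s := by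
  rcases lt_or_gt_of_ne h with h | h
  · filter_upwards [lt_mem_nhds h] with t ht
    simp [timeCutoff, Set.indicator, h, ht, not_lt.2 h.le, not_lt.2 ht.le]
  · filter_upwards [gt_mem_nhds h] with t ht
    simp [timeCutoff, Set.indicator, h, ht, not_lt.2 h.le, not_lt.2 ht.le]

/-- The cutoff is 1 on (0, t) for t > 0 and -1 on (t, 0] for t < 0; this sign is the orientation of
the interval integral, and endpoints are null. -/
theorem integral_timeCutoff_smul {F : Type*} [NormedAddCommGroup F] [NormedSpace ℝ F]
    (t : ℝ) (f : ℝ → F) : ∫ s, timeCutoff t s • f s = ∫ s in (0 : ℝ)..t, f s := by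
  rcases le_total 0 t with h | h
  · have e : ∀ s, timeCutoff t s • f s = (Set.Ioo 0 t).indicator f s := by
      intro s
      simp only [timeCutoff, Set.indicator, Set.mem_Iio, Set.mem_Ioi, Set.mem_Iic, Pi.one_apply,
        Set.mem_Ioo]
      split_ifs <;> first | (exfalso; linarith) | (exfalso; grind) | simp
    simp_rw [e]
    rw [integral_indicator measurableSet_Ioo, intervalIntegral.integral_of_le h,
      integral_Ioc_eq_integral_Ioo]
  · have e : ∀ s, timeCutoff t s • f s = -(Set.Ioc t 0).indicator f s := by
      intro s
      simp only [timeCutoff, Set.indicator, Set.mem_Iio, Set.mem_Ioi, Set.mem_Iic, Pi.one_apply,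
        Set.mem_Ioc]
      split_ifs <;> first | (exfalso; linarith) | (exfalso; grind) | simp
    simp_rw [e]
    rw [integral_neg, integral_indicator measurableSet_Ioc, intervalIntegral.integral_of_ge h]

variable {n : ℕ}

/-- Multiplication by the signed indicator of the time interval between `0` and `t`. -/
noncomputable def timeCutoffMul (t : ℝ) : SpaceTimeL2 n →L[ℂ] SpaceTimeL2 n :=
  mulL2 (fun p : ℝ × EuclideanSpace ℝ (Fin n) => (timeCutoff t p.1 : ℂ))
    (Complex.measurable_ofReal.comp
      ((measurable_timeCutoff t).comp measurable_fst)).aestronglyMeasurable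
    1 fun p => norm_timeCutoff_le t p.1

theorem coeFn_timeCutoffMul (t : ℝ) (g : SpaceTimeL2 n) :
    timeCutoffMul t g =ᵐ[volume] fun p => (timeCutoff t p.1 : ℂ) * g p :=
  coeFn_mulL2 _ _ g

theorem norm_timeCutoffMul_le (t : ℝ) (g : SpaceTimeL2 n) : ‖timeCutoffMul t g‖ ≤ ‖g‖ := by
  refine Lp.norm_le_norm_of_ae_le ?_
  filter_upwards [coeFn_timeCutoffMul t g] with p hp
  rw [hp, norm_mul]
  exact mul_le_of_le_one_left (norm_nonneg _) (norm_timeCutoff_le t p.1)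

/-- Dominated convergence in `L²`. -/
theorem tendsto_L2_of_dominated {α ι : Type*} [MeasurableSpace α] {μ : Measure α} {l : Filter ι}
    [l.IsCountablyGenerated] {F : ι → Lp ℂ 2 μ} {f g : Lp ℂ 2 μ}
    (hb : ∀ i, ∀ᵐ x ∂μ, ‖F i x - f x‖ₑ ≤ 2 * ‖g x‖ₑ)
    {G : ι → α → ℂ} (hG : ∀ i, F i =ᵐ[μ] G i)
    (hlim : ∀ᵐ x ∂μ, Tendsto (fun i => G i x) l (𝓝 (f x))) : Tendsto F l (𝓝 f) := by
  rw [tendsto_iff_edist_tendsto_0]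
  have h2 : Tendsto (fun i => ∫⁻ x, ‖G i x - f x‖ₑ ^ 2 ∂μ) l (𝓝 (∫⁻ _, 0 ∂μ)) := by
    refine tendsto_lintegral_filter_of_dominated_convergence' (fun x => (2 * ‖g x‖ₑ) ^ 2)
      (Eventually.of_forall fun i => ?_) (Eventually.of_forall fun i => ?_) ?_ ?_
    · exact ((((Lp.aestronglyMeasurable (F i)).congr (hG i)).sub
        (Lp.aestronglyMeasurable f)).enorm).pow_const 2
    · filter_upwards [hb i, hG i] with x h1 h3
      rw [h3] at h1
      gcongr
    · simp_rw [mul_pow]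
      rw [lintegral_const_mul' _ _ (by norm_num), ← eLpNorm_two_sq]
      exact ENNReal.mul_ne_top (by norm_num) (ENNReal.pow_ne_top (Lp.eLpNorm_ne_top _))
    · filter_upwards [hlim] with x hx
      have h3 := ((ENNReal.continuous_pow 2).tendsto _).comp
        ((continuous_enorm.tendsto _).comp (hx.sub_const (f x)))
      simpa [Function.comp_def] using h3
  rw [lintegral_zero] at h2
  have h3 := (ENNReal.continuous_rpow_const (y := 1 / 2)).tendsto 0 |>.comp h2
  have h4 : Tendsto (fun i => (∫⁻ x, ‖G i x - f x‖ₑ ^ 2 ∂μ) ^ (1 / 2 : ℝ)) l (𝓝 0) := by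
    simpa [Function.comp_def] using h3
  refine h4.congr fun i => ?_
  rw [Lp.edist_def, eLpNorm_two_eq]
  congr 1
  refine lintegral_congr_ae ?_
  filter_upwards [hG i] with x hx
  rw [Pi.sub_apply, hx]

/-- The cutoff at s is locally constant in t except at t = s, a null set of s for each time;
dominated convergence applies. This gives the solution its continuity in time. -/
theorem continuous_timeCutoffMul (g : SpaceTimeL2 n) : Continuous fun t => timeCutoffMul t g := by
  refine continuous_iff_continuousAt.2 fun t₀ => ?_
  refine tendsto_L2_of_dominated (g := g) (fun t => ?_) (fun t => coeFn_timeCutoffMul t g) ?_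
  · filter_upwards [coeFn_timeCutoffMul t g, coeFn_timeCutoffMul t₀ g] with p h1 h2
    rw [h1, h2, two_mul]
    refine enorm_sub_le.trans (add_le_add ?_ ?_) <;>
    · rw [← ofReal_norm, ← ofReal_norm, norm_mul]
      exact ENNReal.ofReal_le_ofReal
        (mul_le_of_le_one_left (norm_nonneg _) (norm_timeCutoff_le _ p.1))
  · have hne : ∀ᵐ p : ℝ × EuclideanSpace ℝ (Fin n), p.1 ≠ t₀ :=
      Measure.quasiMeasurePreserving_fst.ae (Measure.ae_ne volume t₀)
    filter_upwards [coeFn_timeCutoffMul t₀ g, hne] with p h1 h2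
    rw [h1]
    refine tendsto_const_nhds.congr' ?_
    filter_upwards [timeCutoff_eventually_eq h2] with t ht
    rw [ht]

variable {V : EuclideanSpace ℝ (Fin n) → ℂ} {a : ℝ≥0}

/-- The Duhamel integral `∫₀ᵗ e^{i(t-s)Δ} |V|^{1/2} g(s) ds`, as a curve in `L²(ℝⁿ)`. -/
noncomputable def duhamelCurve (h : ResolventBound V a) (hV : AEStronglyMeasurable V volume)
    (g : SpaceTimeL2 n) (t : ℝ) : L2Space n :=
  freePropagator t ((smoothingOp h hV).adjoint (timeCutoffMul t g))

/-- With S the smoothing operator the curve is e^{itΔ} S*(χ_t g), χ_t being the signed time cutoff.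
As |V|^{1/2} g(s) need not lie in L²(ℝⁿ), the adjoint replaces a Bochner integral; continuity is
that of the group and of χ_t g. -/
theorem continuous_duhamelCurve (h : ResolventBound V a) (hV : AEStronglyMeasurable V volume)
    (g : SpaceTimeL2 n) : Continuous (duhamelCurve h hV g) :=
  (freeFlow n).continuous_comp continuous_id
    ((smoothingOp h hV).adjoint.continuous.comp (continuous_timeCutoffMul g))

theorem norm_duhamelCurve_le (h : ResolventBound V a) (hV : AEStronglyMeasurable V volume)
    (g : SpaceTimeL2 n) (t : ℝ) : ‖duhamelCurve h hV g t‖ ≤ Real.sqrt (2 * a) * ‖g‖ := by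
  refine ((freeFlow n).norm_map t _).le.trans ?_
  refine ((smoothingOp h hV).adjoint.le_opNorm _).trans ?_
  rw [LinearIsometryEquiv.norm_map]
  exact mul_le_mul (norm_smoothingOp_le h hV) (norm_timeCutoffMul_le t g) (norm_nonneg _)
    (Real.sqrt_nonneg _)

theorem duhamelCurve_zero (h : ResolventBound V a) (hV : AEStronglyMeasurable V volume)
    (g : SpaceTimeL2 n) : duhamelCurve h hV g 0 = 0 := by
  have : timeCutoffMul 0 g = 0 := by
    refine Lp.ext ((coeFn_timeCutoffMul 0 g).trans ?_)
    filter_upwards [Lp.coeFn_zero ℂ 2 (volume : Measure (ℝ × EuclideanSpace ℝ (Fin n)))] with p hp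
    rw [hp, timeCutoff_zero]
    simp
  rw [duhamelCurve, this, _root_.map_zero]
  exact (freeFlow n 0).map_zero

theorem duhamelCurve_sub (h : ResolventBound V a) (hV : AEStronglyMeasurable V volume)
    (g g' : SpaceTimeL2 n) (t : ℝ) :
    duhamelCurve h hV (g - g') t = duhamelCurve h hV g t - duhamelCurve h hV g' t := by
  simp only [duhamelCurve, _root_.map_sub]
  exact (freeFlow n t).map_sub _ _

theorem continuous_duhamelCurve_left (h : ResolventBound V a) (hV : AEStronglyMeasurable V volume)
    (t : ℝ) : Continuous fun g => duhamelCurve h hV g t :=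
  (freeFlow n t).continuous.comp
    ((smoothingOp h hV).adjoint.continuous.comp (timeCutoffMul t).continuous)

/-- Cut-off of a space-time function to the set where `|V| ≤ N`. -/
noncomputable def levelMul (hV : AEStronglyMeasurable V volume) (N : ℝ) :
    SpaceTimeL2 n →L[ℂ] SpaceTimeL2 n :=
  mulL2 (fun p : ℝ × EuclideanSpace ℝ (Fin n) => if ‖V p.2‖ ≤ N then 1 else 0) (by
    have hm : Measurable fun z : ℂ => if ‖z‖ ≤ N then (1 : ℂ) else 0 :=
      Measurable.ite (measurableSet_le measurable_norm measurable_const)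
        measurable_const measurable_const
    exact (hm.comp_aemeasurable hV.comp_snd.aemeasurable).aestronglyMeasurable)
    1 fun p => by split_ifs <;> simp

theorem coeFn_levelMul (hV : AEStronglyMeasurable V volume) (N : ℝ) (g : SpaceTimeL2 n) :
    levelMul hV N g =ᵐ[volume] fun p => (if ‖V p.2‖ ≤ N then 1 else 0) * g p :=
  coeFn_mulL2 _ _ g

theorem tendsto_levelMul (hV : AEStronglyMeasurable V volume) (g : SpaceTimeL2 n) :
    Tendsto (fun N : ℕ => levelMul hV N g) atTop (𝓝 g) := by
  refine tendsto_L2_of_dominated (g := g) (fun t => ?_) (fun t => coeFn_levelMul hV t g) ?_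
  · filter_upwards [coeFn_levelMul hV t g] with p h1
    rw [h1, two_mul]
    refine enorm_sub_le.trans (add_le_add ?_ le_rfl)
    split_ifs <;> simp
  · refine Eventually.of_forall fun p => tendsto_const_nhds.congr' ?_
    obtain ⟨M, hM⟩ := exists_nat_ge ‖V p.2‖
    filter_upwards [eventually_ge_atTop M] with N hN
    rw [if_pos (hM.trans (by exact_mod_cast hN)), one_mul]

theorem memLp_timeCutoff_smul {γ : ℝ → L2Space n} (hγ : MemLp γ 2 volume) (t : ℝ) :
    Integrable fun s => (timeCutoff t s : ℂ) • γ s := by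
  have hm : AEStronglyMeasurable (fun s => (timeCutoff t s : ℂ)) volume :=
    (Complex.measurable_ofReal.comp (measurable_timeCutoff t)).aestronglyMeasurable
  have h1 : MemLp (fun s => (timeCutoff t s : ℂ)) 2 volume := by
    refine (memLp_indicator_const (μ := volume) 2 (s := Set.Icc (-|t|) |t|) measurableSet_Icc
      (1 : ℝ) (Or.inr (by simp))).of_le hm (Eventually.of_forall fun s => ?_)
    by_cases hs : s ∈ Set.Icc (-|t|) |t|
    · rw [Set.indicator_of_mem hs]
      simpa using norm_timeCutoff_le t s
    · rw [timeCutoff_eq_zero (by rw [Set.mem_Icc, ← abs_le, not_le] at hs; exact hs)]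
      simp
  have h2 : MemLp ((fun s => (timeCutoff t s : ℂ)) • γ) 1 volume := hγ.smul h1
  exact memLp_one_iff_integrable.1 h2

/-- On {|V| ≤ N} the full and the truncated weight agree, so for a source living there the adjoint
is a genuine Bochner integral, to which the abstract evolution bounds apply. -/
theorem adjoint_smoothingOp_levelMul (h : ResolventBound V a) (hV : AEStronglyMeasurable V volume)
    (N : ℝ) {g : SpaceTimeL2 n} {γ : ℝ → L2Space n} (hγ : MemLp γ 2 volume)
    (hs : ∀ᵐ t : ℝ, γ t =ᵐ[volume] fun x => g (t, x)) (t : ℝ) :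
    (smoothingOp h hV).adjoint (timeCutoffMul t (levelMul hV N g)) =
      ∫ s, freeFlow n (0 - s) (truncMul hV N ((timeCutoff t s : ℂ) • γ s)) := by
  refine ext_inner_left ℂ fun f => ?_
  refine Eq.trans ?_ (UnitaryFlow.inner_integral_evolution (U := freeFlow n) (truncMul_symm hV N)
    (memLp_timeCutoff_smul hγ t) f).symm
  rw [ContinuousLinearMap.adjoint_inner_right, L2.inner_def]
  have hint := L2.integrable_inner (𝕜 := ℂ) (smoothingOp h hV f)
    (timeCutoffMul t (levelMul hV N g))
  refine (integral_prod (μ := volume) (ν := volume) _ hint).trans (integral_congr_ae ?_)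
  filter_upwards [smoothingOp_slices h hV f, hs,
    slices_ae_eq (ν := volume) (μ := volume) (coeFn_timeCutoffMul t (levelMul hV N g)),
    slices_ae_eq (ν := volume) (μ := volume) (coeFn_levelMul hV N g)] with s h1 h2 h3 h4
  rw [L2.inner_def]
  refine integral_congr_ae ?_
  filter_upwards [h1, h2, h3, h4, coeFn_truncMul hV N (freeFlow n s f),
    Lp.coeFn_smul (timeCutoff t s : ℂ) (γ s)] with x h1 h2 h3 h4 h5 h6
  rw [h1, h3, h4, h5, h6, Pi.smul_apply, h2, freeFlow_apply]
  simp only [RCLike.inner_apply, smul_eq_mul, map_mul, sqrtWeight, truncWeight]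
  split_ifs <;> simp

/-- This splitting, valid for both signs of t, presents ∫₀ᵗ as the causal evolution of the source at
times s > 0 minus the anticausal evolution of the source at times s ≤ 0. -/
theorem timeCutoff_smul_eq {F : Type*} [NormedAddCommGroup F] [NormedSpace ℂ F] (t : ℝ)
    (γ : ℝ → F) (s : ℝ) : (timeCutoff t s : ℂ) • γ s =
      (Set.Iio t).indicator ((Set.Ioi 0).indicator γ) s -
      (Set.Ioi t).indicator ((Set.Iic 0).indicator γ) s := by
  rw [timeCutoff, Complex.ofReal_sub, sub_smul]
  simp only [Set.indicator]
  congr 1 <;> split_ifs <;> simp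

/-- The causal and the anticausal part contribute a ‖g‖ each. -/
theorem eLpNorm_truncMul_duhamelCurve_levelMul_le (h : ResolventBound V a)
    (hV : AEStronglyMeasurable V volume) (N : ℝ) (g : SpaceTimeL2 n) :
    eLpNorm (fun t => truncMul hV N (duhamelCurve h hV (levelMul hV N g) t)) 2 volume ≤
      2 * a * ‖g‖ₑ := by
  obtain ⟨γ, hγ, hs⟩ := exists_curve_of_memLp (ν := volume) (μ := volume) (Lp.memLp g)
  set γp := (Set.Ioi (0 : ℝ)).indicator γ with hγp
  set γm := (Set.Iic (0 : ℝ)).indicator γ with hγm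
  have hp : MemLp γp 2 volume := hγ.indicator measurableSet_Ioi
  have hm : MemLp γm 2 volume := hγ.indicator measurableSet_Iic
  -- Only the bounded interval (0, t) contributes, and there L² is contained in L¹.
  have hpi : ∀ t, IntegrableOn γp (Set.Iio t) := fun t => by
    rw [hγp, IntegrableOn, integrable_indicator_iff measurableSet_Ioi, IntegrableOn,
      Measure.restrict_restrict measurableSet_Ioi]
    have : IsFiniteMeasure ((volume : Measure ℝ).restrict (Set.Ioi 0 ∩ Set.Iio t)) :=
      ⟨by rw [Set.Ioi_inter_Iio]; simp⟩
    exact (hγ.restrict _).integrable (by norm_num)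
  have hmi : ∀ t, IntegrableOn γm (Set.Ioi t) := fun t => by
    rw [hγm, IntegrableOn, integrable_indicator_iff measurableSet_Iic, IntegrableOn,
      Measure.restrict_restrict measurableSet_Iic]
    have : IsFiniteMeasure ((volume : Measure ℝ).restrict (Set.Iic 0 ∩ Set.Ioi t)) :=
      ⟨by rw [Set.inter_comm, Set.Ioi_inter_Iic]; simp⟩
    exact (hγ.restrict _).integrable (by norm_num)
  obtain ⟨m1, b1⟩ := UnitaryFlow.causal_bound (h.laplaceBound hV N) hp hpi
  obtain ⟨m2, b2⟩ := UnitaryFlow.anticausal_bound (h.laplaceBound_reverse hV N) hm hmi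
  have key : ∀ t, truncMul hV N (duhamelCurve h hV (levelMul hV N g) t) =
      truncMul hV N (∫ s in Set.Iio t, freeFlow n (t - s) (truncMul hV N (γp s))) -
      truncMul hV N (∫ s in Set.Ioi t, freeFlow n (t - s) (truncMul hV N (γm s))) := by
    intro t
    rw [← _root_.map_sub, duhamelCurve, adjoint_smoothingOp_levelMul h hV N hγ hs t,
      ← freeFlow_apply]
    congr 1
    refine ((freeFlow n).map_integral t
      (UnitaryFlow.integrable_evolution 0 (memLp_timeCutoff_smul hγ t))).trans ?_
    rw [← integral_indicator measurableSet_Iio, ← integral_indicator measurableSet_Ioi,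
      ← integral_sub]
    · refine integral_congr_ae (Eventually.of_forall fun s => ?_)
      simp only
      rw [← UnitaryFlow.map_add, timeCutoff_smul_eq, _root_.map_sub,
        _root_.map_sub, show t + (0 - s) = t - s by ring]
      congr 1 <;> simp only [Set.indicator] <;> split_ifs <;> simp [γp, γm, *]
    · exact (integrable_indicator_iff measurableSet_Iio).2
        (UnitaryFlow.integrable_evolution t (hpi t))
    · exact (integrable_indicator_iff measurableSet_Ioi).2
        (UnitaryFlow.integrable_evolution t (hmi t))
  simp_rw [key]
  have hγn : eLpNorm γ 2 volume = ‖g‖ₑ := by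
    rw [Lp.enorm_def]
    exact (eLpNorm_prod_eq_of_slices (ν := volume) (μ := volume)
      (Lp.aestronglyMeasurable g) hs).symm
  refine (eLpNorm_sub_le m1 m2 (by norm_num)).trans ((add_le_add b1 b2).trans ?_)
  rw [ENNReal.ofReal_coe_nnreal, mul_assoc, two_mul, ← hγn]
  gcongr <;> exact eLpNorm_indicator_le _

/-- The source level M tends to infinity while the outer level N stays fixed. For M ≥ N the outer
weight may be raised to level M, where both truncations match and the previous bound applies. -/
theorem eLpNorm_truncMul_duhamelCurve_le (h : ResolventBound V a)
    (hV : AEStronglyMeasurable V volume) (N : ℕ) (g : SpaceTimeL2 n) :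
    eLpNorm (fun t => truncMul hV N (duhamelCurve h hV g t)) 2 volume ≤ 2 * a * ‖g‖ₑ := by
  have hlim : ∀ t, Tendsto (fun M : ℕ => truncMul hV N (duhamelCurve h hV (levelMul hV M g) t))
      atTop (𝓝 (truncMul hV N (duhamelCurve h hV g t))) := fun t =>
    ((truncMul hV N).continuous.tendsto _).comp
      (((continuous_duhamelCurve_left h hV t).tendsto g).comp (tendsto_levelMul hV g))
  refine (Lp.eLpNorm_lim_le_liminf_eLpNorm (fun M => ((truncMul hV N).continuous.comp
    (continuous_duhamelCurve h hV _)).aestronglyMeasurable) _ (Eventually.of_forall hlim)).trans ?_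
  refine liminf_le_of_le (by isBoundedDefault) fun b hb => ?_
  obtain ⟨M, hM, hNM⟩ := (hb.and (eventually_ge_atTop N)).exists
  refine hM.trans ((eLpNorm_mono fun t => ?_).trans
    (eLpNorm_truncMul_duhamelCurve_levelMul_le h hV M g))
  exact norm_truncMul_mono hV (by exact_mod_cast hNM) _

theorem exists_duhamel (h : ResolventBound V a) (hV : AEStronglyMeasurable V volume)
    (g : SpaceTimeL2 n) : ∃ w : SpaceTimeL2 n,
      (∀ᵐ t : ℝ, (fun x => w (t, x)) =ᵐ[volume]
        fun x => sqrtWeight V x * duhamelCurve h hV g t x) ∧ ‖w‖ ≤ 2 * a * ‖g‖ := by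
  obtain ⟨u, hu, hs⟩ := exists_slices_of_continuous (continuous_duhamelCurve h hV g)
    (norm_duhamelCurve_le h hV g)
  have hb := memLp_sqrtWeight_mul_of_truncMul hV hu hs fun N =>
    eLpNorm_truncMul_duhamelCurve_le h hV N g
  have hb' : (2 * a * ‖g‖ₑ : ℝ≥0∞) = ENNReal.ofReal (2 * a * ‖g‖) := by
    rw [ENNReal.ofReal_mul (by positivity), ENNReal.ofReal_mul (by positivity), ofReal_norm]
    simp
  rw [hb'] at hb
  have hL : MemLp (fun p => sqrtWeight V p.2 * u p) 2 volume :=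
    ⟨(aestronglyMeasurable_sqrtWeight_snd hV).mul hu, hb.trans_lt ENNReal.ofReal_lt_top⟩
  refine ⟨hL.toLp _, ?_, ?_⟩
  · filter_upwards [slices_ae_eq (ν := volume) (μ := volume) hL.coeFn_toLp, hs] with t h1 h2
    filter_upwards [h1, h2] with x h1 h2
    rw [h1, h2]
  · rw [Lp.norm_toLp]
    exact ENNReal.toReal_le_of_le_ofReal (by positivity) hb

/-- The operator `g ↦ |V|^{1/2} ∫₀ᵗ e^{i(t-s)Δ} |V|^{1/2} g(s) ds` on `L²(ℝ × ℝⁿ)`. -/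
noncomputable def duhamelOp (h : ResolventBound V a) (hV : AEStronglyMeasurable V volume)
    (g : SpaceTimeL2 n) : SpaceTimeL2 n :=
  (exists_duhamel h hV g).choose

theorem duhamelOp_slices (h : ResolventBound V a) (hV : AEStronglyMeasurable V volume)
    (g : SpaceTimeL2 n) : ∀ᵐ t : ℝ, (fun x => duhamelOp h hV g (t, x)) =ᵐ[volume]
        fun x => sqrtWeight V x * duhamelCurve h hV g t x :=
  (exists_duhamel h hV g).choose_spec.1

theorem norm_duhamelOp_le (h : ResolventBound V a) (hV : AEStronglyMeasurable V volume)
    (g : SpaceTimeL2 n) : ‖duhamelOp h hV g‖ ≤ 2 * a * ‖g‖ :=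
  (exists_duhamel h hV g).choose_spec.2

theorem duhamelOp_sub (h : ResolventBound V a) (hV : AEStronglyMeasurable V volume)
    (g g' : SpaceTimeL2 n) : duhamelOp h hV (g - g') = duhamelOp h hV g - duhamelOp h hV g' := by
  refine SpaceTimeL2.ext_slices ?_
  filter_upwards [duhamelOp_slices h hV (g - g'), duhamelOp_slices h hV g,
    duhamelOp_slices h hV g', slices_ae_eq (ν := volume) (μ := volume)
      (Lp.coeFn_sub (duhamelOp h hV g) (duhamelOp h hV g'))] with t h1 h2 h3 h4
  filter_upwards [h1, h2, h3, h4, Lp.coeFn_sub (duhamelCurve h hV g t) (duhamelCurve h hV g' t)]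
    with x h1 h2 h3 h4 h5
  rw [h1, h4, Pi.sub_apply, h2, h3, duhamelCurve_sub, h5, Pi.sub_apply, mul_sub]

end Duhamel

/-! ### The propagator on Schwartz functions -/

section Test

variable {n : ℕ}

theorem fourierInv_conj_neg (h : EuclideanSpace ℝ (Fin n) → ℂ) (x : EuclideanSpace ℝ (Fin n)) :
    𝓕⁻ (fun ξ => starRingEnd ℂ (h (-ξ))) x = starRingEnd ℂ (𝓕⁻ h x) := by
  rw [Real.fourierInv_eq, Real.fourierInv_eq, ← integral_conj, ← integral_neg_eq_self]
  refine integral_congr_ae (Eventually.of_forall fun ξ => ?_)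
  simp only [neg_neg, inner_neg_left, Circle.smul_def, smul_eq_mul, map_mul]
  congr 1
  rw [AddChar.map_neg_eq_inv, Circle.coe_inv_eq_conj]

theorem propagatorSymbol_neg_right (t : ℝ) (ξ : EuclideanSpace ℝ (Fin n)) :
    propagatorSymbol t (-ξ) = propagatorSymbol t ξ := by
  simp [propagatorSymbol]

theorem conj_propagatorSymbol (t : ℝ) (ξ : EuclideanSpace ℝ (Fin n)) :
    starRingEnd ℂ (propagatorSymbol t ξ) = propagatorSymbol (-t) ξ := by
  simp only [propagatorSymbol, ← Complex.exp_conj]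
  rw [map_mul, map_neg, Complex.conj_ofReal, Complex.conj_I]
  congr 1
  push_cast
  ring

theorem continuous_propagatorSymbol_right (t : ℝ) :
    Continuous fun ξ : EuclideanSpace ℝ (Fin n) => propagatorSymbol t ξ :=
  continuous_propagatorSymbol.comp (Continuous.prodMk_right t)

/-- Multiplication by the propagator symbol, or its reflection, preserves integrability. -/
theorem memLp_propagatorSymbol_mul (t : ℝ) {k : EuclideanSpace ℝ (Fin n) → ℂ} {p : ℝ≥0∞}
    (hk : MemLp k p volume) : MemLp (fun ξ => propagatorSymbol t ξ * k ξ) p volume :=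
  hk.of_le ((continuous_propagatorSymbol_right t).aestronglyMeasurable.mul hk.1)
    (Eventually.of_forall fun ξ => by rw [norm_mul, norm_propagatorSymbol, one_mul])

theorem integrable_propagatorSymbol_mul (t : ℝ) {k : EuclideanSpace ℝ (Fin n) → ℂ}
    (hk : Integrable k volume) : Integrable (fun ξ => propagatorSymbol t ξ * k ξ) volume :=
  memLp_one_iff_integrable.1 (memLp_propagatorSymbol_mul t (memLp_one_iff_integrable.2 hk))

/-- Connects the abstract L² propagator with the pointwise Fourier integral through
`fourierInv_toLp_ae_eq`. -/
theorem freePropagator_toLp_ae_eq (t : ℝ) {k g : EuclideanSpace ℝ (Fin n) → ℂ}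
    (hk₁ : Integrable k volume) (hk₂ : MemLp k 2 volume) (hg : MemLp g 2 volume)
    (hgk : g = 𝓕⁻ k) :
    freePropagator t (hg.toLp g) =ᵐ[volume] 𝓕⁻ fun ξ => propagatorSymbol t ξ * k ξ := by
  have h1 : hg.toLp g = 𝓕⁻ (hk₂.toLp k) := by
    refine Lp.ext (hg.coeFn_toLp.trans ?_)
    rw [hgk]
    exact (fourierInv_toLp_ae_eq hk₁ hk₂).symm
  have h2 : freePropagator t (hg.toLp g) =
      𝓕⁻ ((memLp_propagatorSymbol_mul t hk₂).toLp _) := by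
    unfold freePropagator fourierMultiplierL2
    congr 1
    refine MemLp.toLp_congr _ _ ?_
    rw [h1, FourierTransform.fourier_fourierInv_eq]
    filter_upwards [hk₂.coeFn_toLp] with ξ hξ
    rw [hξ]
  rw [h2]
  exact fourierInv_toLp_ae_eq (integrable_propagatorSymbol_mul t hk₁) _

variable (ψ : 𝓢(EuclideanSpace ℝ (Fin n), ℂ))

theorem schwartz_eq_fourierInv_fourier :
    (ψ : EuclideanSpace ℝ (Fin n) → ℂ) = 𝓕⁻ (𝓕 (ψ : EuclideanSpace ℝ (Fin n) → ℂ)) := by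
  have := congrArg (fun φ : 𝓢(EuclideanSpace ℝ (Fin n), ℂ) => (φ : EuclideanSpace ℝ (Fin n) → ℂ))
    (FourierTransform.fourierInv_fourier_eq (F := 𝓢(EuclideanSpace ℝ (Fin n), ℂ)) ψ)
  simp only [SchwartzMap.fourierInv_coe, SchwartzMap.fourier_coe] at this
  exact this.symm

theorem integrable_fourier_schwartz :
    Integrable (𝓕 (ψ : EuclideanSpace ℝ (Fin n) → ℂ)) volume := by
  rw [← SchwartzMap.fourier_coe]
  exact (𝓕 ψ).integrable

theorem memLp_fourier_schwartz :
    MemLp (𝓕 (ψ : EuclideanSpace ℝ (Fin n) → ℂ)) 2 volume := by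
  rw [← SchwartzMap.fourier_coe]
  exact (𝓕 ψ).memLp 2 volume

theorem propagatorOnTest_zero (x : EuclideanSpace ℝ (Fin n)) : propagatorOnTest 0 ψ x = ψ x := by
  conv_rhs => rw [schwartz_eq_fourierInv_fourier ψ]
  simp only [propagatorOnTest, propagatorSymbol_zero, one_mul]

theorem memLp_conj_schwartz : MemLp (fun x => starRingEnd ℂ (ψ x)) 2 volume :=
  (ψ.memLp 2 volume).star

/-- The complex conjugate of a Schwartz function, as an element of `L²`. -/
noncomputable def conjTest : L2Space n := (memLp_conj_schwartz ψ).toLp _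

theorem integrable_conj_neg {k : EuclideanSpace ℝ (Fin n) → ℂ} (hk : Integrable k volume) :
    Integrable (fun ξ => starRingEnd ℂ (k (-ξ))) volume :=
  Complex.conjCLE.toContinuousLinearMap.integrable_comp hk.comp_neg

theorem memLp_conj_neg {k : EuclideanSpace ℝ (Fin n) → ℂ} (hk : MemLp k 2 volume) :
    MemLp (fun ξ => starRingEnd ℂ (k (-ξ))) 2 volume :=
  (hk.comp_measurePreserving (Measure.measurePreserving_neg volume)).star

/-- The symbol is even in ξ and conjugation reverses t. This converts between the bilinear pairing
of the weak formulation and the sesquilinear inner product. -/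
theorem freePropagator_conjTest (t : ℝ) : freePropagator (-t) (conjTest ψ) =ᵐ[volume]
    fun x => starRingEnd ℂ (propagatorOnTest t ψ x) := by
  refine (freePropagator_toLp_ae_eq (-t) (integrable_conj_neg (integrable_fourier_schwartz ψ))
    (memLp_conj_neg (memLp_fourier_schwartz ψ)) (memLp_conj_schwartz ψ) ?_).trans
    (Eventually.of_forall fun x => ?_)
  · funext x
    rw [fourierInv_conj_neg, ← schwartz_eq_fourierInv_fourier]
  · simp only [propagatorOnTest]
    rw [← fourierInv_conj_neg]
    simp only [map_mul, propagatorSymbol_neg_right, conj_propagatorSymbol]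

theorem integral_mul_eq_inner_conjTest (f : L2Space n) :
    ∫ x, f x * ψ x = inner ℂ (conjTest ψ) f := by
  rw [L2.inner_def]
  refine integral_congr_ae ?_
  filter_upwards [(memLp_conj_schwartz ψ).coeFn_toLp] with x hx
  rw [conjTest, hx]
  simp

theorem integral_freePropagator_mul (t : ℝ) (f : L2Space n) :
    ∫ x, freePropagator t f x * ψ x = ∫ x, f x * propagatorOnTest t ψ x := by
  rw [integral_mul_eq_inner_conjTest, ← freeFlow_apply]
  have h := (freeFlow n).inner_map_left (-t) (conjTest ψ) f
  rw [neg_neg] at h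
  rw [← h, L2.inner_def]
  refine integral_congr_ae ?_
  filter_upwards [freePropagator_conjTest ψ t] with x hx
  rw [freeFlow_apply, hx]
  simp

theorem propagatorOnTest_eq (t : ℝ) (x : EuclideanSpace ℝ (Fin n)) :
    propagatorOnTest t ψ x = ∫ ξ, (Real.fourierChar (inner ℝ ξ x) : ℂ) *
      (propagatorSymbol t ξ * 𝓕 (ψ : EuclideanSpace ℝ (Fin n) → ℂ) ξ) := by
  rw [propagatorOnTest, Real.fourierInv_eq]
  rfl

theorem continuous_propagatorOnTest :
    Continuous fun p : ℝ × EuclideanSpace ℝ (Fin n) => propagatorOnTest p.1 ψ p.2 := by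
  simp_rw [propagatorOnTest_eq]
  have hψ := integrable_fourier_schwartz ψ
  refine continuous_of_dominated (fun p => ?_) (fun p => Eventually.of_forall fun ξ => ?_)
    hψ.norm (Eventually.of_forall fun ξ => ?_)
  · have hc : Continuous fun ξ : EuclideanSpace ℝ (Fin n) =>
        (Real.fourierChar (inner ℝ ξ p.2) : ℂ) :=
      continuous_subtype_val.comp (Real.continuous_fourierChar.comp (by fun_prop))
    exact hc.aestronglyMeasurable.mul
      ((continuous_propagatorSymbol_right p.1).aestronglyMeasurable.mul hψ.1)
  · rw [norm_mul, norm_mul, Circle.norm_coe, norm_propagatorSymbol, one_mul, one_mul]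
  · have hc : Continuous fun p : ℝ × EuclideanSpace ℝ (Fin n) =>
        (Real.fourierChar (inner ℝ ξ p.2) : ℂ) :=
      continuous_subtype_val.comp (Real.continuous_fourierChar.comp (by fun_prop))
    exact hc.mul ((continuous_propagatorSymbol.comp
      (continuous_fst.prodMk continuous_const)).mul continuous_const)

theorem continuous_propagatorOnTest_left (x : EuclideanSpace ℝ (Fin n)) :
    Continuous fun t : ℝ => propagatorOnTest t ψ x :=
  Continuous.comp (g := fun p : ℝ × EuclideanSpace ℝ (Fin n) => propagatorOnTest p.1 ψ p.2)
    (f := fun t => (t, x)) (continuous_propagatorOnTest ψ) (continuous_id.prodMk continuous_const)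

theorem fourier_laplacian (ξ : EuclideanSpace ℝ (Fin n)) :
    𝓕 ((Δ ψ : 𝓢(EuclideanSpace ℝ (Fin n), ℂ)) : EuclideanSpace ℝ (Fin n) → ℂ) ξ =
      -(4 * Real.pi ^ 2 * ‖ξ‖ ^ 2 : ℝ) * 𝓕 (ψ : EuclideanSpace ℝ (Fin n) → ℂ) ξ := by
  have hg : (fun x : EuclideanSpace ℝ (Fin n) => (‖x‖ ^ 2 : ℝ)).HasTemperateGrowth := by fun_prop
  have h : 𝓕 (Δ ψ) = -(2 * Real.pi) ^ 2 • SchwartzMap.smulLeftCLM ℂ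
      (fun x : EuclideanSpace ℝ (Fin n) => (‖x‖ ^ 2 : ℝ)) (𝓕 ψ) := by
    rw [SchwartzMap.laplacian_eq_fourierMultiplierCLM, SchwartzMap.fourierMultiplierCLM_apply]
    simp
  rw [← SchwartzMap.fourier_coe, h, ← SchwartzMap.fourier_coe]
  simp [SchwartzMap.smulLeftCLM_apply_apply hg]
  ring

theorem hasDerivAt_propagatorSymbol (t : ℝ) (ξ : EuclideanSpace ℝ (Fin n)) :
    HasDerivAt (fun t : ℝ => propagatorSymbol t ξ)
      (Complex.I * (-(4 * Real.pi ^ 2 * ‖ξ‖ ^ 2 : ℝ) * propagatorSymbol t ξ)) t := by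
  unfold propagatorSymbol
  have h : HasDerivAt (fun t : ℝ => -((4 * Real.pi ^ 2 * t * ‖ξ‖ ^ 2 : ℝ) : ℂ) * Complex.I)
      (-((4 * Real.pi ^ 2 * ‖ξ‖ ^ 2 : ℝ) : ℂ) * Complex.I) t := by
    have h1 : HasDerivAt (fun t : ℝ => (4 * Real.pi ^ 2 * t * ‖ξ‖ ^ 2 : ℝ))
        (4 * Real.pi ^ 2 * ‖ξ‖ ^ 2) t := by
      have := ((hasDerivAt_id t).const_mul (4 * Real.pi ^ 2)).mul_const (‖ξ‖ ^ 2)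
      simpa using this
    exact h1.ofReal_comp.neg.mul_const _
  convert h.cexp using 1
  ring

/-- Differentiation under the Fourier integral; the t-derivative of the integrand is dominated by
the integrable transform of Δψ. -/
theorem hasDerivAt_propagatorOnTest (t : ℝ) (x : EuclideanSpace ℝ (Fin n)) :
    HasDerivAt (fun t => propagatorOnTest t ψ x) (Complex.I * propagatorOnTest t (Δ ψ) x) t := by
  simp_rw [propagatorOnTest_eq]
  rw [← integral_const_mul]
  have hψ := integrable_fourier_schwartz ψ
  have hΔ := integrable_fourier_schwartz (Δ ψ)
  have hc : Continuous fun ξ : EuclideanSpace ℝ (Fin n) =>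
      (Real.fourierChar (inner ℝ ξ x) : ℂ) :=
    continuous_subtype_val.comp (Real.continuous_fourierChar.comp (by fun_prop))
  have hm : ∀ (φ : 𝓢(EuclideanSpace ℝ (Fin n), ℂ)) (t : ℝ), AEStronglyMeasurable (fun ξ =>
      (Real.fourierChar (inner ℝ ξ x) : ℂ) * (propagatorSymbol t ξ *
        𝓕 (φ : EuclideanSpace ℝ (Fin n) → ℂ) ξ)) volume := fun φ t =>
    hc.aestronglyMeasurable.mul ((continuous_propagatorSymbol_right t).aestronglyMeasurable.mul
      (integrable_fourier_schwartz φ).1)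
  refine (hasDerivAt_integral_of_dominated_loc_of_deriv_le (μ := volume) (s := Set.univ)
    (F := fun t ξ => (Real.fourierChar (inner ℝ ξ x) : ℂ) * (propagatorSymbol t ξ *
        𝓕 (ψ : EuclideanSpace ℝ (Fin n) → ℂ) ξ))
    (F' := fun t ξ => Complex.I * ((Real.fourierChar (inner ℝ ξ x) : ℂ) * (propagatorSymbol t ξ *
        𝓕 ((Δ ψ : 𝓢(EuclideanSpace ℝ (Fin n), ℂ)) : EuclideanSpace ℝ (Fin n) → ℂ) ξ)))
    (bound := fun ξ => ‖𝓕 ((Δ ψ : 𝓢(EuclideanSpace ℝ (Fin n), ℂ)) :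
      EuclideanSpace ℝ (Fin n) → ℂ) ξ‖) Filter.univ_mem
    (Eventually.of_forall (hm ψ)) ?_ ((hm (Δ ψ) t).const_mul _) ?_ hΔ.norm ?_).2
  · refine hψ.norm.mono' (hm ψ t) (Eventually.of_forall fun ξ => ?_)
    rw [norm_mul, norm_mul, Circle.norm_coe, norm_propagatorSymbol, one_mul, one_mul]
  · refine Eventually.of_forall fun ξ s _ => ?_
    rw [norm_mul, norm_mul, norm_mul, Complex.norm_I, Circle.norm_coe, norm_propagatorSymbol,
      one_mul, one_mul, one_mul]
  · refine Eventually.of_forall fun ξ s _ => ?_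
    rw [fourier_laplacian]
    refine (((hasDerivAt_propagatorSymbol s ξ).mul_const
      (𝓕 (ψ : EuclideanSpace ℝ (Fin n) → ℂ) ξ)).const_mul
      (Real.fourierChar (inner ℝ ξ x) : ℂ)).congr_deriv ?_
    ring

theorem propagatorOnTest_sub (r t : ℝ) (x : EuclideanSpace ℝ (Fin n)) :
    propagatorOnTest t ψ x - propagatorOnTest r ψ x =
      Complex.I * ∫ s in r..t, propagatorOnTest s (Δ ψ) x := by
  rw [← intervalIntegral.integral_const_mul]
  refine (intervalIntegral.integral_eq_sub_of_hasDerivAt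
    (fun s _ => hasDerivAt_propagatorOnTest ψ s x) ?_).symm
  exact ((continuous_propagatorOnTest_left (Δ ψ) x).const_mul Complex.I).intervalIntegrable _ _

end Test

/-! ### Pairing the Duhamel integral with test functions -/

section Pairing

variable {n : ℕ} {V : EuclideanSpace ℝ (Fin n) → ℂ} {a : ℝ≥0}

theorem continuous_propagatorOnTest_comp (ψ : 𝓢(EuclideanSpace ℝ (Fin n), ℂ)) {Y : Type*}
    [TopologicalSpace Y] {τ : Y → ℝ} {y : Y → EuclideanSpace ℝ (Fin n)} (hτ : Continuous τ)
    (hy : Continuous y) : Continuous fun q => propagatorOnTest (τ q) ψ (y q) :=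
  Continuous.comp (g := fun p : ℝ × EuclideanSpace ℝ (Fin n) => propagatorOnTest p.1 ψ p.2)
    (f := fun q => (τ q, y q)) (continuous_propagatorOnTest ψ) (hτ.prodMk hy)

theorem smoothingOp_conjTest_ae_eq (h : ResolventBound V a) (hV : AEStronglyMeasurable V volume)
    (ψ : 𝓢(EuclideanSpace ℝ (Fin n), ℂ)) (t : ℝ) :
    smoothingOp h hV (freePropagator (-t) (conjTest ψ)) =ᵐ[volume]
      fun p => starRingEnd ℂ (sqrtWeight V p.2 * propagatorOnTest (t - p.1) ψ p.2) := by
  refine ae_eq_of_slices (ν := volume) (μ := volume) (Lp.aestronglyMeasurable _) ?_ ?_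
  · refine AEStronglyMeasurable.star ((aestronglyMeasurable_sqrtWeight_snd hV).mul ?_)
    exact (continuous_propagatorOnTest_comp ψ (by fun_prop) continuous_snd).aestronglyMeasurable
  · filter_upwards [smoothingOp_slices h hV (freePropagator (-t) (conjTest ψ))] with s hs
    have e : freePropagator s (freePropagator (-t) (conjTest ψ)) =
        freePropagator (-(t - s)) (conjTest ψ) := by
      have := (freeFlow n).map_add s (-t) (conjTest ψ)
      rw [show -(t - s) = s + -t by ring]
      exact this.symm
    rw [e] at hs
    filter_upwards [hs, freePropagator_conjTest ψ (t - s)] with x h1 h2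
    rw [h1, h2, map_mul]
    simp only [sqrtWeight, Complex.conj_ofReal]

/-- Kato smoothing for the datum e^{-itΔ} ψ̄, after conjugation. Hence a source |V|^{1/2} g with g
in L² pairs absolutely with the evolved test function. -/
theorem memLp_weight_propagatorOnTest (h : ResolventBound V a)
    (hV : AEStronglyMeasurable V volume) (ψ : 𝓢(EuclideanSpace ℝ (Fin n), ℂ)) (t : ℝ) :
    MemLp (fun p : ℝ × EuclideanSpace ℝ (Fin n) =>
      sqrtWeight V p.2 * propagatorOnTest (t - p.1) ψ p.2) 2 volume ∧
    eLpNorm (fun p : ℝ × EuclideanSpace ℝ (Fin n) =>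
      sqrtWeight V p.2 * propagatorOnTest (t - p.1) ψ p.2) 2 volume ≤
      ENNReal.ofReal (Real.sqrt (2 * a) * ‖conjTest ψ‖) := by
  have h1 := smoothingOp_conjTest_ae_eq h hV ψ t
  have h2 := ((Lp.memLp (smoothingOp h hV (freePropagator (-t) (conjTest ψ)))).ae_eq h1).star
  have e : (star fun p : ℝ × EuclideanSpace ℝ (Fin n) =>
      starRingEnd ℂ (sqrtWeight V p.2 * propagatorOnTest (t - p.1) ψ p.2)) =
      fun p => sqrtWeight V p.2 * propagatorOnTest (t - p.1) ψ p.2 := by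
    funext p
    simp
  rw [e] at h2
  refine ⟨h2, ?_⟩
  calc _ = eLpNorm (smoothingOp h hV (freePropagator (-t) (conjTest ψ))) 2 volume := by
        refine eLpNorm_congr_norm_ae ?_
        filter_upwards [h1] with p hp
        rw [hp, RCLike.norm_conj]
    _ = ENNReal.ofReal ‖smoothingOp h hV (freePropagator (-t) (conjTest ψ))‖ := by
        rw [ofReal_norm, Lp.enorm_def]
    _ ≤ _ := by
        refine ENNReal.ofReal_le_ofReal ((ContinuousLinearMap.le_opNorm _ _).trans ?_)
        rw [show ‖freePropagator (-t) (conjTest ψ)‖ = ‖conjTest ψ‖ from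
          (freeFlow n).norm_map (-t) _]
        exact mul_le_mul_of_nonneg_right (norm_smoothingOp_le h hV) (norm_nonneg _)

theorem integrable_source_mul (h : ResolventBound V a)
    (hV : AEStronglyMeasurable V volume) (g : SpaceTimeL2 n)
    (ψ : 𝓢(EuclideanSpace ℝ (Fin n), ℂ)) (t : ℝ) :
    Integrable (fun p : ℝ × EuclideanSpace ℝ (Fin n) =>
      sqrtWeight V p.2 * g p * propagatorOnTest (t - p.1) ψ p.2) volume := by
  have h1 : MemLp ((fun p : ℝ × EuclideanSpace ℝ (Fin n) =>
      sqrtWeight V p.2 * propagatorOnTest (t - p.1) ψ p.2) * fun p => g p) 1 volume :=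
    (Lp.memLp g).mul (memLp_weight_propagatorOnTest h hV ψ t).1
  refine (memLp_one_iff_integrable.1 h1).congr (Eventually.of_forall fun p => ?_)
  simp only [Pi.mul_apply]
  ring

/-- The group and then the adjoint are moved onto the conjugated test function, where the smoothing
operator has an explicit formula. -/
theorem integral_duhamelCurve_mul_prod (h : ResolventBound V a)
    (hV : AEStronglyMeasurable V volume) (g : SpaceTimeL2 n)
    (ψ : 𝓢(EuclideanSpace ℝ (Fin n), ℂ)) (t : ℝ) :
    ∫ x, duhamelCurve h hV g t x * ψ x = ∫ p : ℝ × EuclideanSpace ℝ (Fin n),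
      timeCutoff t p.1 * (sqrtWeight V p.2 * g p * propagatorOnTest (t - p.1) ψ p.2) := by
  rw [integral_mul_eq_inner_conjTest, duhamelCurve, ← freeFlow_apply]
  have h1 := (freeFlow n).inner_map_left (-t) (conjTest ψ)
    ((smoothingOp h hV).adjoint (timeCutoffMul t g))
  rw [neg_neg] at h1
  rw [← h1, ContinuousLinearMap.adjoint_inner_right, L2.inner_def]
  refine integral_congr_ae ?_
  filter_upwards [smoothingOp_conjTest_ae_eq h hV ψ t, coeFn_timeCutoffMul t g] with p h2 h3
  rw [freeFlow_apply, h2, h3, RCLike.inner_apply, Complex.conj_conj]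
  ring

theorem integrable_timeCutoff_mul_prod (t : ℝ) {f : ℝ × EuclideanSpace ℝ (Fin n) → ℂ}
    (hf : IntegrableOn f (Set.uIcc 0 t ×ˢ Set.univ) volume) :
    Integrable (fun p : ℝ × EuclideanSpace ℝ (Fin n) => (timeCutoff t p.1 : ℂ) * f p) volume := by
  have hs : MeasurableSet (Set.uIcc 0 t ×ˢ (Set.univ : Set (EuclideanSpace ℝ (Fin n)))) :=
    measurableSet_uIcc.prod MeasurableSet.univ
  have h1 := (integrable_indicator_iff hs).2 hf
  refine (h1.bdd_mul (c := 1) (Complex.measurable_ofReal.comp ((measurable_timeCutoff t).comp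
    measurable_fst)).aestronglyMeasurable
    (Eventually.of_forall fun p => norm_timeCutoff_le t p.1)).congr
    (Eventually.of_forall fun p => ?_)
  by_cases hp : p.1 ∈ Set.uIcc 0 t
  · simp [Set.indicator, hp]
  · have h0 : timeCutoff t p.1 = 0 := by
      simp only [Set.mem_uIcc, not_or, not_and, not_le] at hp
      simp only [timeCutoff, Set.indicator, Set.mem_Iio, Set.mem_Ioi, Set.mem_Iic, Pi.one_apply]
      split_ifs <;> grind
    simp [h0]

theorem integral_timeCutoff_mul_prod (t : ℝ) {f : ℝ × EuclideanSpace ℝ (Fin n) → ℂ}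
    (hf : IntegrableOn f (Set.uIcc 0 t ×ˢ Set.univ) volume) :
    ∫ p : ℝ × EuclideanSpace ℝ (Fin n), timeCutoff t p.1 * f p =
      ∫ s in (0 : ℝ)..t, ∫ x, f (s, x) := by
  rw [← integral_timeCutoff_smul]
  have hi := integrable_timeCutoff_mul_prod t hf
  refine (integral_prod (μ := volume) (ν := volume) _ hi).trans ?_
  refine integral_congr_ae (Eventually.of_forall fun s => ?_)
  simp only [integral_const_mul]
  rw [Complex.real_smul]

theorem integral_duhamelCurve_mul (h : ResolventBound V a)
    (hV : AEStronglyMeasurable V volume) (g : SpaceTimeL2 n)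
    (ψ : 𝓢(EuclideanSpace ℝ (Fin n), ℂ)) (t : ℝ) :
    ∫ x, duhamelCurve h hV g t x * ψ x =
      ∫ s in (0 : ℝ)..t, ∫ x, sqrtWeight V x * g (s, x) * propagatorOnTest (t - s) ψ x := by
  rw [integral_duhamelCurve_mul_prod]
  exact integral_timeCutoff_mul_prod t (integrable_source_mul h hV g ψ t).integrableOn

theorem enorm_intervalIntegral_sq_le {F : Type*} [NormedAddCommGroup F] [NormedSpace ℝ F]
    {f : ℝ → F} (hf : Continuous f) (a b : ℝ) :
    ‖∫ s in a..b, f s‖ₑ ^ 2 ≤ ENNReal.ofReal |b - a| * ∫⁻ s, ‖f s‖ₑ ^ 2 := by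
  set μ : Measure ℝ := volume.restrict (Set.uIoc a b)
  have h0 : ‖∫ s in a..b, f s‖ₑ ≤ eLpNorm f 1 μ := by
    rw [← ofReal_norm, intervalIntegral.norm_intervalIntegral_eq, ofReal_norm,
      eLpNorm_one_eq_lintegral_enorm]
    exact enorm_integral_le_lintegral_enorm _
  have h1 := eLpNorm_le_eLpNorm_mul_rpow_measure_univ (μ := μ) (f := f) (p := 1) (q := 2)
    (by norm_num) hf.aestronglyMeasurable
  have hμ : μ Set.univ = ENNReal.ofReal |b - a| := by
    simp [μ, Set.uIoc, Real.volume_Ioc, max_sub_min_eq_abs']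
    rw [abs_sub_comm]
  calc _ ≤ (eLpNorm f 2 μ * μ Set.univ ^ (1 / (1 : ℝ≥0∞).toReal - 1 / (2 : ℝ≥0∞).toReal)) ^ 2 := by
        gcongr
        exact h0.trans h1
    _ = ENNReal.ofReal |b - a| * eLpNorm f 2 μ ^ 2 := by
        rw [mul_pow, hμ, ← ENNReal.rpow_natCast, ← ENNReal.rpow_natCast, ← ENNReal.rpow_mul,
          mul_comm]
        norm_num
    _ ≤ _ := by
        rw [eLpNorm_two_sq]
        gcongr
        exact Measure.restrict_le_self

/-- The resolvent estimate makes `|V|^{1/2} ψ` square integrable for every Schwartz function. -/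
theorem memLp_weight_schwartz (h : ResolventBound V a)
    (hV : AEStronglyMeasurable V volume) (ψ : 𝓢(EuclideanSpace ℝ (Fin n), ℂ)) :
    MemLp (fun x => sqrtWeight V x * ψ x) 2 volume := by
  have hb := aestronglyMeasurable_sqrtWeight hV
  have hP := (memLp_weight_propagatorOnTest h hV ψ 0).1
  have hL := (memLp_weight_propagatorOnTest h hV (Δ ψ) 0).1
  -- Smoothing is a bound in space-time, so only almost every slice |V|^{1/2} e^{-isΔ} ψ is in L²;
  -- one such s is fixed.
  have hPt : ∀ᵐ s : ℝ, MemLp (fun x => sqrtWeight V x * propagatorOnTest (0 - s) ψ x) 2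
      volume := by
    obtain ⟨γ, -, hγ⟩ := exists_curve_of_memLp (ν := volume) (μ := volume) hP
    filter_upwards [hγ] with s hs
    exact (Lp.memLp (γ s)).ae_eq hs
  obtain ⟨s, hs⟩ := hPt.exists
  have hLc : ∀ x, Continuous fun r : ℝ => propagatorOnTest (0 - r) (Δ ψ) x := fun x =>
    continuous_propagatorOnTest_comp (Δ ψ) (by fun_prop) continuous_const
  -- To return from e^{-isΔ} ψ to ψ, integrate the time derivative, which involves Δψ;
  -- Cauchy–Schwarz in time and smoothing for Δψ control the difference.
  have hdiff : MemLp (fun x => sqrtWeight V x * ∫ r in 0..s, propagatorOnTest (0 - r) (Δ ψ) x) 2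
      volume := by
    refine ⟨hb.mul (Continuous.aestronglyMeasurable ?_), ?_⟩
    · exact intervalIntegral.continuous_parametric_intervalIntegral_of_continuous'
        (continuous_propagatorOnTest_comp (Δ ψ) (continuous_const.sub continuous_snd)
          continuous_fst) _ _
    rw [eLpNorm_two_eq]
    refine ENNReal.rpow_lt_top_of_nonneg (by norm_num) (ne_of_lt ?_)
    calc _ ≤ ∫⁻ x, ENNReal.ofReal |s - 0| *
          ∫⁻ r : ℝ, ‖sqrtWeight V x * propagatorOnTest (0 - r) (Δ ψ) x‖ₑ ^ 2 := by
          refine lintegral_mono fun x => ?_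
          rw [enorm_mul, mul_pow]
          refine (mul_le_mul_right (enorm_intervalIntegral_sq_le (hLc x) 0 s) _).trans
            (le_of_eq ?_)
          simp_rw [enorm_mul, mul_pow]
          rw [lintegral_const_mul' _ _ (ENNReal.pow_ne_top enorm_ne_top), mul_left_comm]
      _ = ENNReal.ofReal |s - 0| * ∫⁻ p : ℝ × EuclideanSpace ℝ (Fin n),
          ‖sqrtWeight V p.2 * propagatorOnTest (0 - p.1) (Δ ψ) p.2‖ₑ ^ 2 := by
          rw [lintegral_const_mul' _ _ ENNReal.ofReal_ne_top]
          congr 1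
          exact (lintegral_prod_symm (μ := volume) (ν := volume) _
            (hL.1.enorm.pow_const 2)).symm
      _ < ∞ := by
          rw [← eLpNorm_two_sq]
          exact ENNReal.mul_lt_top ENNReal.ofReal_lt_top (ENNReal.pow_lt_top hL.2)
  have e : (fun x => sqrtWeight V x * ψ x) = (fun x => sqrtWeight V x * propagatorOnTest
      (0 - s) ψ x)
      + fun x => Complex.I * (sqrtWeight V x * ∫ r in 0..s, propagatorOnTest (0 - r) (Δ ψ) x) := by
    funext x
    have h1 := propagatorOnTest_sub ψ (0 - s) 0 x
    have h2 := intervalIntegral.integral_comp_sub_left (a := 0) (b := s)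
      (fun r => propagatorOnTest r (Δ ψ) x) 0
    rw [sub_zero] at h2
    rw [propagatorOnTest_zero, sub_eq_iff_eq_add, ← h2] at h1
    rw [Pi.add_apply, h1]
    ring
  rw [e]
  exact hs.add (hdiff.const_mul _)

end Pairing

/-! ### The weak form of the equation -/

section WeakForm

variable {n : ℕ} {V : EuclideanSpace ℝ (Fin n) → ℂ} {a : ℝ≥0}

theorem integrable_prod_of_lintegral_enorm_le {α β : Type*} [MeasurableSpace α]
    [MeasurableSpace β] {μ : Measure α} [IsFiniteMeasure μ] {ν : Measure β} [SFinite ν]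
    {f : α × β → ℂ} (hf : AEStronglyMeasurable f (μ.prod ν)) {C : ℝ≥0∞} (hC : C ≠ ∞)
    (h : ∀ s, ∫⁻ y, ‖f (s, y)‖ₑ ∂ν ≤ C) : Integrable f (μ.prod ν) := by
  refine ⟨hf, ?_⟩
  rw [HasFiniteIntegral, lintegral_prod _ hf.enorm]
  refine (lintegral_mono h).trans_lt ?_
  rw [lintegral_const]
  exact ENNReal.mul_lt_top hC.lt_top (measure_lt_top μ _)

theorem lintegral_enorm_mul_le {α : Type*} [MeasurableSpace α] {μ : Measure α} {f g : α → ℂ}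
    (hf : AEStronglyMeasurable f μ) (hg : AEStronglyMeasurable g μ) :
    ∫⁻ x, ‖f x * g x‖ₑ ∂μ ≤ eLpNorm f 2 μ * eLpNorm g 2 μ := by
  have h := eLpNorm_smul_le_mul_eLpNorm (p := 2) (q := 2) (r := 1) hg hf
  rwa [eLpNorm_one_eq_lintegral_enorm] at h

theorem eLpNorm_propagatorOnTest (ψ : 𝓢(EuclideanSpace ℝ (Fin n), ℂ)) (t : ℝ) :
    eLpNorm (propagatorOnTest t ψ) 2 volume = ‖conjTest ψ‖ₑ := by
  have h : ‖freePropagator (-t) (conjTest ψ)‖ₑ = ‖conjTest ψ‖ₑ := by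
    rw [← ofReal_norm, show ‖freePropagator (-t) (conjTest ψ)‖ = ‖conjTest ψ‖ from
      (freeFlow n).norm_map (-t) _, ofReal_norm]
  rw [← h, Lp.enorm_def]
  refine eLpNorm_congr_norm_ae ?_
  filter_upwards [freePropagator_conjTest ψ t] with x hx
  rw [hx, RCLike.norm_conj]

/-- The free evolution solves the free Schrödinger equation weakly. -/
theorem integral_freePropagator_mul_eq (u₀ : L2Space n) (ψ : 𝓢(EuclideanSpace ℝ (Fin n), ℂ))
    (t : ℝ) : ∫ x, freePropagator t u₀ x * ψ x = (∫ x, u₀ x * ψ x) +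
      Complex.I * ∫ s in (0 : ℝ)..t, ∫ x, freePropagator s u₀ x * (Δ ψ) x := by
  have hi : Integrable (Function.uncurry fun (s : ℝ) (x : EuclideanSpace ℝ (Fin n)) =>
      u₀ x * propagatorOnTest s (Δ ψ) x)
      ((volume.restrict (Set.uIoc 0 t)).prod volume) := by
    have : IsFiniteMeasure ((volume : Measure ℝ).restrict (Set.uIoc 0 t)) :=
      ⟨by simp [Set.uIoc]⟩
    refine integrable_prod_of_lintegral_enorm_le
      ((Lp.aestronglyMeasurable u₀).comp_snd.mul
        (continuous_propagatorOnTest (Δ ψ)).aestronglyMeasurable)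
      (C := ‖u₀‖ₑ * ‖conjTest (Δ ψ)‖ₑ) (ENNReal.mul_ne_top enorm_ne_top enorm_ne_top) fun s => ?_
    have hc : Continuous (propagatorOnTest s (Δ ψ)) :=
      continuous_propagatorOnTest_comp (Δ ψ) continuous_const continuous_id
    refine (lintegral_enorm_mul_le (Lp.aestronglyMeasurable u₀)
      hc.aestronglyMeasurable).trans (le_of_eq ?_)
    rw [eLpNorm_propagatorOnTest, Lp.enorm_def u₀]
  -- With the propagator on the test function, the claim is the fundamental theorem of calculus for
  -- s ↦ e^{isΔ} ψ at each x, plus Fubini.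
  simp_rw [integral_freePropagator_mul]
  rw [intervalIntegral_integral_swap hi, ← integral_const_mul, ← integral_add]
  · refine integral_congr_ae (Eventually.of_forall fun x => ?_)
    have h := propagatorOnTest_sub ψ 0 t x
    rw [propagatorOnTest_zero, sub_eq_iff_eq_add] at h
    simp only [intervalIntegral.integral_const_mul]
    rw [h]
    ring
  · exact (Lp.memLp u₀).integrable_mul (ψ.memLp 2 volume)
  · simp_rw [intervalIntegral.intervalIntegral_eq_integral_uIoc]
    exact (hi.integral_prod_right.smul _).const_mul _

theorem timeCutoff_eq_ite (t s : ℝ) : timeCutoff t s =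
    if 0 < s then if s < t then 1 else 0 else if t < s then -1 else 0 := by
  simp only [timeCutoff, Set.indicator, Set.mem_Iio, Set.mem_Ioi, Set.mem_Iic, Pi.one_apply]
  by_cases h : 0 < s
  · simp [h, not_le.2 h]
  · simp only [h, not_lt.1 h, if_true, if_false]
    split_ifs <;> norm_num

/-- Oriented form of the change of order on a triangle: s runs from 0 to t and r from 0 to s exactly
when r runs from 0 to t and s from r to t, signs included. The diagonal is excluded because of the
half-open endpoints. -/
theorem timeCutoff_mul_timeCutoff {t r s : ℝ} (h : s ≠ r) :
    timeCutoff t s * timeCutoff s r = timeCutoff t r * timeCutoff (t - r) (s - r) := by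
  simp only [timeCutoff_eq_ite, sub_pos, sub_lt_sub_iff_right]
  rcases lt_or_gt_of_ne h with h | h
  · simp only [h, h.not_gt, if_false, if_true]
    by_cases hr : 0 < r
    · simp only [hr, if_true, mul_zero]
      split_ifs <;> first | (exfalso; linarith) | norm_num
    · simp only [hr, not_lt.2 (h.le.trans (not_lt.1 hr)), if_false]
      split_ifs <;> first | (exfalso; linarith) | norm_num
  · simp only [h, h.not_gt, if_false, if_true]
    split_ifs <;> first | (exfalso; linarith) | norm_num

theorem intervalIntegral_timeCutoff_smul {F : Type*} [NormedAddCommGroup F] [NormedSpace ℝ F]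
    (t r : ℝ) (f : ℝ → F) : ∫ s in (0 : ℝ)..t, timeCutoff s r • f (s - r) =
      timeCutoff t r • ∫ s in (0 : ℝ)..(t - r), f s := by
  rw [← integral_timeCutoff_smul, ← integral_timeCutoff_smul, ← integral_smul,
    ← integral_sub_right_eq_self (fun s => timeCutoff t r • timeCutoff (t - r) s • f s) r]
  refine integral_congr_ae ?_
  filter_upwards [Measure.ae_ne volume r] with s hs
  rw [smul_smul, smul_smul]
  rw [timeCutoff_mul_timeCutoff hs]

theorem measurable_timeCutoff_uncurry : Measurable fun q : ℝ × ℝ => timeCutoff q.1 q.2 := by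
  have e : (fun q : ℝ × ℝ => timeCutoff q.1 q.2) = fun q =>
      (({q | q.2 < q.1} ∩ {q | 0 < q.2} : Set (ℝ × ℝ)).indicator 1 q : ℝ) -
        ({q | q.1 < q.2} ∩ {q | q.2 ≤ 0} : Set (ℝ × ℝ)).indicator 1 q := by
    funext q
    simp only [timeCutoff, Set.indicator, Set.mem_Iio, Set.mem_Ioi, Set.mem_Iic, Set.mem_inter_iff,
      Set.mem_ofPred_eq, Pi.one_apply, ite_and]
  rw [e]
  refine (measurable_one.indicator ?_).sub (measurable_one.indicator ?_)
  · exact (measurableSet_lt measurable_snd measurable_fst).inter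
      (measurableSet_lt measurable_const measurable_snd)
  · exact (measurableSet_lt measurable_fst measurable_snd).inter
      (measurableSet_le measurable_snd measurable_const)

theorem integrableOn_source_mul_schwartz (h : ResolventBound V a)
    (hV : AEStronglyMeasurable V volume) (g : SpaceTimeL2 n)
    (ψ : 𝓢(EuclideanSpace ℝ (Fin n), ℂ)) (t : ℝ) :
    IntegrableOn (fun p : ℝ × EuclideanSpace ℝ (Fin n) => sqrtWeight V p.2 * g p * ψ p.2)
      (Set.uIcc 0 t ×ˢ Set.univ) volume := by
  have : IsFiniteMeasure ((volume : Measure ℝ).restrict (Set.uIcc 0 t)) :=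
    ⟨by simp [Set.uIcc]⟩
  have h1 := (memLp_weight_schwartz h hV ψ).comp_snd ((volume : Measure ℝ).restrict (Set.uIcc 0 t))
  have h2 : (volume : Measure (ℝ × EuclideanSpace ℝ (Fin n))).restrict
      (Set.uIcc 0 t ×ˢ Set.univ) = ((volume : Measure ℝ).restrict (Set.uIcc 0 t)).prod volume := by
    rw [Measure.volume_eq_prod, ← Measure.prod_restrict, Measure.restrict_univ]
  rw [← h2] at h1
  refine (((Lp.memLp g).restrict _).integrable_mul h1).congr (Eventually.of_forall fun p => ?_)
  simp only [Pi.mul_apply]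
  ring

/-- The Duhamel integral solves the inhomogeneous Schrödinger equation weakly. -/
theorem integral_duhamelCurve_mul_eq (h : ResolventBound V a)
    (hV : AEStronglyMeasurable V volume) (g : SpaceTimeL2 n)
    (ψ : 𝓢(EuclideanSpace ℝ (Fin n), ℂ)) (t : ℝ) :
    ∫ x, duhamelCurve h hV g t x * ψ x =
      Complex.I * (∫ s in (0 : ℝ)..t, ∫ x, duhamelCurve h hV g s x * (Δ ψ) x) +
        ∫ s in (0 : ℝ)..t, ∫ x, sqrtWeight V x * g (s, x) * ψ x := by
  have hi : Integrable (Function.uncurry fun (s : ℝ) (p : ℝ × EuclideanSpace ℝ (Fin n)) =>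
      (timeCutoff s p.1 : ℂ) *
        (sqrtWeight V p.2 * g p * propagatorOnTest (s - p.1) (Δ ψ) p.2))
      ((volume.restrict (Set.uIoc 0 t)).prod volume) := by
    have : IsFiniteMeasure ((volume : Measure ℝ).restrict (Set.uIoc 0 t)) :=
      ⟨by simp [Set.uIoc]⟩
    have hσ := aestronglyMeasurable_sqrtWeight_snd hV
    refine integrable_prod_of_lintegral_enorm_le ?_
      (C := ‖g‖ₑ * ENNReal.ofReal (Real.sqrt (2 * a) * ‖conjTest (Δ ψ)‖))
      (ENNReal.mul_ne_top enorm_ne_top ENNReal.ofReal_ne_top) fun s => ?_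
    · refine AEStronglyMeasurable.mul ?_ ((hσ.comp_snd.mul
        (Lp.aestronglyMeasurable g).comp_snd).mul ?_)
      · exact (Complex.measurable_ofReal.comp (measurable_timeCutoff_uncurry.comp
          (measurable_fst.prodMk (measurable_fst.comp measurable_snd)))).aestronglyMeasurable
      · exact (continuous_propagatorOnTest_comp (Δ ψ)
          (continuous_fst.sub (continuous_fst.comp continuous_snd))
          (continuous_snd.comp continuous_snd)).aestronglyMeasurable
    · have hP := memLp_weight_propagatorOnTest h hV (Δ ψ) s
      refine le_trans (lintegral_mono fun p => ?_) ((lintegral_enorm_mul_le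
        (Lp.aestronglyMeasurable g) hP.1.1).trans ?_)
      · simp only [Function.uncurry]
        rw [show g p * (sqrtWeight V p.2 * propagatorOnTest (s - p.1) (Δ ψ) p.2) =
          sqrtWeight V p.2 * g p * propagatorOnTest (s - p.1) (Δ ψ) p.2 by ring,
          ← ofReal_norm, ← ofReal_norm, norm_mul]
        exact ENNReal.ofReal_le_ofReal
          (mul_le_of_le_one_left (norm_nonneg _) (norm_timeCutoff_le s p.1))
      · rw [Lp.enorm_def]
        gcongr
        exact hP.2
  simp_rw [integral_duhamelCurve_mul_prod]
  rw [intervalIntegral_integral_swap hi]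
  have hψ := integrableOn_source_mul_schwartz h hV g ψ t
  have hψ' := integrable_timeCutoff_mul_prod t hψ
  have hP := integrable_timeCutoff_mul_prod t (integrable_source_mul h hV g ψ t).integrableOn
  rw [← integral_timeCutoff_mul_prod t hψ, ← integral_const_mul, ← sub_eq_iff_eq_add,
    ← integral_sub hP hψ']
  -- For a source at the fixed point p, the integral in s of the evolved Δψ is, up to the factor i,
  -- e^{i(t-p.1)Δ} ψ - ψ; the term ψ yields the inhomogeneity.
  refine integral_congr_ae (Eventually.of_forall fun p => ?_)
  have h1 := intervalIntegral_timeCutoff_smul t p.1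
    (fun s => sqrtWeight V p.2 * g p * propagatorOnTest s (Δ ψ) p.2)
  simp only [Complex.real_smul] at h1
  have h2 := propagatorOnTest_sub ψ 0 (t - p.1) p.2
  rw [propagatorOnTest_zero, sub_eq_iff_eq_add] at h2
  rw [intervalIntegral.integral_const_mul] at h1
  simp only
  rw [h1, h2]
  ring

end WeakForm

/-! ### The fixed-point problem and well-posedness -/

section CauchyProblem

variable {n : ℕ} {V : EuclideanSpace ℝ (Fin n) → ℂ} {a : ℝ≥0}

/-- The phase `V / |V|` of a potential, equal to `0` where `V` vanishes. -/
noncomputable def phase {α : Type*} (V : α → ℂ) (x : α) : ℂ := V x / ‖V x‖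

theorem norm_phase_le {α : Type*} (V : α → ℂ) (x : α) : ‖phase V x‖ ≤ 1 := by
  rw [phase, norm_div, Complex.norm_real, norm_norm]
  exact div_self_le_one _

theorem sqrtWeight_mul_phase_mul_sqrtWeight {α : Type*} (V : α → ℂ) (x : α) :
    sqrtWeight V x * (phase V x * sqrtWeight V x) = V x := by
  have h1 : sqrtWeight V x * sqrtWeight V x = (‖V x‖ : ℂ) := by
    rw [sqrtWeight, ← Complex.ofReal_mul, Real.mul_self_sqrt (norm_nonneg _)]
  rw [mul_left_comm, h1, phase]
  by_cases h : V x = 0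
  · simp [h]
  · exact div_mul_cancel₀ _ (by simpa using h)

/-- Multiplication of a space-time function by the phase of the potential. -/
noncomputable def phaseMul (hV : AEStronglyMeasurable V volume) :
    SpaceTimeL2 n →L[ℂ] SpaceTimeL2 n :=
  mulL2 (fun p : ℝ × EuclideanSpace ℝ (Fin n) => phase V p.2) (by
    have h : AEMeasurable (fun p : ℝ × EuclideanSpace ℝ (Fin n) => V p.2) volume :=
      hV.comp_snd.aemeasurable
    exact (h.div (Complex.measurable_ofReal.comp_aemeasurable h.norm)).aestronglyMeasurable)
    1 fun p => norm_phase_le V p.2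

theorem coeFn_phaseMul (hV : AEStronglyMeasurable V volume) (v : SpaceTimeL2 n) :
    phaseMul hV v =ᵐ[volume] fun p => phase V p.2 * v p :=
  coeFn_mulL2 _ _ v

theorem norm_phaseMul_le (hV : AEStronglyMeasurable V volume) (v : SpaceTimeL2 n) :
    ‖phaseMul hV v‖ ≤ ‖v‖ := by
  refine Lp.norm_le_norm_of_ae_le ?_
  filter_upwards [coeFn_phaseMul hV v] with p hp
  rw [hp, norm_mul]
  exact mul_le_of_le_one_left (norm_nonneg _) (norm_phase_le V p.2)

theorem weightedL2Norm_eq_eLpNorm (u : ℝ × EuclideanSpace ℝ (Fin n) → ℂ) :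
    weightedL2Norm volume (fun p => ‖V p.2‖ₑ) u =
      eLpNorm (fun p => sqrtWeight V p.2 * u p) 2 volume := by
  rw [weightedL2Norm, eLpNorm_two_eq]
  simp_rw [enorm_mul, mul_pow, enorm_sqrtWeight_sq, mul_comm]

theorem memWeightedL2_iff_memLp (hV : AEStronglyMeasurable V volume)
    {u : ℝ × EuclideanSpace ℝ (Fin n) → ℂ} (hu : AEStronglyMeasurable u volume) :
    MemWeightedL2 volume (fun p => ‖V p.2‖ₑ) u ↔
      MemLp (fun p => sqrtWeight V p.2 * u p) 2 volume := by
  rw [MemWeightedL2, weightedL2Norm_eq_eLpNorm, MemLp]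
  exact ⟨fun h => ⟨(aestronglyMeasurable_sqrtWeight_snd hV).mul hu, h.2⟩, fun h => ⟨hu, h.2⟩⟩

/-- A source in `L²(|V|⁻¹)` is `|V|^{1/2}` times a function in `L²`. -/
theorem exists_source_factor (hV : AEStronglyMeasurable V volume)
    {F : ℝ × EuclideanSpace ℝ (Fin n) → ℂ}
    (hF : MemWeightedL2 volume (fun p => ‖V p.2‖ₑ⁻¹) F) :
    ∃ f : SpaceTimeL2 n, F =ᵐ[volume] (fun p => sqrtWeight V p.2 * f p) ∧
      ‖f‖ₑ = weightedL2Norm volume (fun p => ‖V p.2‖ₑ⁻¹) F := by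
  have hσ := aestronglyMeasurable_sqrtWeight_snd hV
  have hVm : AEMeasurable (fun p : ℝ × EuclideanSpace ℝ (Fin n) => V p.2) volume :=
    hV.comp_snd.aemeasurable
  have hint : ∫⁻ p : ℝ × EuclideanSpace ℝ (Fin n), ‖F p‖ₑ ^ 2 * ‖V p.2‖ₑ⁻¹ ≠ ∞ := by
    intro h
    have := hF.2
    rw [weightedL2Norm, h, ENNReal.top_rpow_of_pos (by norm_num)] at this
    exact lt_irrefl _ this
  have hfin : ∀ᵐ p : ℝ × EuclideanSpace ℝ (Fin n), ‖F p‖ₑ ^ 2 * ‖V p.2‖ₑ⁻¹ < ∞ :=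
    ae_lt_top' ((hF.1.enorm.pow_const 2).mul hVm.enorm.inv) hint
  -- The weight is infinite where V vanishes, so finiteness of the norm forces F = 0 there, and the
  -- quotient by the weight loses nothing.
  have hz : ∀ᵐ p : ℝ × EuclideanSpace ℝ (Fin n), V p.2 = 0 → F p = 0 := by
    filter_upwards [hfin] with p hp h0
    by_contra hne
    have h1 : ‖F p‖ₑ ^ 2 ≠ 0 := pow_ne_zero 2 (enorm_ne_zero.2 hne)
    rw [h0, enorm_zero, ENNReal.inv_zero, ENNReal.mul_top h1] at hp
    exact lt_irrefl _ hp
  have hne : ∀ {p : ℝ × EuclideanSpace ℝ (Fin n)}, V p.2 ≠ 0 → sqrtWeight V p.2 ≠ 0 := by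
    intro p hp h0
    have := enorm_sqrtWeight_sq V p.2
    rw [h0, enorm_zero] at this
    exact hp (enorm_eq_zero.1 (by simpa using this.symm))
  have hm : AEStronglyMeasurable (fun p => F p / sqrtWeight V p.2) volume :=
    (hF.1.aemeasurable.div hσ.aemeasurable).aestronglyMeasurable
  have hn : eLpNorm (fun p => F p / sqrtWeight V p.2) 2 volume =
      weightedL2Norm volume (fun p => ‖V p.2‖ₑ⁻¹) F := by
    rw [weightedL2Norm, eLpNorm_two_eq]
    congr 1
    refine lintegral_congr_ae ?_
    filter_upwards [hz] with p hp
    by_cases h0 : V p.2 = 0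
    · simp [hp h0]
    · rw [div_eq_mul_inv, enorm_mul, enorm_inv (hne h0), mul_pow, ← enorm_sqrtWeight_sq V,
        ENNReal.inv_pow]
  have hf : MemLp (fun p => F p / sqrtWeight V p.2) 2 volume := ⟨hm, hn ▸ hF.2⟩
  refine ⟨hf.toLp _, ?_, by rw [Lp.enorm_def, eLpNorm_congr_ae hf.coeFn_toLp, hn]⟩
  filter_upwards [hf.coeFn_toLp, hz] with p h1 h2
  rw [h1]
  by_cases h0 : V p.2 = 0
  · simp [h2 h0]
  · exact (mul_div_cancel₀ _ (hne h0)).symm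

/-- The curve `e^{itΔ} u₀ - i ∫₀ᵗ e^{i(t-s)Δ} |V|^{1/2} g(s) ds` in `L²(ℝⁿ)`. -/
noncomputable def evolutionCurve (h : ResolventBound V a) (hV : AEStronglyMeasurable V volume)
    (u₀ : L2Space n) (g : SpaceTimeL2 n) (t : ℝ) : L2Space n :=
  freePropagator t u₀ - Complex.I • duhamelCurve h hV g t

/-- The product of `|V|^{1/2}` with `evolutionCurve`, as an element of `L²(ℝ × ℝⁿ)`. -/
noncomputable def weightedEvolution (h : ResolventBound V a)
    (hV : AEStronglyMeasurable V volume) (u₀ : L2Space n) (g : SpaceTimeL2 n) : SpaceTimeL2 n :=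
  smoothingOp h hV u₀ - Complex.I • duhamelOp h hV g

variable (h : ResolventBound V a) (hV : AEStronglyMeasurable V volume)

theorem weightedEvolution_slices (u₀ : L2Space n) (g : SpaceTimeL2 n) :
    ∀ᵐ t : ℝ, (fun x => weightedEvolution h hV u₀ g (t, x)) =ᵐ[volume]
      fun x => sqrtWeight V x * evolutionCurve h hV u₀ g t x := by
  filter_upwards [smoothingOp_slices h hV u₀, duhamelOp_slices h hV g,
    slices_ae_eq (ν := volume) (μ := volume)
      (Lp.coeFn_sub (smoothingOp h hV u₀) (Complex.I • duhamelOp h hV g)),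
    slices_ae_eq (ν := volume) (μ := volume) (Lp.coeFn_smul Complex.I (duhamelOp h hV g))]
    with t h1 h2 h3 h4
  filter_upwards [h1, h2, h3, h4,
    Lp.coeFn_sub (freePropagator t u₀) (Complex.I • duhamelCurve h hV g t),
    Lp.coeFn_smul Complex.I (duhamelCurve h hV g t)] with x h1 h2 h3 h4 h5 h6
  rw [weightedEvolution, evolutionCurve, h3, Pi.sub_apply, h4, Pi.smul_apply, h1, h2, h5,
    Pi.sub_apply, h6, Pi.smul_apply, smul_eq_mul, smul_eq_mul]
  ring

theorem continuous_evolutionCurve (u₀ : L2Space n) (g : SpaceTimeL2 n) :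
    Continuous (evolutionCurve h hV u₀ g) :=
  (continuous_freePropagator u₀).sub ((continuous_duhamelCurve h hV g).const_smul Complex.I)

theorem evolutionCurve_zero (u₀ : L2Space n) (g : SpaceTimeL2 n) :
    evolutionCurve h hV u₀ g 0 = u₀ := by
  rw [evolutionCurve, duhamelCurve_zero, smul_zero, sub_zero]
  exact (freeFlow n).map_zero u₀

theorem norm_evolutionCurve_le (u₀ : L2Space n) (g : SpaceTimeL2 n) (t : ℝ) :
    ‖evolutionCurve h hV u₀ g t‖ ≤ ‖u₀‖ + Real.sqrt (2 * a) * ‖g‖ := by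
  refine (norm_sub_le _ _).trans (add_le_add ((freeFlow n).norm_map t u₀).le ?_)
  rw [norm_smul, Complex.norm_I, one_mul]
  exact norm_duhamelCurve_le h hV g t

theorem norm_weightedEvolution_le (u₀ : L2Space n) (g : SpaceTimeL2 n) :
    ‖weightedEvolution h hV u₀ g‖ ≤ Real.sqrt (2 * a) * ‖u₀‖ + 2 * a * ‖g‖ := by
  refine (norm_sub_le _ _).trans (add_le_add ?_ ?_)
  · exact ((smoothingOp h hV).le_opNorm u₀).trans
      (mul_le_mul_of_nonneg_right (norm_smoothingOp_le h hV) (norm_nonneg _))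
  · rw [norm_smul, Complex.norm_I, one_mul]
    exact norm_duhamelOp_le h hV g

theorem norm_weightedEvolution_sub_le (u₀ : L2Space n) (g g' : SpaceTimeL2 n) :
    ‖weightedEvolution h hV u₀ g - weightedEvolution h hV u₀ g'‖ ≤ 2 * a * ‖g - g'‖ := by
  rw [weightedEvolution, weightedEvolution, sub_sub_sub_cancel_left, ← smul_sub, norm_smul,
    Complex.norm_I, one_mul, ← duhamelOp_sub, ← norm_neg (g - g'), neg_sub]
  exact norm_duhamelOp_le h hV _

/-- The Duhamel equation for `v = |V|^{1/2} u` is a contraction for small potentials. -/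
theorem contractingWith_weightedEvolution (ha : 2 * a ≤ 1 / 2) (u₀ : L2Space n)
    (f : SpaceTimeL2 n) :
    ContractingWith (2 * a) fun v => weightedEvolution h hV u₀ (phaseMul hV v + f) := by
  refine ⟨ha.trans_lt (by norm_num), LipschitzWith.of_dist_le_mul fun v w => ?_⟩
  rw [dist_eq_norm, dist_eq_norm]
  refine (norm_weightedEvolution_sub_le h hV u₀ _ _).trans ?_
  rw [add_sub_add_right_eq_sub, ← _root_.map_sub, NNReal.coe_mul, NNReal.coe_ofNat]
  exact mul_le_mul_of_nonneg_left (norm_phaseMul_le hV _) (by positivity)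

theorem integral_evolutionCurve_mul_schwartz (u₀ : L2Space n) (g : SpaceTimeL2 n)
    (ψ : 𝓢(EuclideanSpace ℝ (Fin n), ℂ)) (t : ℝ) :
    ∫ x, evolutionCurve h hV u₀ g t x * ψ x = (∫ x, freePropagator t u₀ x * ψ x) -
      Complex.I * ∫ x, duhamelCurve h hV g t x * ψ x := by
  simp_rw [integral_mul_eq_inner_conjTest]
  rw [evolutionCurve, inner_sub_right, inner_smul_right]

theorem continuous_integral_mul_schwartz {γ : ℝ → L2Space n} (hγ : Continuous γ)
    (ψ : 𝓢(EuclideanSpace ℝ (Fin n), ℂ)) : Continuous fun t => ∫ x, γ t x * ψ x := by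
  simp_rw [integral_mul_eq_inner_conjTest]
  exact continuous_const.inner hγ

theorem integral_evolutionCurve_mul_eq (u₀ : L2Space n) (g : SpaceTimeL2 n)
    (ψ : 𝓢(EuclideanSpace ℝ (Fin n), ℂ)) (t : ℝ) :
    ∫ x, evolutionCurve h hV u₀ g t x * ψ x = (∫ x, u₀ x * ψ x) +
      Complex.I * (∫ s in (0 : ℝ)..t, ∫ x, evolutionCurve h hV u₀ g s x * (Δ ψ) x) -
        Complex.I * ∫ s in (0 : ℝ)..t, ∫ x, sqrtWeight V x * g (s, x) * ψ x := by
  have h1 := (continuous_integral_mul_schwartz (continuous_freePropagator u₀)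
    (Δ ψ)).intervalIntegrable (μ := volume) 0 t
  have h2 := (continuous_integral_mul_schwartz (continuous_duhamelCurve h hV g)
    (Δ ψ)).intervalIntegrable (μ := volume) 0 t
  simp_rw [integral_evolutionCurve_mul_schwartz]
  rw [intervalIntegral.integral_sub h1 (h2.const_mul _), intervalIntegral.integral_const_mul,
    integral_freePropagator_mul_eq, integral_duhamelCurve_mul_eq]
  ring

theorem intervalIntegral_congr_of_ae_eq {G H : ℝ × EuclideanSpace ℝ (Fin n) → ℂ}
    (hGH : G =ᵐ[volume] H) (K : ℝ → EuclideanSpace ℝ (Fin n) → ℂ) (t : ℝ) :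
    ∫ s in (0 : ℝ)..t, ∫ x, G (s, x) * K s x = ∫ s in (0 : ℝ)..t, ∫ x, H (s, x) * K s x := by
  refine intervalIntegral.integral_congr_ae ?_
  filter_upwards [slices_ae_eq (ν := volume) (μ := volume) hGH] with s hs _
  refine integral_congr_ae ?_
  filter_upwards [hs] with x hx
  rw [hx]

theorem ae_eq_of_integral_mul_schwartz {f g : EuclideanSpace ℝ (Fin n) → ℂ}
    (hf : LocallyIntegrable f volume) (hg : LocallyIntegrable g volume)
    (hfg : ∀ ψ : 𝓢(EuclideanSpace ℝ (Fin n), ℂ), HasCompactSupport ψ →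
      ∫ x, f x * ψ x = ∫ x, g x * ψ x) : f =ᵐ[volume] g := by
  refine ae_eq_of_integral_contDiff_smul_eq hf hg fun φ hφ hφs => ?_
  have hc : HasCompactSupport fun x => (φ x : ℂ) := hφs.comp_left (g := Complex.ofReal) rfl
  have key := hfg (hc.toSchwartzMap (Complex.ofRealCLM.contDiff.comp hφ)) hc
  simp only [Complex.real_smul]
  refine Eq.trans ?_ (key.trans ?_) <;>
  exact integral_congr_ae (Eventually.of_forall fun x => mul_comm _ _)

variable {F : ℝ × EuclideanSpace ℝ (Fin n) → ℂ} {u₀ : L2Space n} {g : SpaceTimeL2 n}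
  {u : ℝ × EuclideanSpace ℝ (Fin n) → ℂ}

theorem isDuhamelSolution_of_slices (hu : AEStronglyMeasurable u volume)
    (hus : ∀ᵐ t : ℝ, evolutionCurve h hV u₀ g t =ᵐ[volume] fun x => u (t, x))
    (hg : (fun p => V p.2 * u p + F p) =ᵐ[volume] fun p => sqrtWeight V p.2 * g p) :
    IsDuhamelSolution V F u₀ u where
  memWeightedL2 := by
    rw [memWeightedL2_iff_memLp hV hu]
    refine (Lp.memLp (weightedEvolution h hV u₀ g)).ae_eq
      (ae_eq_of_slices (ν := volume) (μ := volume) (Lp.aestronglyMeasurable _)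
        ((aestronglyMeasurable_sqrtWeight_snd hV).mul hu) ?_)
    filter_upwards [hus, weightedEvolution_slices h hV u₀ g] with t h1 h2
    filter_upwards [h1, h2] with x h1 h2
    rw [h2, h1]
  locallyIntegrable := by
    filter_upwards [hus] with t ht
    exact ((Lp.memLp (evolutionCurve h hV u₀ g t)).ae_eq ht).locallyIntegrable (by norm_num)
  duhamel := by
    filter_upwards [hus] with t ht ψ _
    constructor
    · refine ((integrable_source_mul h hV g ψ t).congr ?_).integrableOn
      filter_upwards [hg] with p hp
      rw [hp]
    · rw [intervalIntegral_congr_of_ae_eq hg (fun s x => propagatorOnTest (t - s) ψ x),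
        ← integral_duhamelCurve_mul h hV g ψ t, ← integral_evolutionCurve_mul_schwartz]
      refine integral_congr_ae ?_
      filter_upwards [ht] with x hx
      rw [hx]

theorem solvesWeakly_evolutionCurve
    (hg : (fun p => V p.2 * u p + F p) =ᵐ[volume] fun p => sqrtWeight V p.2 * g p) :
    SolvesWeakly V F u (evolutionCurve h hV u₀ g) := by
  intro t ψ
  constructor
  · refine (integrableOn_source_mul_schwartz h hV g ψ t).congr (ae_restrict_of_ae ?_)
    filter_upwards [hg] with p hp
    rw [hp]
  · rw [intervalIntegral_congr_of_ae_eq hg (fun _ x => ψ x), evolutionCurve_zero]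
    exact integral_evolutionCurve_mul_eq h hV u₀ g ψ t

/-- Compactly supported test functions identify the locally integrable slice, so every solution is,
for almost every t, the evolution curve of its own source. -/
theorem IsDuhamelSolution.slices (hu : IsDuhamelSolution V F u₀ u)
    (hg : (fun p => V p.2 * u p + F p) =ᵐ[volume] fun p => sqrtWeight V p.2 * g p) :
    ∀ᵐ t : ℝ, evolutionCurve h hV u₀ g t =ᵐ[volume] fun x => u (t, x) := by
  filter_upwards [hu.locallyIntegrable, hu.duhamel] with t h1 h2
  refine ae_eq_of_integral_mul_schwartz ((Lp.memLp _).locallyIntegrable (by norm_num)) h1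
    fun ψ hψ => ?_
  rw [(h2 ψ hψ).2, intervalIntegral_congr_of_ae_eq hg (fun s x => propagatorOnTest (t - s) ψ x),
    ← integral_duhamelCurve_mul h hV g ψ t, ← integral_evolutionCurve_mul_schwartz]

/-- Uses V = |V|^{1/2} · phase · |V|^{1/2}: the whole right-hand side is |V|^{1/2} times an L²
function depending on u only through v. -/
theorem source_ae_eq {v f : SpaceTimeL2 n}
    (hf : F =ᵐ[volume] fun p => sqrtWeight V p.2 * f p)
    (hv : v =ᵐ[volume] fun p => sqrtWeight V p.2 * u p) :
    (fun p => V p.2 * u p + F p) =ᵐ[volume]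
      fun p => sqrtWeight V p.2 * (phaseMul hV v + f : SpaceTimeL2 n) p := by
  filter_upwards [hf, hv, coeFn_phaseMul hV v, Lp.coeFn_add (phaseMul hV v) f] with p h1 h2 h3 h4
  rw [h4, Pi.add_apply, h3, h2, h1]
  linear_combination -(u p) * sqrtWeight_mul_phase_mul_sqrtWeight V p.2

/-- Well-posedness of the Cauchy problem for a potential with a small resolvent bound. -/
theorem exists_duhamelSolution (h : ResolventBound V a) (hV : AEStronglyMeasurable V volume)
    (ha : 2 * a ≤ 1 / 2) (u₀ : L2Space n) {f : SpaceTimeL2 n}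
    (hf : F =ᵐ[volume] fun p => sqrtWeight V p.2 * f p) :
    ∃ u : ℝ × EuclideanSpace ℝ (Fin n) → ℂ, IsDuhamelSolution V F u₀ u ∧
      (∀ w, IsDuhamelSolution V F u₀ w → w =ᵐ[volume] u) ∧
      (∃ U : ℝ → L2Space n, Continuous U ∧ U 0 = u₀ ∧
        (∀ᵐ t : ℝ, (fun x => u (t, x)) =ᵐ[volume] U t) ∧ SolvesWeakly V F u U ∧
        ∀ t, ‖U t‖ ≤ 2 * ‖u₀‖ + 2 * Real.sqrt (2 * a) * ‖f‖) ∧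
      weightedL2Norm volume (fun p => ‖V p.2‖ₑ) u ≤
        ENNReal.ofReal (2 * Real.sqrt (2 * a) * ‖u₀‖ + 4 * a * ‖f‖) := by
  have ha' : 2 * (a : ℝ) ≤ 1 / 2 := by exact_mod_cast ha
  have hΦ := contractingWith_weightedEvolution h hV ha u₀ f
  set v := ContractingWith.fixedPoint _ hΦ with hv_def
  have hv : weightedEvolution h hV u₀ (phaseMul hV v + f) = v := hΦ.fixedPoint_isFixedPt
  set g := phaseMul hV v + f with hg_def
  have hgn : ‖g‖ ≤ ‖v‖ + ‖f‖ :=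
    (norm_add_le _ _).trans (add_le_add (norm_phaseMul_le hV v) le_rfl)
  -- The term 2a ‖v‖ ≤ ‖v‖/2 is absorbed on the left, which doubles the remaining constants.
  have hvn : ‖v‖ ≤ 2 * Real.sqrt (2 * a) * ‖u₀‖ + 4 * a * ‖f‖ := by
    have h1 := norm_weightedEvolution_le h hV u₀ g
    rw [hv] at h1
    have h2 : 2 * (a : ℝ) * ‖g‖ ≤ 2 * a * (‖v‖ + ‖f‖) :=
      mul_le_mul_of_nonneg_left hgn (by positivity)
    have h3 : 2 * (a : ℝ) * ‖v‖ ≤ 1 / 2 * ‖v‖ := mul_le_mul_of_nonneg_right ha' (norm_nonneg _)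
    linarith
  have hUn := norm_evolutionCurve_le h hV u₀ g
  obtain ⟨u, hu, hus⟩ := exists_slices_of_continuous (continuous_evolutionCurve h hV u₀ g) hUn
  have hvu : v =ᵐ[volume] fun p => sqrtWeight V p.2 * u p := by
    refine ae_eq_of_slices (ν := volume) (μ := volume) (Lp.aestronglyMeasurable _)
      ((aestronglyMeasurable_sqrtWeight_snd hV).mul hu) ?_
    filter_upwards [hus, weightedEvolution_slices h hV u₀ g] with t h1 h2
    rw [hv] at h2
    filter_upwards [h1, h2] with x h1 h2
    rw [h2, h1]
  have hg := source_ae_eq hV hf hvu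
  refine ⟨u, isDuhamelSolution_of_slices h hV hu hus hg, fun w hw => ?_,
    ⟨evolutionCurve h hV u₀ g, continuous_evolutionCurve h hV u₀ g,
      evolutionCurve_zero h hV u₀ g, hus.mono fun t ht => ht.symm,
      solvesWeakly_evolutionCurve h hV hg, fun t => (hUn t).trans ?_⟩, ?_⟩
  -- Weighting another solution w gives a fixed point, hence v. Then w and u have the same source,
  -- and so the same evolution curve.
  · have hwm := hw.memWeightedL2
    have hwL := (memWeightedL2_iff_memLp hV hwm.1).1 hwm
    have hgw := source_ae_eq hV hf hwL.coeFn_toLp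
    have hws := hw.slices h hV hgw
    have hfix : weightedEvolution h hV u₀ (phaseMul hV (hwL.toLp _) + f) = hwL.toLp _ := by
      refine SpaceTimeL2.ext_slices ?_
      filter_upwards [hws, weightedEvolution_slices h hV u₀ (phaseMul hV (hwL.toLp _) + f),
        slices_ae_eq (ν := volume) (μ := volume) hwL.coeFn_toLp] with t h1 h2 h3
      filter_upwards [h1, h2, h3] with x h1 h2 h3
      rw [h2, h1, h3]
    rw [hΦ.fixedPoint_unique hfix, ← hv_def, ← hg_def] at hws
    refine ae_eq_of_slices (ν := volume) (μ := volume) hwm.1 hu ?_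
    filter_upwards [hws, hus] with t h1 h2
    exact h1.symm.trans h2
  · have hs := Real.sqrt_nonneg (2 * (a : ℝ))
    have hs2 := Real.mul_self_sqrt (show 0 ≤ 2 * (a : ℝ) by positivity)
    -- Inserting the bound for v gives terms 4a ‖u₀‖ and 4a √(2a) ‖f‖; since 4a ≤ 1 they are at most
    -- ‖u₀‖ and √(2a) ‖f‖.
    have h1 : Real.sqrt (2 * a) * ‖g‖ ≤ Real.sqrt (2 * a) *
        (2 * Real.sqrt (2 * a) * ‖u₀‖ + 4 * a * ‖f‖ + ‖f‖) :=
      mul_le_mul_of_nonneg_left (hgn.trans (by linarith)) hs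
    have h2 : 2 * (a : ℝ) * ‖u₀‖ ≤ 1 / 2 * ‖u₀‖ := mul_le_mul_of_nonneg_right ha' (norm_nonneg _)
    have h3 : 2 * (a : ℝ) * (Real.sqrt (2 * a) * ‖f‖) ≤ 1 / 2 * (Real.sqrt (2 * a) * ‖f‖) :=
      mul_le_mul_of_nonneg_right ha' (by positivity)
    have h4 : Real.sqrt (2 * a) * (2 * Real.sqrt (2 * a) * ‖u₀‖ + 4 * a * ‖f‖ + ‖f‖) =
        2 * (2 * a * ‖u₀‖) + 2 * (2 * a * (Real.sqrt (2 * a) * ‖f‖)) +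
          Real.sqrt (2 * a) * ‖f‖ := by
      linear_combination 2 * ‖u₀‖ * hs2
    linarith
  · rw [weightedL2Norm_eq_eLpNorm, ← eLpNorm_congr_ae hvu, ← Lp.enorm_def, ← ofReal_norm]
    exact ENNReal.ofReal_le_ofReal hvn

end CauchyProblem

/-! ### Choice of constants and conclusion -/

theorem mainTheorem7 (n : ℕ) (hn : 2 ≤ n)
    (R : Set (EuclideanSpace ℝ (Fin n) → ℂ))
    (br : (EuclideanSpace ℝ (Fin n) → ℂ) → ℝ≥0)
    (hR : IsResolventType R br) :
    ∃ ε : ℝ≥0, 0 < ε ∧ ∃ C : ℝ≥0, ∀ V ∈ R, br V < ε →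
      ∀ (u₀ : L2Space n) (F : ℝ × EuclideanSpace ℝ (Fin n) → ℂ),
        MemWeightedL2 volume (fun p => ‖V p.2‖ₑ⁻¹) F →
        ∃ u : ℝ × EuclideanSpace ℝ (Fin n) → ℂ,
          IsDuhamelSolution V F u₀ u ∧
          (∀ w : ℝ × EuclideanSpace ℝ (Fin n) → ℂ,
            IsDuhamelSolution V F u₀ w → w =ᵐ[volume] u) ∧
          (∃ U : ℝ → L2Space n,
            Continuous U ∧ U 0 = u₀ ∧
            (∀ᵐ t : ℝ, (fun x => u (t, x)) =ᵐ[volume] U t) ∧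
            SolvesWeakly V F u U ∧
            (∀ t : ℝ, ‖U t‖ₑ ≤ (C : ℝ≥0∞) * ‖u₀‖ₑ +
              (C : ℝ≥0∞) * (NNReal.sqrt (br V) : ℝ≥0∞) *
                weightedL2Norm volume (fun p => ‖V p.2‖ₑ⁻¹) F)) ∧
          weightedL2Norm volume (fun p => ‖V p.2‖ₑ) u ≤
            (C : ℝ≥0∞) * (NNReal.sqrt (br V) : ℝ≥0∞) * ‖u₀‖ₑ +
              (C : ℝ≥0∞) * (br V : ℝ≥0∞) *
                weightedL2Norm volume (fun p => ‖V p.2‖ₑ⁻¹) F := by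
  obtain ⟨hm, A, hA⟩ := hR
  -- The threshold gives 2A [V] ≤ 1/2, with A + 1 keeping it meaningful when A = 0. The constant C
  -- is the sum of the three constants 2, 2√(2A) and 4A of the estimates.
  refine ⟨(4 * (A + 1))⁻¹, by positivity, 2 + 2 * NNReal.sqrt (2 * A) + 4 * A,
    fun V hVR hε u₀ F hF => ?_⟩
  have hV := hm V hVR
  have h : ResolventBound V (A * br V) := fun z hz f hf => by
    rw [ENNReal.coe_mul]
    exact hA V hVR z hz f hf
  have ha : 2 * (A * br V) ≤ 1 / 2 := by
    have h1 : br V * (4 * (A + 1)) ≤ 1 := by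
      calc _ ≤ (4 * (A + 1))⁻¹ * (4 * (A + 1)) := mul_le_mul_left hε.le _
        _ = 1 := inv_mul_cancel₀ (by positivity)
    have h2 : (br V : ℝ) * (4 * (A + 1)) ≤ 1 := by exact_mod_cast h1
    have h3 : 2 * ((A : ℝ) * br V) ≤ 1 / 2 := by nlinarith [(br V).coe_nonneg]
    exact_mod_cast h3
  obtain ⟨f, hf, hfn⟩ := exists_source_factor hV hF
  have hs : Real.sqrt (2 * ((A * br V : ℝ≥0) : ℝ)) =
      ((NNReal.sqrt (2 * A) * NNReal.sqrt (br V) : ℝ≥0) : ℝ) := by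
    rw [← NNReal.sqrt_mul, Real.coe_sqrt]
    congr 1
    push_cast
    ring
  obtain ⟨u, h1, h2, ⟨U, h3, h4, h5, h6, h7⟩, h8⟩ := exists_duhamelSolution h hV ha u₀ hf
  refine ⟨u, h1, h2, ⟨U, h3, h4, h5, h6, fun t => ?_⟩, h8.trans ?_⟩
  · rw [← hfn, enorm_eq_nnnorm, enorm_eq_nnnorm, enorm_eq_nnnorm]
    have h9 := h7 t
    rw [hs] at h9
    have h10 : ‖U t‖₊ ≤ 2 * ‖u₀‖₊ + 2 * (NNReal.sqrt (2 * A) * NNReal.sqrt (br V)) * ‖f‖₊ := by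
      exact_mod_cast h9
    refine le_trans (ENNReal.coe_le_coe.2 (h10.trans (?_ : _ ≤
      (2 + 2 * NNReal.sqrt (2 * A) + 4 * A) * ‖u₀‖₊ +
        (2 + 2 * NNReal.sqrt (2 * A) + 4 * A) * NNReal.sqrt (br V) * ‖f‖₊))) (by push_cast; rfl)
    rw [← mul_assoc]
    gcongr
    · rw [add_assoc]; exact le_self_add
    · rw [add_right_comm]; exact le_add_self
  · rw [← hfn, enorm_eq_nnnorm, enorm_eq_nnnorm, hs]
    refine le_trans (le_of_eq ?_) (le_trans (ENNReal.coe_le_coe.2 (?_ :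
      2 * (NNReal.sqrt (2 * A) * NNReal.sqrt (br V)) * ‖u₀‖₊ + 4 * (A * br V) * ‖f‖₊ ≤
      (2 + 2 * NNReal.sqrt (2 * A) + 4 * A) * NNReal.sqrt (br V) * ‖u₀‖₊ +
        (2 + 2 * NNReal.sqrt (2 * A) + 4 * A) * br V * ‖f‖₊)) (by push_cast; rfl))
    · rw [← ENNReal.ofReal_coe_nnreal]
      congr 1
    · rw [← mul_assoc, ← mul_assoc]
      gcongr
      · rw [add_right_comm]; exact le_add_self
      · exact le_add_self
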